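/- Let $d,N\in\mathbb N$, let $\Omega_0$ be a compact metrizable space, $\Omega=\Omega_0^{\mathbb Z^d}$ with the product topology and the shifts $(\tau_y\omega)_x=\omega_{x-y}$, and let $C_N(\Omega)$ be the $C^*$-algebra of continuous functions $\Omega\to M_N(\mathbb C)$. Let $\phi$ be a real antisymmetric $d\times d$ matrix and let $\mathcal A_d=C^*(C_N(\Omega),u_1,\dots,u_d)$ be the universal unital $C^*$-algebra generated by $C_N(\Omega)$ and unitaries $u_1,\dots,u_d$ with $u_iu_j=e^{\mathrm i\phi_{ij}}u_ju_i$ and $f\,u_j=u_j\,(f\circ\tau_{e_j})$ for $f\in C_N(\Omega)$. For $\lambda\in\mathbb T^d$ let $\rho_\lambda$ be the automorphism of $\mathcal A_d$ that fixes $C_N(\Omega)$ and sends $u_j\mapsto\lambda_j^{-1}u_j$. For $x\in\mathbb Z^d$ put $u_x=e^{-\frac{\mathrm i}{2}\sum_{i<j}\phi_{ij}x_ix_j}u_1^{x_1}\cdots u_d^{x_d}$, and let $$a_x=\Big[\int_{\mathbb T^d}\lambda^x\rho_\lambda(a)\,d\mu(\lambda)\Big]u_x^*\in C_N(\Omega)$$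 be the Fourier coefficients of $a\in\mathcal A_d$ ($\mu$ the normalized Haar measure). Let $V_M=\{x\in\mathbb Z^d:|x_j|\le M,\ j=1,\dots,d\}$, so $|V_M|=(2M+1)^d$. Consider the following conditions on $a\in\mathcal A_d$. (a1) The map $\lambda\mapsto\rho_\lambda(a)$ is infinitely differentiable in norm. (a2) For every $K\in\mathbb N$ there is a constant $0<A_K<\infty$ such that for all $M\in\mathbb N$ and all $\omega,\omega'\in\Omega$ with $\omega_y=\omega'_y$ for $y\in V_M$, $$\|a_x(\omega)-a_x(\omega')\|\le\frac{A_K}{(1+|V_M|)^K}\qquad\text{for all }x\in\mathbb Z^d,$$ where the norm on the left is the operator norm on $M_N(\mathbb C)$. Let $\mathcal S$ be the set of all $a\in\mathcal A_d$ that satisfy both (a1) and (a2). Then: 1. If $a,b\in\mathcal S$, then $ab\in\mathcal S$. 2. If $a\in\mathcal S$ is invertible in $\mathcal A_d$, then $a^{-1}\in\mathcal S$. 3. $\mathcal S$ is a unital subalgebra of $\mathcal A_d$. 4. $\mathcal S$ is stable under the holomorphic functional calculus: if $a\in\mathcal S$ and $f$ is holomorphic on an open set $U\supseteq\sigma(a)$,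 then $f(a)=\frac1{2\pi\mathrm i}\oint_\Gamma f(z)(z-a)^{-1}dz\in\mathcal S$, where $\Gamma$ is any cycle of closed $C^1$ curves in $U\setminus\sigma(a)$ with winding number $1$ about each point of $\sigma(a)$ and $0$ about each point outside $U$. 5. $\mathcal S$ is stable under the $C^\infty$ functional calculus of self-adjoint elements: if $h=h^*\in\mathcal S$ and $G$ is a complex-valued $C^\infty$ function on an open set of $\mathbb R$ that contains $\sigma(h)$, then $G(h)\in\mathcal S$. -/

import Mathlib

open Set
open scoped ENNReal Matrix.Norms.L2Operator

universe u

/-! ## Disorder configurations and the matrix-valued functions on them -/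

/-- The Tychonov space `Ω = ∏_{x ∈ ℤ^d} Ω₀` of disorder configurations (product topology). -/
abbrev Config (d : ℕ) (Ω₀ : Type u) : Type u := (Fin d → ℤ) → Ω₀

/-- `C_N(Ω)`: continuous functions from `Ω` to the `N × N` complex matrices, the latter with the
`C⋆`-norm (the operator norm on `ℂ^N`). -/
abbrev CN (d N : ℕ) (Ω₀ : Type u) [TopologicalSpace Ω₀] : Type u :=
  C(Config d Ω₀, Matrix (Fin N) (Fin N) ℂ)

/-- The shift `(τ_y ω)_x = ω_{x - y}`. -/
def shift {d : ℕ} {Ω₀ : Type u} [TopologicalSpace Ω₀] (y : Fin d → ℤ) :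
    C(Config d Ω₀, Config d Ω₀) where
  toFun ω := fun x => ω (x - y)
  continuous_toFun := by fun_prop

noncomputable section

/-! ## The universal `C⋆`-algebra `𝒜_d` -/

/-- A family of elements of a nonzero unital `C⋆`-algebra, indexed by the elements of `C_N(Ω)` and
by `j = 1, …, d`, which satisfies all the relations that define the algebra of bulk observables:
those of `C_N(Ω)`, unitarity of the `u_j`, `u_i u_j = e^{i φ_ij} u_j u_i`, and
`f u_j = u_j (f ∘ τ_{e_j})`. -/
structure CovRep (d N : ℕ) (Ω₀ : Type u) [TopologicalSpace Ω₀]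
    (φ : Matrix (Fin d) (Fin d) ℝ) : Type (u + 1) where
  carrier : Type u
  [cstar : CStarAlgebra carrier]
  [nontriv : Nontrivial carrier]
  ofFun : CN d N Ω₀ →⋆ₐ[ℂ] carrier
  gen : Fin d → carrier
  gen_star_mul : ∀ j, star (gen j) * gen j = 1
  gen_mul_star : ∀ j, gen j * star (gen j) = 1
  gen_comm : ∀ i j, gen i * gen j = Complex.exp (Complex.I * φ i j) • (gen j * gen i)
  ofFun_gen : ∀ (f : CN d N Ω₀) (j : Fin d),
    ofFun f * gen j = gen j * ofFun (f.comp (shift (Pi.single j 1)))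

attribute [instance] CovRep.cstar CovRep.nontriv

section Algebra

variable (d N : ℕ) (Ω₀ : Type u) [TopologicalSpace Ω₀] (φ : Matrix (Fin d) (Fin d) ℝ)

/-- The bounded families `(b_R)_R`, one component in the target of each `R : CovRep`, with the
norm `sup_R ‖b_R‖`. -/
abbrev RepProd : Type (u + 1) := lp (fun R : CovRep d N Ω₀ φ => R.carrier) ∞

instance : CStarAlgebra (RepProd d N Ω₀ φ) where

variable {d N Ω₀ φ}

theorem CovRep.norm_ofFun_le [CompactSpace Ω₀] (R : CovRep d N Ω₀ φ) (f : CN d N Ω₀) :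
    ‖R.ofFun f‖ ≤ ‖f‖ :=
  NonUnitalStarAlgHom.norm_apply_le R.ofFun f

theorem CovRep.norm_gen (R : CovRep d N Ω₀ φ) (j : Fin d) : ‖R.gen j‖ = 1 :=
  CStarRing.norm_of_mem_unitary ⟨R.gen_star_mul j, R.gen_mul_star j⟩

variable (φ) in
/-- The family of all images of `f ∈ C_N(Ω)`. -/
def prodFun [CompactSpace Ω₀] (f : CN d N Ω₀) : RepProd d N Ω₀ φ :=
  ⟨fun R => R.ofFun f, memℓp_infty ⟨‖f‖, by rintro _ ⟨R, rfl⟩; exact R.norm_ofFun_le f⟩⟩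

variable (N Ω₀ φ) in
/-- The family of all images of the generator `u_j`. -/
def prodGen (j : Fin d) : RepProd d N Ω₀ φ :=
  ⟨fun R => R.gen j, memℓp_infty ⟨1, by rintro _ ⟨R, rfl⟩; exact (R.norm_gen j).le⟩⟩

variable (d N Ω₀ φ) in
/-- The universal `C⋆`-algebra `𝒜_d = C⋆(C_N(Ω), u_1, …, u_d)` as a `C⋆`-subalgebra: the closed
`⋆`-subalgebra that the universal families `prodFun f`, `prodGen j` generate. The norm of
a noncommutative polynomial in the generators is thus the supremum of its norms in all `C⋆`-algebras
in which the relations are realised. -/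
def bulkSub [CompactSpace Ω₀] : StarSubalgebra ℂ (RepProd d N Ω₀ φ) :=
  (StarAlgebra.adjoin ℂ (range (prodFun φ) ∪ range (prodGen N Ω₀ φ))).topologicalClosure

variable (d N Ω₀ φ) in
/-- The algebra `𝒜_d` of bulk physical observables. -/
abbrev Bulk [CompactSpace Ω₀] : Type (u + 1) := bulkSub d N Ω₀ φ

instance [CompactSpace Ω₀] : IsClosed (bulkSub d N Ω₀ φ : Set (RepProd d N Ω₀ φ)) :=
  StarSubalgebra.isClosed_topologicalClosure _

instance [CompactSpace Ω₀] : CStarAlgebra (Bulk d N Ω₀ φ) :=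
  StarSubalgebra.cstarAlgebra (bulkSub d N Ω₀ φ)

variable [CompactSpace Ω₀]

theorem prodFun_mem (f : CN d N Ω₀) : prodFun φ f ∈ bulkSub d N Ω₀ φ :=
  StarSubalgebra.le_topologicalClosure _ (StarAlgebra.subset_adjoin ℂ _ (Or.inl ⟨f, rfl⟩))

theorem prodGen_mem (j : Fin d) : prodGen N Ω₀ φ j ∈ bulkSub d N Ω₀ φ :=
  StarSubalgebra.le_topologicalClosure _ (StarAlgebra.subset_adjoin ℂ _ (Or.inr ⟨j, rfl⟩))

variable (φ) in
/-- The canonical homomorphism `C_N(Ω) → 𝒜_d`. -/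
def bulkFun : CN d N Ω₀ →⋆ₐ[ℂ] Bulk d N Ω₀ φ where
  toFun f := ⟨prodFun φ f, prodFun_mem f⟩
  map_one' := by ext R; exact map_one R.ofFun
  map_mul' f g := by ext R; exact map_mul R.ofFun f g
  map_zero' := by ext R; exact map_zero R.ofFun
  map_add' f g := by ext R; exact map_add R.ofFun f g
  commutes' c := by ext R; exact AlgHomClass.commutes R.ofFun c
  map_star' f := by ext R; exact map_star R.ofFun f

variable (N Ω₀ φ) in
/-- The generator `u_j`, a unitary element of `𝒜_d`. -/
def bulkGen (j : Fin d) : unitary (Bulk d N Ω₀ φ) :=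
  ⟨⟨prodGen N Ω₀ φ j, prodGen_mem j⟩, by
    constructor
    · ext R; exact R.gen_star_mul j
    · ext R; exact R.gen_mul_star j⟩

theorem bulkGen_comm (i j : Fin d) :
    (bulkGen N Ω₀ φ i : Bulk d N Ω₀ φ) * bulkGen N Ω₀ φ j
      = Complex.exp (Complex.I * φ i j) • ((bulkGen N Ω₀ φ j : Bulk d N Ω₀ φ)
          * bulkGen N Ω₀ φ i) := by
  ext R; exact R.gen_comm i j

theorem bulkFun_gen (f : CN d N Ω₀) (j : Fin d) :
    bulkFun φ f * (bulkGen N Ω₀ φ j : Bulk d N Ω₀ φ)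
      = bulkGen N Ω₀ φ j * bulkFun φ (f.comp (shift (Pi.single j 1))) := by
  ext R; exact R.ofFun_gen f j

/-- The component at `R`, as a `⋆`-homomorphism. -/
def evalRep (R : CovRep d N Ω₀ φ) : RepProd d N Ω₀ φ →⋆ₐ[ℂ] R.carrier where
  toFun b := b R
  map_one' := rfl
  map_mul' _ _ := rfl
  map_zero' := rfl
  map_add' _ _ := rfl
  commutes' _ := rfl
  map_star' _ := rfl

/-- The universal property of `𝒜_d`. -/
theorem existsUnique_lift (R : CovRep d N Ω₀ φ) :
    ∃! F : Bulk d N Ω₀ φ →⋆ₐ[ℂ] R.carrier,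
      (∀ f, F (bulkFun φ f) = R.ofFun f) ∧ ∀ j, F (bulkGen N Ω₀ φ j) = R.gen j := by
  refine ⟨(evalRep R).comp (bulkSub d N Ω₀ φ).subtype, ⟨fun _ => rfl, fun _ => rfl⟩, ?_⟩
  rintro F ⟨h1, h2⟩
  have cont : ∀ T : Bulk d N Ω₀ φ →⋆ₐ[ℂ] R.carrier, Continuous T := fun T =>
    AddMonoidHomClass.continuous_of_bound T 1 fun x => by
      simpa using NonUnitalStarAlgHom.norm_apply_le T x
  refine StarAlgHom.ext_topologicalClosure (cont _) (cont _) ?_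
  refine StarAlgHom.ext_adjoin ?_
  rintro ⟨x, hx'⟩ (⟨f, rfl⟩ | ⟨j, rfl⟩)
  · exact h1 f
  · exact h2 j

/-! ## The torus action and the Fourier coefficients -/

/-- The relations are preserved when each `u_j` is multiplied by `λ_j⁻¹`, `|λ_j| = 1`. -/
abbrev CovRep.twist (l : Fin d → Circle) (R : CovRep d N Ω₀ φ) : CovRep d N Ω₀ φ where
  carrier := R.carrier
  ofFun := R.ofFun
  gen j := (((l j)⁻¹ : Circle) : ℂ) • R.gen j
  gen_star_mul j := by
    rw [star_smul, smul_mul_smul_comm, R.gen_star_mul j, Complex.star_def,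
      ← Complex.normSq_eq_conj_mul_self, Circle.normSq_coe, Complex.ofReal_one, one_smul]
  gen_mul_star j := by
    rw [star_smul, smul_mul_smul_comm, R.gen_mul_star j, Complex.star_def, mul_comm,
      ← Complex.normSq_eq_conj_mul_self, Circle.normSq_coe, Complex.ofReal_one, one_smul]
  gen_comm i j := by
    rw [smul_mul_smul_comm, smul_mul_smul_comm, R.gen_comm i j, smul_comm,
      mul_comm (((l i)⁻¹ : Circle) : ℂ)]
  ofFun_gen f j := by
    rw [mul_smul_comm, smul_mul_assoc, R.ofFun_gen f j]

/-- Reindexing of the components along `R ↦ R.twist λ`. -/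
def prodGauge (l : Fin d → Circle) : RepProd d N Ω₀ φ →⋆ₐ[ℂ] RepProd d N Ω₀ φ where
  toFun b := ⟨fun R => b (R.twist l), by
    refine memℓp_infty ⟨‖b‖, ?_⟩
    rintro _ ⟨R, rfl⟩
    exact lp.norm_apply_le_norm ENNReal.top_ne_zero b (R.twist l)⟩
  map_one' := rfl
  map_mul' _ _ := rfl
  map_zero' := rfl
  map_add' _ _ := rfl
  commutes' _ := rfl
  map_star' _ := rfl

theorem prodGauge_mem (l : Fin d → Circle) {b : RepProd d N Ω₀ φ} (hb : b ∈ bulkSub d N Ω₀ φ) :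
    prodGauge l b ∈ bulkSub d N Ω₀ φ := by
  have cont : Continuous (prodGauge (φ := φ) (N := N) (Ω₀ := Ω₀) l) :=
    AddMonoidHomClass.continuous_of_bound _ 1 fun x => by
      simpa using NonUnitalStarAlgHom.norm_apply_le (prodGauge (φ := φ) l) x
  suffices h : bulkSub d N Ω₀ φ ≤ (bulkSub d N Ω₀ φ).comap (prodGauge (φ := φ) l) from h hb
  refine StarSubalgebra.topologicalClosure_minimal ?_
    ((StarSubalgebra.isClosed_topologicalClosure _).preimage cont)
  refine StarAlgebra.adjoin_le ?_
  rintro _ (⟨f, rfl⟩ | ⟨j, rfl⟩)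
  · exact (prodFun_mem f : prodFun φ f ∈ bulkSub d N Ω₀ φ)
  · have : prodGauge l (prodGen N Ω₀ φ j) = (((l j)⁻¹ : Circle) : ℂ) • prodGen N Ω₀ φ j := rfl
    change prodGauge l (prodGen N Ω₀ φ j) ∈ bulkSub d N Ω₀ φ
    rw [this]
    exact (bulkSub d N Ω₀ φ).smul_mem (prodGen_mem j) _

/-- The torus action `ρ_λ` on `𝒜_d`: the `⋆`-endomorphism that fixes `C_N(Ω)` and sends
`u_j ↦ λ_j⁻¹ u_j`, see `bulkGauge_bulkFun` and `bulkGauge_bulkGen`. -/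
def bulkGauge (l : Fin d → Circle) : Bulk d N Ω₀ φ →⋆ₐ[ℂ] Bulk d N Ω₀ φ :=
  ((prodGauge l).comp (bulkSub d N Ω₀ φ).subtype).codRestrict (bulkSub d N Ω₀ φ)
    fun b => prodGauge_mem l b.2

theorem bulkGauge_bulkFun (l : Fin d → Circle) (f : CN d N Ω₀) :
    bulkGauge l (bulkFun φ f) = bulkFun φ f := rfl

theorem bulkGauge_bulkGen (l : Fin d → Circle) (j : Fin d) :
    bulkGauge l (bulkGen N Ω₀ φ j : Bulk d N Ω₀ φ)
      = (((l j)⁻¹ : Circle) : ℂ) • (bulkGen N Ω₀ φ j : Bulk d N Ω₀ φ) := rfl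

variable (N Ω₀ φ) in
/-- The monomial `u_x` of the symmetric presentation: `u_1^{x_1} ⋯ u_d^{x_d}` times the phase for
which `u_x⋆ = u_{-x}`. -/
def bulkMonomial (x : Fin d → ℤ) : Bulk d N Ω₀ φ :=
  Complex.exp (-(Complex.I / 2) *
      ∑ i : Fin d, ∑ j : Fin d, if i < j then (φ i j * x i * x j : ℂ) else 0) •
    (((List.ofFn fun j => bulkGen N Ω₀ φ j ^ x j).prod : unitary (Bulk d N Ω₀ φ)) :
      Bulk d N Ω₀ φ)

/-- The Fourier coefficient `Φ_x(a) = [∫_{𝕋^d} λ^x ρ_λ(a) dμ(λ)] u_x⋆`, `μ` the normalized Haar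
measure of the torus. (`mFourierCoeff F n` is the Haar integral of `λ^{-n} F(λ)`.) -/
def bulkFourierCoeff (x : Fin d → ℤ) (a : Bulk d N Ω₀ φ) : Bulk d N Ω₀ φ :=
  UnitAddTorus.mFourierCoeff
      (fun t : UnitAddTorus (Fin d) => bulkGauge (fun j => AddCircle.toCircle (t j)) a) (-x) *
    star (bulkMonomial N Ω₀ φ x)

/-! ## The two assumptions -/

/-- `a ∈ 𝒜_d^∞ = ⋂ₙ Cⁿ(𝒜_d)`: the map `λ ↦ ρ_λ(a)` on the torus is `n` times continuously
differentiable for every `n`. -/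
def IsSmoothElement (a : Bulk d N Ω₀ φ) : Prop :=
  ∀ n : ℕ, ContDiff ℝ n fun θ : Fin d → ℝ => bulkGauge (fun j => Circle.exp (θ j)) a

/-- The cube `V_M = {x ∈ ℤ^d : |x_j| ≤ M for all j}`. -/
def cube (d M : ℕ) : Finset (Fin d → ℤ) := Finset.Icc (fun _ => -(M : ℤ)) (fun _ => (M : ℤ))

/-- The Fourier coefficients of `a`, viewed as functions `h x ∈ C_N(Ω)`, are localized with respect
to the disorder configuration. -/
def IsLocalizedElement (a : Bulk d N Ω₀ φ) : Prop :=
  ∃ h : (Fin d → ℤ) → CN d N Ω₀, (∀ x, bulkFun φ (h x) = bulkFourierCoeff x a) ∧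
    ∀ K : ℕ, ∃ A : ℝ, 0 < A ∧ ∀ (M : ℕ) (ω ω' : Config d Ω₀), (∀ y ∈ cube d M, ω y = ω' y) →
      ∀ x, ‖h x ω - h x ω'‖ ≤ A / (1 + ((cube d M).card : ℝ)) ^ K

/-- Both assumptions together. -/
def IsSmoothLocalized (a : Bulk d N Ω₀ φ) : Prop := IsSmoothElement a ∧ IsLocalizedElement a

end Algebra

/-! ## Holomorphic functional calculus -/

/-- `b = f(a)` in the sense of the holomorphic functional calculus: `b` is
`(2πi)⁻¹ ∮_Γ f(z) (z - a)⁻¹ dz` for a cycle `Γ` of closed `C¹` curves in `U \ σ(a)` which winds once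
around each point of `σ(a)` and zero times around each point outside `U`. -/
def IsHolomorphicCalculus {A : Type*} [CStarAlgebra A] (U : Set ℂ) (f : ℂ → ℂ) (a b : A) : Prop :=
  ∃ (n : ℕ) (γ : Fin n → ℝ → ℂ),
    (∀ k, ContDiffOn ℝ 1 (γ k) (Icc 0 1)) ∧ (∀ k, γ k 0 = γ k 1) ∧
    (∀ k, ∀ t ∈ Icc (0 : ℝ) 1, γ k t ∈ U \ spectrum ℂ a) ∧
    (∀ w ∈ spectrum ℂ a,
      (2 * Real.pi * Complex.I)⁻¹ * ∑ k, ∫ t in (0 : ℝ)..1, deriv (γ k) t / (γ k t - w) = 1) ∧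
    (∀ w ∉ U,
      (2 * Real.pi * Complex.I)⁻¹ * ∑ k, ∫ t in (0 : ℝ)..1, deriv (γ k) t / (γ k t - w) = 0) ∧
    b = (2 * Real.pi * Complex.I)⁻¹ •
      ∑ k, ∫ t in (0 : ℝ)..1, (deriv (γ k) t * f (γ k t)) • resolvent a (γ k t)

end

/-! ## Elements with smooth orbits -/

section SmoothOrbit

open scoped ContDiff

variable {A B E : Type*} [CStarAlgebra A] [CStarAlgebra B] [NormedAddCommGroup E] [NormedSpace ℝ E]

/-! Condition (a1) says that the torus orbit of `a` is smooth. The main point is that, in the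
presence of (a1), condition (a2) also says that an orbit of `a` is smooth, under a one-parameter
family of ⋆-homomorphisms `pairOrbit` into operators on a Hilbert space (`isSmoothLocalized_iff`).
Elements with smooth orbits are stable under all the operations in question for general reasons.

The Hilbert space is ℓ² over the tuples (M, ω, ω', y) with ω = ω' on V_M and y ∈ ℤ^d, with values in
ℂ^N ⊕ ℂ^N. A function f acts there by f(τ_y ω) ⊕ f(τ_y ω'), and u_j by a magnetic translation of y.
Let P be the projection onto the vectors (v, v), let w = max(M - |y|, 0), and conjugate by the
diagonal unitary e^{isw} P + e^{-isw} (1 - P). Consider the matrix entry of an operator between two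
sites whose marked points differ by x. Its P-diagonal corners oscillate in s with the difference of
the two weights as frequency, which is at most |x| and so is controlled by (a1). Its off-diagonal
corners oscillate with the sum of the two weights. On a block diagonal A ⊕ A' these corners vanish
when A = A', and their norm is comparable to ‖A - A'‖ (`norm_corner_le`, `norm_sub_le_norm_corner`).
Smoothness in s therefore amounts to bounds on w^k ‖a_x(τ_y ω) - a_x(τ_y ω')‖ for all k, uniformly
in x. Such bounds follow from (a2) (`HasSmoothOrbit.of_isSmoothLocalized`), and at y = 0, where w =
M, they give it back (`pow_mul_norm_sub_le`). Fourier inversion for smooth elements,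
`hasSum_bulkComponent`, connects `a` with its coefficients.

For smooth orbits, sums and products are immediate, and inverses are covered because inversion in a
Banach algebra is smooth. For the holomorphic calculus the same argument is applied in the Banach
algebra of continuous functions along the contour. For the C^∞ calculus, G is expanded on the
spectrum in a Fourier series with rapidly decreasing coefficients. The k-th derivative of the orbit
of e^{inrh} grows at most like (1 + |n|)^k (`exists_norm_iteratedFDeriv_pow_le`), so the series can
be differentiated term by term. -/

theorem CStarAlgebra.norm_one_le (A : Type*) [CStarAlgebra A] : ‖(1 : A)‖ ≤ 1 := by
  rcases subsingleton_or_nontrivial A with h | h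
  · simp [Subsingleton.elim (1 : A) 0]
  · exact CStarRing.norm_one.le

/-- A `⋆`-homomorphism of `C⋆`-algebras as a continuous linear map. -/
noncomputable def StarAlgHom.toCLM (F : A →⋆ₐ[ℂ] B) : A →L[ℂ] B :=
  LinearMap.mkContinuous F.toAlgHom.toLinearMap 1 fun x => by
    simpa using NonUnitalStarAlgHom.norm_apply_le F x

theorem StarAlgHom.toCLM_apply (F : A →⋆ₐ[ℂ] B) (a : A) : F.toCLM a = F a := rfl

theorem StarAlgHom.norm_toCLM_le (F : A →⋆ₐ[ℂ] B) : ‖F.toCLM‖ ≤ 1 :=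
  LinearMap.mkContinuous_norm_le _ zero_le_one _

theorem StarAlgHom.continuous_of_cstar (F : A →⋆ₐ[ℂ] B) : Continuous F := F.toCLM.continuous

/-- The orbit of `a` under a family of `⋆`-homomorphisms is a smooth function of the parameter. -/
def HasSmoothOrbit (Θ : E → A →⋆ₐ[ℂ] B) (a : A) : Prop := ∀ n : ℕ, ContDiff ℝ n fun e => Θ e a

namespace HasSmoothOrbit

variable {Θ : E → A →⋆ₐ[ℂ] B} {a b : A}

theorem add (ha : HasSmoothOrbit Θ a) (hb : HasSmoothOrbit Θ b) : HasSmoothOrbit Θ (a + b) :=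
  fun n => by simpa only [map_add] using (ha n).add (hb n)

theorem mul (ha : HasSmoothOrbit Θ a) (hb : HasSmoothOrbit Θ b) : HasSmoothOrbit Θ (a * b) :=
  fun n => by simpa only [map_mul] using (ha n).mul (hb n)

theorem of_algebraMap (c : ℂ) : HasSmoothOrbit Θ (algebraMap ℂ A c) :=
  fun n => by simpa only [AlgHomClass.commutes] using contDiff_const

theorem smul (c : ℂ) (ha : HasSmoothOrbit Θ a) : HasSmoothOrbit Θ (c • a) := by
  rw [Algebra.smul_def]; exact (of_algebraMap c).mul ha

theorem unit_inv {a : Aˣ} (ha : HasSmoothOrbit Θ (a : A)) :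
    HasSmoothOrbit Θ ((a⁻¹ : Aˣ) : A) := fun n => by
  have h : (fun e => Θ e ((a⁻¹ : Aˣ) : A)) = fun e => Ring.inverse (Θ e (a : A)) := by
    ext e
    exact (Ring.inverse_unit (Units.map (Θ e : A →* B) a)).symm
  rw [h]
  refine contDiff_iff_contDiffAt.2 fun e => ?_
  have := contDiffAt_ringInverse (n := (n : ℕ∞ω)) ℝ (Units.map (Θ e : A →* B) a)
  exact this.comp e (ha n).contDiffAt

theorem exp (ha : HasSmoothOrbit Θ a) : HasSmoothOrbit Θ (NormedSpace.exp a) := fun n => by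
  have h : (fun e => Θ e (NormedSpace.exp a)) = fun e => NormedSpace.exp (Θ e a) := by
    ext e
    exact NormedSpace.map_exp_of_mem_ball (𝕂 := ℂ) (Θ e) (Θ e).continuous_of_cstar a
      ((NormedSpace.expSeries_radius_eq_top ℂ A).symm ▸ edist_lt_top _ _)
  rw [h]
  refine ContDiff.comp (g := NormedSpace.exp) ?_ (ha n)
  exact contDiff_iff_contDiffAt.2 fun x => (NormedSpace.exp_analytic (𝕂 := ℝ) x).contDiffAt

end HasSmoothOrbit

/-! ### Holomorphic calculus -/

theorem map_resolvent_of_notMem_spectrum (F : A →⋆ₐ[ℂ] B) {a : A} {z : ℂ} (hz : z ∉ spectrum ℂ a) :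
    F (resolvent a z) = resolvent (F a) z ∧ z ∉ spectrum ℂ (F a) := by
  obtain ⟨u, hu⟩ := spectrum.notMem_iff.1 hz
  have h : ((Units.map (F : A →* B) u : Bˣ) : B) = algebraMap ℂ B z - F a := by
    change F u = _
    rw [hu, map_sub, AlgHomClass.commutes]
  constructor
  · rw [resolvent, resolvent, ← hu, ← h, Ring.inverse_unit, Ring.inverse_unit]
    rfl
  · exact spectrum.notMem_iff.2 ⟨_, h⟩

/-- Integration over `[0, 1]` against an integrable density, on continuous functions. -/
noncomputable def integralCLM (B : Type*) [CStarAlgebra B] (g : ℝ → ℂ)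
    (hg : MeasureTheory.IntegrableOn g (Icc 0 1)) : C(Icc (0 : ℝ) 1, B) →L[ℝ] B :=
  have hi : ∀ F : C(Icc (0 : ℝ) 1, B), MeasureTheory.IntegrableOn
      (fun t => g t • F (projIcc 0 1 zero_le_one t)) (Icc 0 1) := fun F =>
    hg.smul_continuousOn (F.continuous.comp continuous_projIcc).continuousOn isCompact_Icc
  LinearMap.mkContinuous
    { toFun := fun F => ∫ t in Icc (0 : ℝ) 1, g t • F (projIcc 0 1 zero_le_one t)
      map_add' := fun F H => by
        rw [← MeasureTheory.integral_add (hi F) (hi H)]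
        simp only [ContinuousMap.add_apply, smul_add]
      map_smul' := fun c F => by
        rw [RingHom.id_apply, ← MeasureTheory.integral_smul]
        simp only [ContinuousMap.smul_apply, smul_comm c] }
    (∫ t in Icc (0 : ℝ) 1, ‖g t‖) fun F => by
      refine (MeasureTheory.norm_integral_le_integral_norm _).trans ?_
      rw [← MeasureTheory.integral_mul_const]
      refine MeasureTheory.integral_mono (hi F).norm (hg.norm.mul_const _) fun t => ?_
      rw [norm_smul]
      exact mul_le_mul_of_nonneg_left (F.norm_coe_le_norm _) (norm_nonneg _)

theorem integralCLM_apply {g : ℝ → ℂ} (hg : MeasureTheory.IntegrableOn g (Icc 0 1))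
    (F : C(Icc (0 : ℝ) 1, B)) :
    integralCLM B g hg F = ∫ t in Icc (0 : ℝ) 1, g t • F (projIcc 0 1 zero_le_one t) := rfl

/-- Differentiation under the integral sign is avoided. The resolvents along the curve form a single
inverse in the Banach algebra C([0,1], B), where inversion is smooth, and the integral is a
continuous linear map on that space. -/
theorem HasSmoothOrbit.intervalIntegral_resolvent {Θ : E → A →⋆ₐ[ℂ] B} {a : A}
    (ha : HasSmoothOrbit Θ a) {γ g : ℝ → ℂ} (hγ : ContinuousOn γ (Icc 0 1))
    (hs : ∀ t ∈ Icc (0 : ℝ) 1, γ t ∉ spectrum ℂ a)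
    (hg : MeasureTheory.IntegrableOn g (Icc 0 1)) :
    HasSmoothOrbit Θ (∫ t in (0 : ℝ)..1, g t • resolvent a (γ t)) := by
  intro n
  let c : C(Icc (0 : ℝ) 1, B) := ⟨fun t => algebraMap ℂ B (γ t),
    (continuous_algebraMap ℂ B).comp (continuousOn_iff_continuous_domRestrict.1 hγ)⟩
  let F : E → C(Icc (0 : ℝ) 1, B) := fun e => c - ContinuousLinearMap.const ℝ _ (Θ e a)
  have hF : ContDiff ℝ n F :=
    contDiff_const.sub (ContDiff.comp (g := ContinuousLinearMap.const ℝ (Icc (0 : ℝ) 1))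
      (ContinuousLinearMap.contDiff _) (ha n))
  have hFu : ∀ e, IsUnit (F e) := fun e => (ContinuousMap.isUnit_iff_forall_isUnit _).2 fun t =>
    spectrum.notMem_iff.1 (map_resolvent_of_notMem_spectrum (Θ e) (hs t t.2)).2
  have hinv : ∀ e t, Ring.inverse (F e) t = Θ e (resolvent a (γ t)) := by
    intro e t
    rw [(map_resolvent_of_notMem_spectrum (Θ e) (hs t t.2)).1]
    obtain ⟨v, hv⟩ := hFu e
    have h : ((Units.map ((Pi.evalMonoidHom _ t).comp
        (ContinuousMap.coeFnMonoidHom (α := Icc (0 : ℝ) 1) (β := B))) v : Bˣ) : B)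
        = algebraMap ℂ B (γ t) - Θ e a := by
      change (v : C(Icc (0 : ℝ) 1, B)) t = _
      rw [hv]; rfl
    rw [resolvent, ← h, ← hv, Ring.inverse_unit, Ring.inverse_unit]
    rfl
  have hR : ContinuousOn (fun t => resolvent a (γ t)) (Icc (0 : ℝ) 1) := by
    intro t ht
    obtain ⟨u, hu⟩ := spectrum.notMem_iff.1 (hs t ht)
    refine ContinuousAt.comp_continuousWithinAt (g := Ring.inverse) (hu ▸ NormedRing.inverse_continuousAt u) ?_
    exact ((continuous_algebraMap ℂ A).continuousAt.comp_continuousWithinAt (hγ t ht)).sub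
      continuousWithinAt_const
  have key : (fun e => Θ e (∫ t in (0 : ℝ)..1, g t • resolvent a (γ t)))
      = fun e => integralCLM B g hg (Ring.inverse (F e)) := by
    ext e
    rw [intervalIntegral.integral_of_le zero_le_one, ← MeasureTheory.integral_Icc_eq_integral_Ioc,
      ← StarAlgHom.toCLM_apply, ← ContinuousLinearMap.integral_comp_comm _
        (hg.smul_continuousOn hR isCompact_Icc), integralCLM_apply]
    refine MeasureTheory.setIntegral_congr_fun measurableSet_Icc fun t ht => ?_
    simp only [map_smul, StarAlgHom.toCLM_apply]
    rw [hinv, projIcc_of_mem _ ht]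
  rw [key]
  refine (integralCLM B g hg).contDiff.comp (contDiff_iff_contDiffAt.2 fun e => ?_)
  obtain ⟨v, hv⟩ := hFu e
  exact ContDiffAt.comp e (hv ▸ contDiffAt_ringInverse ℝ v) hF.contDiffAt

theorem HasSmoothOrbit.holomorphicCalculus {Θ : E → A →⋆ₐ[ℂ] B} {a b : A} {U : Set ℂ} {f : ℂ → ℂ}
    (ha : HasSmoothOrbit Θ a) (hf : ContinuousOn f U) (hb : IsHolomorphicCalculus U f a b) :
    HasSmoothOrbit Θ b := by
  obtain ⟨n, γ, hγ, -, hmem, -, -, rfl⟩ := hb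
  refine HasSmoothOrbit.smul _ ?_
  have key : ∀ k, HasSmoothOrbit Θ
      (∫ t in (0 : ℝ)..1, (deriv (γ k) t * f (γ k t)) • resolvent a (γ k t)) := by
    intro k
    have hc := (hγ k).continuousOn
    refine ha.intervalIntegral_resolvent hc (fun t ht => (hmem k t ht).2) ?_
    -- A `C¹` curve on the closed interval has a continuous `derivWithin` there. It agrees with
    -- `deriv` on the open interval, and the endpoints are a null set.
    have h1 : ContinuousOn (fun t => derivWithin (γ k) (Icc 0 1) t * f (γ k t)) (Icc (0:ℝ) 1) :=
      ((hγ k).continuousOn_derivWithin (uniqueDiffOn_Icc zero_lt_one) le_rfl).mul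
        (hf.comp hc fun t ht => (hmem k t ht).1)
    refine (integrableOn_Icc_iff_integrableOn_Ioo).2 ?_
    refine ((h1.integrableOn_compact isCompact_Icc).mono_set Ioo_subset_Icc_self).congr_fun
      (fun t ht => ?_) measurableSet_Ioo
    simp only [derivWithin_of_mem_nhds (Icc_mem_nhds ht.1 ht.2)]
  refine Finset.sum_induction _ (HasSmoothOrbit Θ) (fun _ _ => HasSmoothOrbit.add) ?_
    fun k _ => key k
  simpa using HasSmoothOrbit.of_algebraMap (Θ := Θ) 0

/-! ### Smooth calculus -/

/-- Apply the Leibniz rule to f^n · f. As ‖f‖ ≤ 1, the term in which all derivatives fall on f^n is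
no larger than before. The other terms contain derivatives of f^n of order below k, so they are
O((n+1)^{k-1}) by induction on k. Summation over n costs one more power. -/
theorem exists_norm_iteratedFDeriv_pow_le {f : E → B} (hf : ∀ n : ℕ, ContDiff ℝ n f)
    (h1 : ∀ e, ‖f e‖ ≤ 1) (hb : ∀ k : ℕ, ∃ C : ℝ, ∀ e, ‖iteratedFDeriv ℝ k f e‖ ≤ C) (k : ℕ) :
    ∃ C : ℝ, 0 ≤ C ∧ ∀ (n : ℕ) (e : E),
      ‖iteratedFDeriv ℝ k (fun e => f e ^ n) e‖ ≤ C * (n + 1) ^ k := by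
  choose D hD using hb
  induction k using Nat.strong_induction_on with
  | _ k ih =>
  choose! C hC0 hC using ih
  rcases Nat.eq_zero_or_pos k with rfl | hk
  · refine ⟨1, zero_le_one, fun n e => ?_⟩
    simp only [norm_iteratedFDeriv_zero, pow_zero, mul_one]
    induction n with
    | zero => simpa using CStarAlgebra.norm_one_le B
    | succ n ih =>
      rw [pow_succ]
      exact (norm_mul_le _ _).trans (mul_le_one₀ ih (norm_nonneg _) (h1 e))
  set K : ℝ := ∑ i ∈ Finset.range k, (k.choose i : ℝ) * C i * |D (k - i)| with hK
  have hK0 : 0 ≤ K := Finset.sum_nonneg fun i hi => by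
    have := hC0 i (Finset.mem_range.1 hi); positivity
  have main : ∀ (n : ℕ) (e : E),
      ‖iteratedFDeriv ℝ k (fun e => f e ^ n) e‖ ≤ K * n * (n + 1) ^ (k - 1) := by
    intro n e
    induction n with
    | zero =>
      simp only [pow_zero]
      rw [iteratedFDeriv_const_of_ne hk.ne']
      simp
    | succ n ihn =>
      simp only [pow_succ (f _)]
      refine (norm_iteratedFDeriv_mul_le (N := (k : ℕ∞ω)) ((hf k).pow n) (hf k) e le_rfl).trans ?_
      rw [Finset.sum_range_succ]
      have e1 : ∑ i ∈ Finset.range k, (k.choose i : ℝ) *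
          ‖iteratedFDeriv ℝ i (fun e => f e ^ n) e‖ * ‖iteratedFDeriv ℝ (k - i) f e‖
          ≤ K * (n + 1) ^ (k - 1) := by
        rw [hK, Finset.sum_mul]
        refine Finset.sum_le_sum fun i hi => ?_
        have hi' := Finset.mem_range.1 hi
        have a1 : ‖iteratedFDeriv ℝ i (fun e => f e ^ n) e‖ ≤ C i * (n + 1) ^ (k - 1) :=
          (hC i hi' n e).trans (mul_le_mul_of_nonneg_left
            (pow_le_pow_right₀ (by linarith [n.cast_nonneg (α := ℝ)]) (by omega)) (hC0 i hi'))
        have a2 : ‖iteratedFDeriv ℝ (k - i) f e‖ ≤ |D (k - i)| :=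
          (hD _ e).trans (le_abs_self _)
        have a3 := hC0 i hi'
        calc _ ≤ (k.choose i : ℝ) * (C i * (n + 1) ^ (k - 1)) * |D (k - i)| := by
              gcongr
          _ = _ := by ring
      -- The only term of full order in f^n, and the only place where ‖f‖ ≤ 1 is needed in this
      -- recursion.
      have e2 : ((k.choose k : ℕ) : ℝ) * ‖iteratedFDeriv ℝ k (fun e => f e ^ n) e‖ *
          ‖iteratedFDeriv ℝ (k - k) f e‖ ≤ K * n * (n + 1) ^ (k - 1) := by
        rw [Nat.choose_self, Nat.cast_one, one_mul, Nat.sub_self, norm_iteratedFDeriv_zero]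
        exact (mul_le_of_le_one_right (norm_nonneg _) (h1 e)).trans ihn
      calc _ ≤ K * (n + 1) ^ (k - 1) + K * n * (n + 1) ^ (k - 1) := add_le_add e1 e2
        _ = K * (n + 1) * (n + 1) ^ (k - 1) := by ring
        _ ≤ _ := by push_cast; gcongr; linarith
  refine ⟨K, hK0, fun n e => (main n e).trans ?_⟩
  obtain ⟨j, rfl⟩ : ∃ j, k = j + 1 := ⟨k - 1, by omega⟩
  rw [Nat.add_sub_cancel, pow_succ, mul_assoc, mul_comm ((n + 1 : ℝ) ^ j)]
  gcongr
  linarith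

/-! ### Rapidly convergent Fourier series on a compact set. -/

theorem summable_int_one_add_abs_inv_sq : Summable fun n : ℤ => ((1 + |(n : ℝ)|) ^ 2)⁻¹ := by
  have h := (Real.summable_one_div_int_pow (p := 2)).2 one_lt_two
  refine Summable.of_norm_bounded_eventually h ?_
  filter_upwards [(Set.finite_singleton (0 : ℤ)).compl_mem_cofinite] with n hn
  have hn' : (0 : ℝ) < |(n : ℝ)| := abs_pos.2 (by exact_mod_cast hn)
  rw [norm_inv, one_div, Real.norm_of_nonneg (by positivity), ← sq_abs (n : ℝ)]
  gcongr
  linarith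

/-- Cut G off to a compactly supported smooth function, rescale it to period one, and periodize.
Poisson summation gives the Fourier series of the periodization, whose coefficients are values of a
Schwartz function at the integers. -/
theorem exists_fourier_expansion {K U : Set ℝ} (hK : IsCompact K) (hU : IsOpen U) (hKU : K ⊆ U)
    {G : ℝ → ℂ} (hG : ∀ n : ℕ, ContDiffOn ℝ n G U) :
    ∃ (r : ℝ) (c : ℤ → ℂ), (∀ k : ℕ, Summable fun n : ℤ => ‖c n‖ * (1 + |(n : ℝ)|) ^ k) ∧
      ∀ s ∈ K, HasSum (fun n : ℤ => c n * Complex.exp (n * (r * Complex.I * s))) (G s) := by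
  obtain ⟨t, ht, hKt, htU⟩ := exists_compact_between hK hU hKU
  obtain ⟨χ, hχ1, hχ0, -⟩ := exists_contMDiffMap_one_nhds_of_subset_interior (n := (⊤ : ℕ∞))
    (modelWithCornersSelf ℝ ℝ) hK.isClosed hKt
  have hχ : ContDiff ℝ ∞ χ := χ.contMDiff.contDiff
  set F : ℝ → ℂ := fun x => (χ x : ℂ) * G x with hFdef
  have hF : ContDiff ℝ ∞ F := by
    refine contDiff_iff_contDiffAt.2 fun x => ?_
    by_cases hx : x ∈ t
    · exact (Complex.ofRealCLM.contDiff.comp hχ).contDiffAt.mul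
        ((contDiffOn_infty.2 hG).contDiffAt (hU.mem_nhds (htU hx)))
    · refine (contDiffAt_const (c := (0 : ℂ))).congr_of_eventuallyEq ?_
      filter_upwards [ht.isClosed.isOpen_compl.mem_nhds hx] with y hy
      simp [hFdef, hχ0 y hy]
  obtain ⟨R, hR0, hR⟩ : ∃ R : ℝ, 0 < R ∧ ∀ x ∈ t, |x| ≤ R := by
    obtain ⟨R, hR⟩ := ht.isBounded.exists_norm_le
    exact ⟨max R 1, by positivity, fun x hx => (hR x hx).trans (le_max_left _ _)⟩
  have hF0 : ∀ x, R < |x| → F x = 0 := fun x hx => by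
    simp [hFdef, hχ0 x fun h => hx.not_ge (hR x h)]
  -- With period 3R, a translate of s ∈ [-R, R] by a nonzero multiple of the period has modulus at
  -- least 2R. It lies outside the support of `F`, so the periodization equals `F` on [-R, R].
  set L : ℝ := 3 * R
  have hL : 0 < L := by positivity
  set f : ℝ → ℂ := fun x => F (x * L)
  have hf : ContDiff ℝ ∞ f := hF.comp (contDiff_id.mul contDiff_const)
  have hfs : HasCompactSupport f := by
    refine HasCompactSupport.intro (isCompact_Icc (a := -1) (b := 1)) fun x hx => hF0 _ ?_
    rw [abs_mul, abs_of_pos hL]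
    have : 1 < |x| := by
      by_contra! h
      exact hx (abs_le.1 h)
    nlinarith
  set S : SchwartzMap ℝ ℂ := hfs.toSchwartzMap hf
  have hc : ∀ k : ℕ, Summable fun n : ℤ =>
      ‖(FourierTransform.fourier S : SchwartzMap ℝ ℂ) n‖ * (1 + |(n : ℝ)|) ^ k := by
    intro k
    obtain ⟨C0, hC0, h0⟩ := (FourierTransform.fourier S : SchwartzMap ℝ ℂ).decay 0 0
    -- Two powers beyond k make the series over ℤ summable.
    obtain ⟨C1, hC1, h1⟩ := (FourierTransform.fourier S : SchwartzMap ℝ ℂ).decay (k + 2) 0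
    simp only [norm_iteratedFDeriv_zero, pow_zero, one_mul, Real.norm_eq_abs] at h0 h1
    refine Summable.of_nonneg_of_le (fun n => by positivity) (fun n => ?_)
      (summable_int_one_add_abs_inv_sq.mul_left (2 ^ (k + 1) * (C0 + C1)))
    have e := add_pow_le zero_le_one (abs_nonneg (n : ℝ)) (k + 2)
    rw [one_pow] at e
    rw [← div_eq_mul_inv, le_div_iff₀ (by positivity), mul_assoc, ← pow_add]
    calc _ ≤ _ := mul_le_mul_of_nonneg_left e (norm_nonneg _)
      _ = 2 ^ (k + 1) * (‖(FourierTransform.fourier S : SchwartzMap ℝ ℂ) n‖ + |(n : ℝ)| ^ (k + 2) *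
          ‖(FourierTransform.fourier S : SchwartzMap ℝ ℂ) n‖) := by
        rw [show k + 2 - 1 = k + 1 from rfl]; ring
      _ ≤ _ := by gcongr; exacts [h0 n, h1 n]
  refine ⟨2 * Real.pi / L, fun n => (FourierTransform.fourier S : SchwartzMap ℝ ℂ) n, hc, ?_⟩
  intro s hs
  have hs' : |s| ≤ R := hR s (interior_subset (hKt hs))
  -- Poisson summation. By the choice of `L` only the zeroth translate survives on the left.
  have key := S.tsum_eq_tsum_fourier (s / L)
  rw [tsum_eq_single 0] at key
  · have e1 : S (s / L + (0 : ℤ)) = G s := by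
      change F ((s / L + (0 : ℤ)) * L) = G s
      rw [Int.cast_zero, add_zero, div_mul_cancel₀ _ hL.ne', hFdef]
      have := hχ1.self_of_nhdsSet s hs
      simp [this]
    rw [e1] at key
    rw [key]
    have e2 : ∀ n : ℤ, fourier n ((s / L : ℝ) : UnitAddCircle)
        = Complex.exp (n * ((2 * Real.pi / L : ℝ) * Complex.I * s)) := by
      intro n
      rw [fourier_coe_apply]
      congr 1
      push_cast
      ring
    simp only [e2]
    refine Summable.hasSum (Summable.of_norm_bounded (hc 0) fun n => ?_)
    rw [norm_mul, pow_zero, show (n : ℂ) * ((2 * Real.pi / L : ℝ) * Complex.I * s)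
      = ((n * (2 * Real.pi / L) * s : ℝ) : ℂ) * Complex.I by push_cast; ring,
      Complex.norm_exp_ofReal_mul_I]
  · intro m hm
    refine hF0 _ ?_
    rw [add_mul, div_mul_cancel₀ _ hL.ne']
    have h1 : (1 : ℝ) ≤ |(m : ℝ)| := by exact_mod_cast Int.one_le_abs hm
    have h2 : |(m : ℝ) * L| ≤ |s + m * L| + |s| := by
      calc _ = |(s + m * L) - s| := by ring_nf
        _ ≤ _ := abs_sub _ _
    rw [abs_mul, abs_of_pos hL] at h2
    have : L ≤ |(m : ℝ)| * L := le_mul_of_one_le_left hL.le h1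
    simp only [L] at this h2 ⊢
    linarith

/-! ### Orbits of exponentials and the C^∞ functional calculus. -/

/-- By covariance the orbit near e is the image under the contraction β_e of the orbit near 0. Hence
the derivatives at 0 dominate those at every point. -/
theorem HasSmoothOrbit.exists_norm_iteratedFDeriv_le {Θ : E → A →⋆ₐ[ℂ] B} {β : E → B →⋆ₐ[ℂ] B}
    (hβ : ∀ e e' a, Θ (e + e') a = β e (Θ e' a)) {a : A} (ha : HasSmoothOrbit Θ a) (k : ℕ) :
    ∃ C : ℝ, ∀ e, ‖iteratedFDeriv ℝ k (fun e => Θ e a) e‖ ≤ C := by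
  refine ⟨‖iteratedFDeriv ℝ k (fun e => Θ e a) 0‖, fun e => ?_⟩
  have h : iteratedFDeriv ℝ k (fun e => Θ e a) e
      = iteratedFDeriv ℝ k (((β e).toCLM.restrictScalars ℝ) ∘ fun e => Θ e a) 0 := by
    have := iteratedFDeriv_comp_add_left (𝕜 := ℝ) (f := fun e => Θ e a) k e 0
    rw [add_zero] at this
    rw [← this]
    congr 1
    ext e'
    exact hβ e e' a
  rw [h]
  refine (ContinuousLinearMap.norm_iteratedFDeriv_comp_left (N := (k : ℕ∞ω)) _
    (ha k).contDiffAt le_rfl).trans (mul_le_of_le_one_left (norm_nonneg _) ?_)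
  rw [ContinuousLinearMap.norm_restrictScalars]
  exact (β e).norm_toCLM_le

theorem norm_exp_I_smul_le {a : A} (ha : IsSelfAdjoint a) :
    ‖NormedSpace.exp (Complex.I • a)‖ ≤ 1 := by
  have h := (selfAdjoint.expUnitary ⟨a, ha⟩).2.1
  have h2 := CStarRing.norm_star_mul_self (x := NormedSpace.exp (Complex.I • a))
  change star (NormedSpace.exp (Complex.I • a)) * NormedSpace.exp (Complex.I • a) = 1 at h
  rw [h] at h2
  have := CStarAlgebra.norm_one_le A
  nlinarith [norm_nonneg (NormedSpace.exp (Complex.I • a))]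

/-- The series converges uniformly on the spectrum, and the continuous functional calculus carries
this convergence to the algebra. On the spectrum of a self-adjoint element z = Re z, so the real
Fourier series can be used in the complex calculus. -/
theorem hasSum_smul_exp_cfc {h : A} (sa : IsSelfAdjoint h) {G : ℝ → ℂ} {c : ℤ → ℂ} {r : ℝ}
    (hG : ContinuousOn G (spectrum ℝ h)) (hc : Summable fun n => ‖c n‖)
    (hs : ∀ s ∈ spectrum ℝ h,
      HasSum (fun n : ℤ => c n * Complex.exp (n * (r * Complex.I * s))) (G s)) :
    HasSum (fun n : ℤ => c n • NormedSpace.exp ((n * (r * Complex.I)) • h))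
      (cfc (fun z : ℂ => G z.re) h) := by
  have hn : IsStarNormal h := sa.isStarNormal
  have hre : ∀ z ∈ spectrum ℂ h, ((z.re : ℝ) : ℂ) = z := fun z hz =>
    (sa.mem_spectrum_eq_re hz).symm
  have hmem : ∀ z ∈ spectrum ℂ h, z.re ∈ spectrum ℝ h := fun z hz => by
    rw [← spectrum.algebraMap_mem_iff ℂ]
    exact (hre z hz).symm ▸ hz
  have hGc : ContinuousOn (fun z : ℂ => G z.re) (spectrum ℂ h) :=
    hG.comp Complex.continuous_re.continuousOn hmem
  let F : ℤ → C(spectrum ℂ h, ℂ) := fun n =>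
    ⟨fun z => c n * Complex.exp ((n * (r * Complex.I)) * z), by fun_prop⟩
  have hF : ∀ n, cfcHom hn (F n) = c n • NormedSpace.exp ((n * (r * Complex.I)) • h) := by
    intro n
    have h1 : cfc (fun z : ℂ => c n * Complex.exp ((n * (r * Complex.I)) * z)) h
        = c n • NormedSpace.exp ((n * (r * Complex.I)) • h) := by
      rw [cfc_const_mul (c n) (fun z => Complex.exp ((n * (r * Complex.I)) * z)) h,
        cfc_comp_const_mul (n * (r * Complex.I)) Complex.exp h,
        CFC.complex_exp_eq_normedSpace_exp]
    rw [← h1, cfc_apply _ _ hn]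
    rfl
  have hval : ∀ (n : ℤ) (z : spectrum ℂ h),
      F n z = c n * Complex.exp (n * (r * Complex.I * ((z : ℂ).re : ℝ))) := fun n z => by
    change c n * Complex.exp _ = _
    rw [hre z z.2, mul_assoc (n : ℂ)]
  have hsum : Summable F := by
    refine Summable.of_norm_bounded hc fun n => ?_
    refine (ContinuousMap.norm_le _ (norm_nonneg _)).2 fun z => ?_
    rw [hval, norm_mul, show (n : ℂ) * (r * Complex.I * ((z : ℂ).re : ℝ))
      = ((n * r * (z : ℂ).re : ℝ) : ℂ) * Complex.I by push_cast; ring,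
      Complex.norm_exp_ofReal_mul_I, mul_one]
  have hF2 : HasSum F ⟨fun z : spectrum ℂ h => G (z : ℂ).re, hGc.domRestrict⟩ := by
    convert hsum.hasSum
    ext z
    refine HasSum.unique ?_ (ContinuousMap.hasSum_apply hsum.hasSum z)
    simp only [hval]
    exact hs _ (hmem z z.2)
  have := hF2.map (cfcHom hn) (cfcHom_continuous hn)
  rw [cfc_apply _ _ hn hGc]
  simp only [Function.comp_def, hF] at this
  exact this

/-- The k-th derivatives of the orbits of the exponentials grow like (1 + |n|)^k, uniformly in the
parameter. The rapid decay of the coefficients absorbs this growth. -/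
theorem HasSmoothOrbit.smoothCalculus {Θ : E → A →⋆ₐ[ℂ] B} {β : E → B →⋆ₐ[ℂ] B} {h : A}
    (hβ : ∀ e e' a, Θ (e + e') a = β e (Θ e' a)) (hh : HasSmoothOrbit Θ h)
    (sa : IsSelfAdjoint h) {r : ℝ} {c : ℤ → ℂ} {b : A}
    (hc : ∀ k : ℕ, Summable fun n : ℤ => ‖c n‖ * (1 + |(n : ℝ)|) ^ k)
    (hb : HasSum (fun n : ℤ => c n • NormedSpace.exp ((n * (r * Complex.I)) • h)) b) :
    HasSmoothOrbit Θ b := by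
  set W : ℤ → A := fun n => NormedSpace.exp ((n * (r * Complex.I)) • h)
  have hW : ∀ n, HasSmoothOrbit Θ (W n) := fun n => (hh.smul _).exp
  -- Every exponential is a natural power of one of the two with index ±1, so the estimate for
  -- powers of contractions applies.
  have hpow : ∀ (ε : ℤ) (n : ℕ), W (ε * n) = W ε ^ n := by
    intro ε n
    let := NormedAlgebra.restrictScalars ℚ ℂ A
    simp only [W]
    rw [← NormedSpace.exp_nsmul, ← Nat.cast_smul_eq_nsmul ℂ, smul_smul]
    push_cast
    ring_nf
  have hW1 : ∀ n e, ‖Θ e (W n)‖ ≤ 1 := by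
    intro n e
    refine (NonUnitalStarAlgHom.norm_apply_le (Θ e) _).trans ?_
    have hsa : IsSelfAdjoint (((n * r : ℝ) : ℂ) • h) := by
      rw [Complex.coe_smul]; exact (IsSelfAdjoint.all (n * r : ℝ)).smul sa
    have := norm_exp_I_smul_le hsa
    rwa [smul_smul, show Complex.I * ((n * r : ℝ) : ℂ) = n * (r * Complex.I) by
      push_cast; ring] at this
  have hbd : ∀ k : ℕ, ∃ C : ℝ, 0 ≤ C ∧ ∀ (n : ℤ) (e : E),
      ‖iteratedFDeriv ℝ k (fun e => Θ e (W n)) e‖ ≤ C * (1 + |(n : ℝ)|) ^ k := by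
    intro k
    obtain ⟨C, hC0, hC⟩ := exists_norm_iteratedFDeriv_pow_le (hW 1) (hW1 1)
      ((hW 1).exists_norm_iteratedFDeriv_le hβ) k
    obtain ⟨D, hD0, hD⟩ := exists_norm_iteratedFDeriv_pow_le (hW (-1)) (hW1 (-1))
      ((hW (-1)).exists_norm_iteratedFDeriv_le hβ) k
    refine ⟨C + D, by positivity, fun n e => ?_⟩
    obtain ⟨m, rfl | rfl⟩ := n.eq_nat_or_neg
    · have := hpow 1 m
      rw [one_mul] at this
      simp only [this, map_pow, Int.cast_natCast, Nat.abs_cast]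
      rw [add_comm 1 (m : ℝ)]
      refine (hC m e).trans ?_
      gcongr
      linarith
    · have := hpow (-1) m
      rw [neg_one_mul] at this
      simp only [this, map_pow, Int.cast_neg, Int.cast_natCast, abs_neg, Nat.abs_cast]
      rw [add_comm 1 (m : ℝ)]
      refine (hD m e).trans ?_
      gcongr
      linarith
  choose C hC0 hC using hbd
  intro N
  have hsum : (fun e => Θ e b) = fun e => ∑' n : ℤ, c n • Θ e (W n) := by
    ext e
    have := hb.map (Θ e) (Θ e).continuous_of_cstar
    simpa only [Function.comp_def, map_smul] using this.tsum_eq.symm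
  rw [hsum]
  refine contDiff_tsum (N := (N : ℕ∞)) (v := fun k n => C k * (‖c n‖ * (1 + |(n : ℝ)|) ^ k))
    (fun n => (hW n N).const_smul (c n)) (fun k _ => (hc k).mul_left _) fun k n e hk => ?_
  have := iteratedFDeriv_const_smul_apply' (𝕜 := ℝ) (R := ℂ) (a := c n) (i := k)
    (((hW n k).contDiffAt (x := e)))
  rw [this, norm_smul, mul_left_comm]
  exact mul_le_mul_of_nonneg_left (hC k n e) (norm_nonneg _)

end SmoothOrbit

/-! ## Frequencies and decay -/

section Frequency

/-- If a bounded functional of a `C^k` curve oscillates with frequency `κ`, then its amplitude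
is `O(κ^{-k})`. -/
theorem abs_pow_mul_norm_le_of_oscillation {X Y : Type*} [NormedAddCommGroup X] [NormedSpace ℝ X]
    [NormedAddCommGroup Y] [NormedSpace ℂ Y] (T : X →L[ℝ] Y) (hT : ‖T‖ ≤ 1) {f : ℝ → X} {k : ℕ}
    (hf : ContDiff ℝ k f) {κ : ℝ} {y : Y}
    (h : ∀ s : ℝ, T (f s) = Complex.exp (κ * Complex.I * s) • y) :
    |κ| ^ k * ‖y‖ ≤ ‖iteratedFDeriv ℝ k f 0‖ := by
  have h1 := ContinuousLinearMap.norm_iteratedFDeriv_comp_left (N := (k : WithTop ℕ∞)) T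
    (hf.contDiffAt (x := 0)) le_rfl
  have h2 : T ∘ f = fun s : ℝ => Complex.exp (κ * Complex.I * s) • y := funext h
  have hd : ∀ (k : ℕ) (c : ℂ) (y : Y), iteratedDeriv k
      (fun s : ℝ => Complex.exp (c * s) • y) = fun s : ℝ => Complex.exp (c * s) • (c ^ k • y) := by
    intro k c
    induction k with
    | zero => intro y; simp
    | succ k ih =>
      intro y
      rw [iteratedDeriv_succ']
      have : deriv (fun s : ℝ => Complex.exp (c * s) • y)
          = fun s : ℝ => Complex.exp (c * s) • (c • y) := by
        ext s
        have h3 : HasDerivAt (fun s : ℝ => c * (s : ℂ)) c s := by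
          simpa using (Complex.ofRealCLM.hasDerivAt (x := s)).const_mul c
        have h4 : HasDerivAt (fun s : ℝ => Complex.exp (c * s)) (Complex.exp (c * s) * c) s :=
          h3.cexp
        rw [(h4.smul_const y).deriv, mul_smul]
      rw [this, ih, pow_succ]
      simp only [mul_smul]
  rw [h2, norm_iteratedFDeriv_eq_norm_iteratedDeriv, hd] at h1
  simp only [Complex.ofReal_zero, mul_zero, Complex.exp_zero, one_smul] at h1
  rw [norm_smul, norm_pow, norm_mul, Complex.norm_I, mul_one, Complex.norm_real,
    Real.norm_eq_abs] at h1
  exact h1.trans (mul_le_of_le_one_left (norm_nonneg _) hT)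

/-- The supremum norm of a lattice point, as a natural number. -/
def latticeLen {d : ℕ} (x : Fin d → ℤ) : ℕ := Finset.univ.sup fun j => (x j).natAbs

variable {d : ℕ}

theorem latticeLen_le_iff {x : Fin d → ℤ} {n : ℕ} : latticeLen x ≤ n ↔ ∀ j, (x j).natAbs ≤ n := by
  simp [latticeLen]

theorem natAbs_le_latticeLen (x : Fin d → ℤ) (j : Fin d) : (x j).natAbs ≤ latticeLen x :=
  latticeLen_le_iff.1 le_rfl j

theorem latticeLen_zero : latticeLen (0 : Fin d → ℤ) = 0 := by
  simp [latticeLen]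

theorem latticeLen_sub_le (x y : Fin d → ℤ) : latticeLen (x - y) ≤ latticeLen x + latticeLen y :=
  latticeLen_le_iff.2 fun j => (Int.natAbs_sub_le _ _).trans
    (add_le_add (natAbs_le_latticeLen x j) (natAbs_le_latticeLen y j))

theorem mem_cube_iff {M : ℕ} {x : Fin d → ℤ} : x ∈ cube d M ↔ latticeLen x ≤ M := by
  rw [cube, Finset.mem_Icc, latticeLen_le_iff, Pi.le_def, Pi.le_def, ← forall_and]
  exact forall_congr' fun j => by omega

theorem card_cube (d M : ℕ) : (cube d M).card = (2 * M + 1) ^ d := by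
  rw [cube, Pi.card_Icc]
  simp only [Int.card_Icc, Finset.prod_const, Finset.card_univ, Fintype.card_fin]
  congr 1
  omega

theorem summable_pi_prod_of_nonneg {g : ℤ → ℝ} (hg : Summable g) (hg0 : 0 ≤ g) (d : ℕ) :
    Summable fun x : Fin d → ℤ => ∏ j, g (x j) := by
  induction d with
  | zero => exact (hasSum_unique _).summable
  | succ d ih =>
    refine (Fin.consEquiv fun _ : Fin (d + 1) => ℤ).summable_iff.1 ?_
    refine (hg.mul_of_nonneg ih hg0 fun x => Finset.prod_nonneg fun j _ => hg0 _).congr ?_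
    rintro ⟨a, x⟩
    simp [Fin.prod_univ_succ, Fin.consEquiv]

/-- The exponent 2d gives two powers to each coordinate, as |x_j| ≤ |x|. The comparison series is
then a product of d convergent series over ℤ. -/
theorem summable_one_add_latticeLen_inv_pow (d : ℕ) :
    Summable fun x : Fin d → ℤ => ((1 + (latticeLen x : ℝ)) ^ (2 * d))⁻¹ := by
  refine Summable.of_nonneg_of_le (fun x => by positivity) (fun x => ?_)
    (summable_pi_prod_of_nonneg summable_int_one_add_abs_inv_sq (fun n => by positivity) d)
  rw [Finset.prod_inv_distrib]
  refine inv_anti₀ (Finset.prod_pos fun j _ => by positivity) ?_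
  · rw [pow_mul]
    calc ∏ j, (1 + |(x j : ℝ)|) ^ 2 ≤ ∏ _j : Fin d, (1 + (latticeLen x : ℝ)) ^ 2 := by
          refine Finset.prod_le_prod (fun j _ => by positivity) fun j _ => ?_
          have : |(x j : ℝ)| ≤ latticeLen x := by
            rw [← Int.cast_abs, Int.abs_eq_natAbs]
            exact_mod_cast natAbs_le_latticeLen x j
          gcongr
      _ = _ := by simp

end Frequency

/-! ## Bounded families -/

section BddFamily

/-- The Banach space of bounded families. -/
def BddFam (ι X : Type*) [NormedAddCommGroup X] : Type _ := lp (fun _ : ι => X) ∞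

variable {ι X : Type*} [NormedAddCommGroup X]

noncomputable instance : NormedAddCommGroup (BddFam ι X) :=
  inferInstanceAs (NormedAddCommGroup (lp (fun _ : ι => X) ∞))

noncomputable instance [NormedSpace ℂ X] : NormedSpace ℂ (BddFam ι X) :=
  inferInstanceAs (NormedSpace ℂ (lp (fun _ : ι => X) ∞))

instance : CoeFun (BddFam ι X) fun _ => ι → X := ⟨fun f => f.1⟩

theorem BddFam.norm_le {f : BddFam ι X} {C : ℝ} (hC : 0 ≤ C) (h : ∀ i, ‖f i‖ ≤ C) : ‖f‖ ≤ C :=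
  lp.norm_le_of_forall_le hC h

open Classical in
/-- The element of `ℓ^∞` with components `f i` (zero if `f` is unbounded). -/
noncomputable def bddFamily (f : ι → X) : BddFam ι X :=
  if h : Memℓp (E := fun _ => X) f ∞ then ⟨f, h⟩ else 0

theorem bddFamily_apply {f : ι → X} {C : ℝ} (h : ∀ i, ‖f i‖ ≤ C) (i : ι) :
    bddFamily f i = f i := by
  have h' : Memℓp (E := fun _ => X) f ∞ :=
    memℓp_infty ⟨C, by rintro _ ⟨i, rfl⟩; exact h i⟩
  exact congrFun (congrArg Subtype.val (dif_pos h' : bddFamily f = (⟨f, h'⟩ : lp _ ∞))) i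

theorem norm_bddFamily_le {f : ι → X} {C : ℝ} (hC : 0 ≤ C) (h : ∀ i, ‖f i‖ ≤ C) :
    ‖bddFamily f‖ ≤ C :=
  BddFam.norm_le hC fun i => by rw [bddFamily_apply h]; exact h i

variable [NormedSpace ℂ X]

/-- The family `e^{isκ_i} f_i`. -/
noncomputable def phaseFamily (κ : ι → ℝ) (f : ι → X) (s : ℝ) : BddFam ι X :=
  bddFamily fun i => Complex.exp ((s * κ i : ℝ) * Complex.I) • f i

theorem norm_phase_smul (s κ : ℝ) (x : X) :
    ‖Complex.exp ((s * κ : ℝ) * Complex.I) • x‖ = ‖x‖ := by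
  rw [norm_smul, Complex.norm_exp_ofReal_mul_I, one_mul]

/-- The Taylor estimate is needed for all real r, because r is time multiplied by a frequency and
the frequencies are unbounded. For |r| > 1 the triangle inequality suffices. -/
theorem norm_exp_sub_one_sub_le (r : ℝ) :
    ‖Complex.exp (r * Complex.I) - 1 - r * Complex.I‖ ≤ 4 * r ^ 2 := by
  have hn : ‖(r * Complex.I : ℂ)‖ = |r| := by simp
  by_cases h : |r| ≤ 1
  · refine (Complex.norm_exp_sub_one_sub_id_le (hn.trans_le h)).trans ?_
    rw [hn, sq_abs]
    nlinarith [sq_nonneg r]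
  · have h1 : 1 ≤ |r| := (not_le.1 h).le
    calc _ ≤ ‖Complex.exp (r * Complex.I)‖ + ‖(1 : ℂ)‖ + ‖(r * Complex.I : ℂ)‖ :=
          (norm_sub_le _ _).trans (add_le_add_left (norm_sub_le _ _) _)
      _ = 2 + |r| := by rw [Complex.norm_exp_ofReal_mul_I, hn, norm_one]; ring
      _ ≤ 4 * r ^ 2 := by rw [← sq_abs]; nlinarith

/-- The second moment bounds the Taylor remainder uniformly in i, which turns componentwise
derivatives into a derivative in the supremum norm. -/
theorem hasDerivAt_phaseFamily {κ : ι → ℝ} {f : ι → X}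
    (hf : ∀ k : ℕ, ∃ C : ℝ, ∀ i, |κ i| ^ k * ‖f i‖ ≤ C) (s : ℝ) :
    HasDerivAt (phaseFamily κ f) (phaseFamily κ (fun i => (κ i * Complex.I) • f i) s) s := by
  obtain ⟨C0, hC0⟩ := hf 0
  obtain ⟨C1, hC1⟩ := hf 1
  obtain ⟨C2, hC2⟩ := hf 2
  have b0 : ∀ s i, ‖Complex.exp ((s * κ i : ℝ) * Complex.I) • f i‖ ≤ C0 := fun s i => by
    rw [norm_phase_smul]; simpa using hC0 i
  have b1 : ∀ s i, ‖Complex.exp ((s * κ i : ℝ) * Complex.I) • ((κ i * Complex.I) • f i)‖ ≤ C1 :=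
    fun s i => by rw [norm_phase_smul, norm_smul]; simpa using hC1 i
  rw [hasDerivAt_iff_isLittleO_nhds_zero]
  refine Asymptotics.IsBigO.trans_isLittleO (g := fun t : ℝ => t ^ 2) ?_ ?_
  · refine Asymptotics.IsBigO.of_bound (4 * |C2|) (Filter.Eventually.of_forall fun t => ?_)
    refine BddFam.norm_le (by positivity) fun i => ?_
    change ‖phaseFamily κ f (s + t) i - phaseFamily κ f s i - t • _‖ ≤ _
    rw [phaseFamily, phaseFamily, phaseFamily, bddFamily_apply (b0 _), bddFamily_apply (b0 _),
      bddFamily_apply (b1 _)]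
    have e : Complex.exp (((s + t) * κ i : ℝ) * Complex.I) • f i
        - Complex.exp ((s * κ i : ℝ) * Complex.I) • f i
        - t • Complex.exp ((s * κ i : ℝ) * Complex.I) • ((κ i * Complex.I) • f i)
        = Complex.exp ((s * κ i : ℝ) * Complex.I) •
          ((Complex.exp ((t * κ i : ℝ) * Complex.I) - 1 - (t * κ i : ℝ) * Complex.I) • f i) := by
      rw [← Complex.coe_smul, smul_smul, smul_smul, smul_smul, ← sub_smul, ← sub_smul]
      congr 1
      rw [mul_sub, mul_sub, ← Complex.exp_add]
      push_cast
      ring_nf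
    rw [e, norm_phase_smul, norm_smul]
    calc _ ≤ 4 * (t * κ i) ^ 2 * ‖f i‖ := by gcongr; exact norm_exp_sub_one_sub_le _
      _ = 4 * (|κ i| ^ 2 * ‖f i‖) * t ^ 2 := by rw [sq_abs]; ring
      _ ≤ 4 * |C2| * t ^ 2 := by gcongr; exact (hC2 i).trans (le_abs_self _)
      _ = _ := by rw [Real.norm_of_nonneg (sq_nonneg t)]
  · simpa using Asymptotics.isLittleO_pow_pow (𝕜 := ℝ) (m := 1) (n := 2) one_lt_two

theorem phase_moments {κ : ι → ℝ} {f : ι → X}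
    (hf : ∀ k : ℕ, ∃ C : ℝ, ∀ i, |κ i| ^ k * ‖f i‖ ≤ C) (k : ℕ) :
    ∃ C : ℝ, ∀ i, |κ i| ^ k * ‖(κ i * Complex.I) • f i‖ ≤ C := by
  obtain ⟨C, hC⟩ := hf (k + 1)
  refine ⟨C, fun i => ?_⟩
  rw [norm_smul, norm_mul, Complex.norm_I, mul_one, Complex.norm_real, Real.norm_eq_abs,
    ← mul_assoc, ← pow_succ]
  exact hC i

theorem contDiff_phaseFamily {κ : ι → ℝ} {f : ι → X}
    (hf : ∀ k : ℕ, ∃ C : ℝ, ∀ i, |κ i| ^ k * ‖f i‖ ≤ C) (n : ℕ) :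
    ContDiff ℝ n (phaseFamily κ f) := by
  induction n generalizing f with
  | zero =>
    exact contDiff_zero.2 (continuous_iff_continuousAt.2 fun s =>
      (hasDerivAt_phaseFamily hf s).continuousAt)
  | succ n ih =>
    push_cast
    refine contDiff_succ_iff_deriv.2 ⟨fun s => (hasDerivAt_phaseFamily hf s).differentiableAt,
      fun h => (WithTop.coe_ne_top h).elim, ?_⟩
    rw [show deriv (phaseFamily κ f) = phaseFamily κ (fun i => (κ i * Complex.I) • f i) from
      funext fun s => (hasDerivAt_phaseFamily hf s).deriv]
    exact ih (phase_moments hf)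

theorem norm_iteratedFDeriv_phaseFamily_le {κ : ι → ℝ} {f : ι → X}
    (hf : ∀ k : ℕ, ∃ C : ℝ, ∀ i, |κ i| ^ k * ‖f i‖ ≤ C) {k : ℕ} {C : ℝ} (hC0 : 0 ≤ C)
    (hC : ∀ i, |κ i| ^ k * ‖f i‖ ≤ C) (s : ℝ) :
    ‖iteratedFDeriv ℝ k (phaseFamily κ f) s‖ ≤ C := by
  rw [norm_iteratedFDeriv_eq_norm_iteratedDeriv]
  induction k generalizing f with
  | zero =>
    rw [iteratedDeriv_zero]
    refine norm_bddFamily_le hC0 fun i => ?_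
    rw [norm_phase_smul]; simpa using hC i
  | succ k ih =>
    rw [iteratedDeriv_succ',
      show deriv (phaseFamily κ f) = phaseFamily κ (fun i => (κ i * Complex.I) • f i) from
        funext fun s => (hasDerivAt_phaseFamily hf s).deriv]
    refine ih (phase_moments hf) fun i => ?_
    rw [norm_smul, norm_mul, Complex.norm_I, mul_one, Complex.norm_real, Real.norm_eq_abs,
      ← mul_assoc, ← pow_succ]
    exact hC i

end BddFamily

/-! ## Monomial operators -/

section Monomial

variable {ι F : Type*} [NormedAddCommGroup F]

/-- The Hilbert space of square summable families of vectors. -/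
def SqSum (ι F : Type*) [NormedAddCommGroup F] : Type _ := lp (fun _ : ι => F) 2

noncomputable instance : NormedAddCommGroup (SqSum ι F) :=
  inferInstanceAs (NormedAddCommGroup (lp (fun _ : ι => F) 2))

instance : CoeFun (SqSum ι F) fun _ => ι → F := ⟨fun ψ => ψ.1⟩

@[ext]
theorem SqSum.ext {ψ χ : SqSum ι F} (h : ∀ i, ψ i = χ i) : ψ = χ := Subtype.ext (funext h)

theorem SqSum.norm_apply_le (ψ : SqSum ι F) (i : ι) : ‖ψ i‖ ≤ ‖ψ‖ :=
  lp.norm_apply_le_norm two_ne_zero ψ i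

variable [InnerProductSpace ℂ F]

noncomputable instance : InnerProductSpace ℂ (SqSum ι F) :=
  inferInstanceAs (InnerProductSpace ℂ (lp (fun _ : ι => F) 2))

instance [CompleteSpace F] : CompleteSpace (SqSum ι F) :=
  inferInstanceAs (CompleteSpace (lp (fun _ : ι => F) 2))

theorem SqSum.inner_eq_tsum (ψ χ : SqSum ι F) : inner ℂ ψ χ = ∑' i, inner ℂ (ψ i) (χ i) :=
  lp.inner_eq_tsum (G := fun _ : ι => F) ψ χ

theorem monomial_sum_le (σ : Equiv.Perm ι) (m : BddFam ι (F →L[ℂ] F))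
    (ψ : SqSum ι F) (s : Finset ι) :
    ∑ i ∈ s, ‖m i (ψ (σ i))‖ ^ (2 : ℝ≥0∞).toReal ≤ (‖m‖ * ‖ψ‖) ^ (2 : ℝ≥0∞).toReal := by
  have h2 : 0 < (2 : ℝ≥0∞).toReal := by norm_num
  rw [Real.mul_rpow (norm_nonneg _) (norm_nonneg _)]
  calc _ ≤ ∑ i ∈ s, ‖m‖ ^ (2 : ℝ≥0∞).toReal * ‖ψ (σ i)‖ ^ (2 : ℝ≥0∞).toReal := by
        refine Finset.sum_le_sum fun i _ => ?_
        rw [← Real.mul_rpow (norm_nonneg _) (norm_nonneg _)]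
        refine Real.rpow_le_rpow (norm_nonneg _) ?_ h2.le
        exact (ContinuousLinearMap.le_opNorm _ _).trans (mul_le_mul_of_nonneg_right
          (lp.norm_apply_le_norm ENNReal.top_ne_zero m i) (norm_nonneg _))
    _ = ‖m‖ ^ (2 : ℝ≥0∞).toReal * ∑ i ∈ s.map σ.toEmbedding, ‖ψ i‖ ^ (2 : ℝ≥0∞).toReal := by
        rw [← Finset.mul_sum, Finset.sum_map]; rfl
    _ ≤ _ := by
        gcongr
        exact lp.sum_rpow_le_norm_rpow h2 ψ _

/-- The operator `(Tψ)_i = m_i ψ_{σ i}` on `ℓ²`. -/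
noncomputable def monomialOp (σ : Equiv.Perm ι) (m : BddFam ι (F →L[ℂ] F)) :
    SqSum ι F →L[ℂ] SqSum ι F :=
  LinearMap.mkContinuous
    { toFun := fun (ψ : SqSum ι F) => ⟨fun i => m i (ψ (σ i)), memℓp_gen' (monomial_sum_le σ m ψ)⟩
      map_add' := fun (ψ χ : SqSum ι F) => by ext i; exact map_add (m i) _ _
      map_smul' := fun c (ψ : SqSum ι F) => by ext i; exact map_smul (m i) c _ }
    ‖m‖ fun (ψ : SqSum ι F) => lp.norm_le_of_forall_sum_le (by norm_num) (by positivity) (monomial_sum_le σ m ψ)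

theorem monomialOp_apply (σ : Equiv.Perm ι) (m : BddFam ι (F →L[ℂ] F))
    (ψ : SqSum ι F) (i : ι) : monomialOp σ m ψ i = m i (ψ (σ i)) := rfl

/-- `monomialOp` as a continuous linear function of the coefficients. -/
noncomputable def monomialCLM (σ : Equiv.Perm ι) :
    BddFam ι (F →L[ℂ] F) →L[ℂ] SqSum ι F →L[ℂ] SqSum ι F :=
  LinearMap.mkContinuous
    { toFun := fun (m : BddFam ι (F →L[ℂ] F)) => monomialOp σ m
      map_add' := fun (m n : BddFam ι (F →L[ℂ] F)) => by ext ψ i; rfl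
      map_smul' := fun c (m : BddFam ι (F →L[ℂ] F)) => by ext ψ i; rfl }
    1 fun (m : BddFam ι (F →L[ℂ] F)) => by
      rw [one_mul]
      exact LinearMap.mkContinuous_norm_le _ (norm_nonneg m) fun ψ =>
        lp.norm_le_of_forall_sum_le (by norm_num) (by positivity) (monomial_sum_le σ m ψ)

theorem monomialCLM_apply (σ : Equiv.Perm ι) (m : BddFam ι (F →L[ℂ] F)) :
    monomialCLM σ m = monomialOp σ m := rfl

theorem norm_monomialCLM_le (σ : Equiv.Perm ι) : ‖monomialCLM (F := F) σ‖ ≤ 1 :=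
  LinearMap.mkContinuous_norm_le _ zero_le_one _

theorem monomialOp_mul {σ τ : Equiv.Perm ι} {m n k : BddFam ι (F →L[ℂ] F)}
    (h : ∀ i, k i = m i * n (σ i)) :
    monomialOp σ m * monomialOp τ n = monomialOp (σ.trans τ) k := by
  ext ψ i
  change m i (n (σ i) (ψ (τ (σ i)))) = k i (ψ (τ (σ i)))
  rw [h]; rfl

theorem star_monomialOp [CompleteSpace F] {σ : Equiv.Perm ι} {m n : BddFam ι (F →L[ℂ] F)}
    (h : ∀ i, n (σ i) = star (m i)) : star (monomialOp σ m) = monomialOp σ.symm n := by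
  symm
  rw [ContinuousLinearMap.star_eq_adjoint, ContinuousLinearMap.eq_adjoint_iff]
  intro ψ χ
  rw [SqSum.inner_eq_tsum, SqSum.inner_eq_tsum, ← σ.tsum_eq]
  refine tsum_congr fun i => ?_
  rw [monomialOp_apply, monomialOp_apply, Equiv.symm_apply_apply, h,
    ContinuousLinearMap.star_eq_adjoint, ContinuousLinearMap.adjoint_inner_left]

theorem monomialOp_one {m : BddFam ι (F →L[ℂ] F)} (h : ∀ i, m i = 1) :
    monomialOp (Equiv.refl ι) m = 1 := by
  ext ψ i
  rw [monomialOp_apply, h]; rfl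

open Classical in
/-- The `j`-th coordinate embedding. -/
noncomputable def SqSum.single (j : ι) : F →L[ℂ] SqSum ι F :=
  lp.singleContinuousLinearMap ℂ (fun _ : ι => F) 2 j

theorem SqSum.single_apply_self (j : ι) (v : F) : SqSum.single j v j = v := by
  classical
  exact lp.single_apply_self (E := fun _ : ι => F) 2 j v

theorem SqSum.single_apply_ne {i j : ι} (h : i ≠ j) (v : F) : SqSum.single j v i = 0 := by
  classical
  exact lp.single_apply_ne (E := fun _ : ι => F) 2 j v h

theorem SqSum.norm_single (j : ι) (v : F) : ‖SqSum.single j v‖ = ‖v‖ := by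
  classical
  exact lp.norm_single (E := fun _ : ι => F) two_pos j v

/-- The `i`-th coordinate. -/
noncomputable def SqSum.eval (i : ι) : SqSum ι F →L[ℂ] F := lp.evalCLM ℂ (fun _ : ι => F) 2 i

/-- The matrix entry `T ↦ T_{ij}` of operators on `ℓ²`. -/
noncomputable def entryCLM (i j : ι) : (SqSum ι F →L[ℂ] SqSum ι F) →L[ℂ] F →L[ℂ] F :=
  LinearMap.mkContinuous
    { toFun := fun T => (SqSum.eval i).comp (T.comp (SqSum.single j))
      map_add' := fun S T => by ext v; rfl
      map_smul' := fun c T => by ext v; rfl }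
    1 fun T => by
      rw [one_mul]
      refine ContinuousLinearMap.opNorm_le_bound _ (norm_nonneg T) fun v => ?_
      refine (SqSum.norm_apply_le _ i).trans ((T.le_opNorm _).trans_eq ?_)
      exact congrArg (‖T‖ * ·) (SqSum.norm_single j v)

theorem norm_entryCLM_le (i j : ι) : ‖entryCLM (F := F) i j‖ ≤ 1 :=
  LinearMap.mkContinuous_norm_le _ zero_le_one _

theorem entryCLM_apply (i j : ι) (T : SqSum ι F →L[ℂ] SqSum ι F) (v : F) :
    entryCLM i j T v = T (SqSum.single j v) i := rfl

theorem entryCLM_monomialOp (σ : Equiv.Perm ι) (m : BddFam ι (F →L[ℂ] F)) (i : ι) :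
    entryCLM i (σ i) (monomialOp σ m) = m i := by
  ext v
  rw [entryCLM_apply, monomialOp_apply, SqSum.single_apply_self]

theorem entryCLM_monomialOp_of_ne {σ : Equiv.Perm ι} (m : BddFam ι (F →L[ℂ] F)) {i j : ι}
    (h : σ i ≠ j) : entryCLM i j (monomialOp σ m) = 0 := by
  ext v
  rw [entryCLM_apply, monomialOp_apply, SqSum.single_apply_ne h, map_zero]
  rfl

theorem entryCLM_diag_mul (i j : ι) (m : BddFam ι (F →L[ℂ] F))
    (T : SqSum ι F →L[ℂ] SqSum ι F) :
    entryCLM i j (monomialOp (Equiv.refl ι) m * T) = m i * entryCLM i j T := by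
  ext v; rfl

theorem entryCLM_mul_diag (i j : ι) (m : BddFam ι (F →L[ℂ] F))
    (T : SqSum ι F →L[ℂ] SqSum ι F) :
    entryCLM i j (T * monomialOp (Equiv.refl ι) m) = entryCLM i j T * m j := by
  ext v
  change T (monomialOp (Equiv.refl ι) m (SqSum.single j v)) i = T (SqSum.single j (m j v)) i
  suffices h : monomialOp (Equiv.refl ι) m (SqSum.single j v) = SqSum.single j (m j v) by rw [h]
  ext k
  rw [monomialOp_apply, Equiv.refl_apply]
  by_cases h : k = j
  · subst h
    rw [SqSum.single_apply_self, SqSum.single_apply_self]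
  · rw [SqSum.single_apply_ne h, SqSum.single_apply_ne h, map_zero]

end Monomial

/-! ## Words in the generators -/

section Words

theorem commute_list_ofFn_zpow_prod {G : Type*} [Group G] {d : ℕ} {a : G} {g : Fin d → G}
    (hg : ∀ j, Commute a (g j)) (x : Fin d → ℤ) :
    Commute a (List.ofFn fun j => g j ^ x j).prod := by
  refine Commute.list_prod_right _ _ fun b hb => ?_
  obtain ⟨j, rfl⟩ := (List.mem_ofFn' _ _).1 hb
  exact (hg j).zpow_right _

theorem list_ofFn_zpow_add_prod {G : Type*} [Group G] {d : ℕ} {g : Fin d → G}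
    (hg : ∀ i j, Commute (g i) (g j)) (x y : Fin d → ℤ) :
    (List.ofFn fun j => g j ^ (x j + y j)).prod
      = (List.ofFn fun j => g j ^ x j).prod * (List.ofFn fun j => g j ^ y j).prod := by
  induction d with
  | zero => simp
  | succ d ih =>
    simp only [List.ofFn_succ, List.prod_cons, zpow_add]
    have h := ih (g := fun j => g j.succ) (fun i j => hg _ _) (fun j => x j.succ)
      (fun j => y j.succ)
    simp only [zpow_add] at h
    rw [h]
    have hc : Commute (g 0 ^ y 0) (List.ofFn fun j : Fin d => g j.succ ^ x j.succ).prod :=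
      (commute_list_ofFn_zpow_prod (fun j => hg 0 j.succ) _).zpow_left _
    rw [mul_assoc, mul_assoc, ← mul_assoc (g 0 ^ y 0), hc.eq, mul_assoc]

/-- A subgroup of `ℤ^d × G` that contains all `(e_j, g_j)` contains all `(x, g_1^{x_1} ⋯)`. -/
theorem list_ofFn_zpow_prod_mem {G : Type*} [Group G] {d : ℕ} {g : Fin d → G}
    (H : Subgroup (Multiplicative (Fin d → ℤ) × G))
    (hH : ∀ j, (Multiplicative.ofAdd (Pi.single j 1), g j) ∈ H) (x : Fin d → ℤ) :
    (Multiplicative.ofAdd x, (List.ofFn fun j => g j ^ x j).prod) ∈ H := by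
  have h : (Multiplicative.ofAdd x, (List.ofFn fun j => g j ^ x j).prod)
      = (List.ofFn fun j =>
          ((Multiplicative.ofAdd (Pi.single j 1 : Fin d → ℤ), g j) ^ x j)).prod := by
    refine Prod.ext ?_ ?_
    · rw [← MonoidHom.coe_fst, map_list_prod, List.map_ofFn, List.prod_ofFn]
      apply Multiplicative.toAdd.injective
      rw [toAdd_prod]
      simp only [Function.comp_apply, MonoidHom.coe_fst, toAdd_ofAdd]
      ext k
      simp [Finset.sum_apply, Pi.single_apply]
    · rw [← MonoidHom.coe_snd, map_list_prod, List.map_ofFn]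
      rfl
  rw [h]
  refine Subgroup.list_prod_mem _ fun b hb => ?_
  obtain ⟨j, rfl⟩ := (List.mem_ofFn' _ _).1 hb
  exact H.zpow_mem (hH j) _

end Words

noncomputable section

/-! ## Fourier analysis on the algebra of bulk observables -/

section BulkFourier

variable {d N : ℕ} {Ω₀ : Type u} [TopologicalSpace Ω₀] {φ : Matrix (Fin d) (Fin d) ℝ}

theorem shift_zero : shift (Ω₀ := Ω₀) (0 : Fin d → ℤ) = ContinuousMap.id _ := by
  ext ω x; simp [shift]

theorem shift_comp_shift (x y : Fin d → ℤ) :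
    (shift (Ω₀ := Ω₀) x).comp (shift y) = shift (x + y) := by
  ext ω z
  simp only [shift, ContinuousMap.comp_apply, ContinuousMap.coe_mk]
  congr 1
  abel

variable [CompactSpace Ω₀]

/-- `⋆`-homomorphisms out of the algebra of bulk observables are determined by the generators. -/
theorem bulk_hom_ext {C : Type*} [CStarAlgebra C] {F G : Bulk d N Ω₀ φ →⋆ₐ[ℂ] C}
    (h1 : ∀ f, F (bulkFun φ f) = G (bulkFun φ f))
    (h2 : ∀ j, F (bulkGen N Ω₀ φ j) = G (bulkGen N Ω₀ φ j)) : F = G := by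
  refine StarAlgHom.ext_topologicalClosure F.continuous_of_cstar G.continuous_of_cstar ?_
  refine StarAlgHom.ext_adjoin ?_
  rintro ⟨x, hx'⟩ (⟨f, rfl⟩ | ⟨j, rfl⟩)
  · exact h1 f
  · exact h2 j

theorem bulkGauge_bulkGauge (l l' : Fin d → Circle) (a : Bulk d N Ω₀ φ) :
    bulkGauge l (bulkGauge l' a) = bulkGauge (l * l') a := by
  have h : (bulkGauge l).comp (bulkGauge l')
      = (bulkGauge (l * l') : Bulk d N Ω₀ φ →⋆ₐ[ℂ] Bulk d N Ω₀ φ) := by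
    refine bulk_hom_ext (fun f => rfl) fun j => ?_
    rw [StarAlgHom.comp_apply, bulkGauge_bulkGen, map_smul, bulkGauge_bulkGen, bulkGauge_bulkGen,
      smul_smul, Pi.mul_apply, mul_inv, Circle.coe_mul, mul_comm]
  exact DFunLike.congr_fun h a

theorem bulkGauge_one (a : Bulk d N Ω₀ φ) : bulkGauge 1 a = a := by
  have h : bulkGauge 1 = StarAlgHom.id ℂ (Bulk d N Ω₀ φ) := by
    refine bulk_hom_ext (fun f => rfl) fun j => ?_
    rw [bulkGauge_bulkGen]
    simp
  exact DFunLike.congr_fun h a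

/-- The character `λ ↦ λ^x` of the torus. -/
def torusChar (x : Fin d → ℤ) (l : Fin d → Circle) : Circle := ∏ j, l j ^ x j

theorem torusChar_mul (x : Fin d → ℤ) (l l' : Fin d → Circle) :
    torusChar x (l * l') = torusChar x l * torusChar x l' := by
  simp [torusChar, mul_zpow, Finset.prod_mul_distrib]

theorem torusChar_add (x y : Fin d → ℤ) (l : Fin d → Circle) :
    torusChar (x + y) l = torusChar x l * torusChar y l := by
  simp [torusChar, zpow_add, Finset.prod_mul_distrib]

theorem torusChar_neg (x : Fin d → ℤ) (l : Fin d → Circle) :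
    torusChar (-x) l = (torusChar x l)⁻¹ := by
  simp [torusChar]

theorem torusChar_zero (l : Fin d → Circle) : torusChar 0 l = 1 := by
  simp [torusChar]

theorem torusChar_single (j : Fin d) (l : Fin d → Circle) : torusChar (Pi.single j 1) l = l j := by
  rw [torusChar, Finset.prod_eq_single j]
  · simp
  · intro i _ hi; simp [Pi.single_eq_of_ne hi]
  · simp

theorem mFourier_eq_torusChar (x : Fin d → ℤ) (t : UnitAddTorus (Fin d)) :
    UnitAddTorus.mFourier x t = torusChar x fun j => AddCircle.toCircle (t j) := by
  rw [torusChar]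
  change ∏ j, fourier (x j) (t j) = _
  change _ = Circle.coeHom (∏ j, AddCircle.toCircle (t j) ^ x j)
  rw [map_prod]
  refine Finset.prod_congr rfl fun j _ => ?_
  rw [fourier_apply, AddCircle.toCircle_zsmul]
  rfl

/-- The word `u_1^{x_1} ⋯ u_d^{x_d}`. -/
def bulkWord (N : ℕ) (Ω₀ : Type u) [TopologicalSpace Ω₀] [CompactSpace Ω₀]
    (φ : Matrix (Fin d) (Fin d) ℝ) (x : Fin d → ℤ) : unitary (Bulk d N Ω₀ φ) :=
  (List.ofFn fun j => bulkGen N Ω₀ φ j ^ x j).prod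

/-! ### Words in the generators, up to scalars. -/

theorem exists_bulkMonomial_eq (x : Fin d → ℤ) :
    ∃ c : Circle, bulkMonomial N Ω₀ φ x = (c : ℂ) • (bulkWord N Ω₀ φ x : Bulk d N Ω₀ φ) := by
  refine ⟨Circle.exp (-(1 / 2) *
    ∑ i : Fin d, ∑ j : Fin d, if i < j then φ i j * x i * x j else 0), ?_⟩
  rw [bulkMonomial, Circle.coe_exp, bulkWord]
  congr 2
  push_cast
  have : ∀ i j : Fin d, (((if i < j then φ i j * x i * x j else 0 : ℝ)) : ℂ)
      = if i < j then (φ i j * x i * x j : ℂ) else 0 := fun i j => by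
    split_ifs <;> push_cast <;> rfl
  simp only [this]
  ring

theorem bulkMonomial_mem_unitary (x : Fin d → ℤ) :
    bulkMonomial N Ω₀ φ x ∈ unitary (Bulk d N Ω₀ φ) := by
  obtain ⟨c, hc⟩ := exists_bulkMonomial_eq (N := N) (Ω₀ := Ω₀) (φ := φ) x
  rw [hc]
  have h1 : star (c : ℂ) * c = 1 := by
    rw [Complex.star_def, ← Complex.normSq_eq_conj_mul_self, Circle.normSq_coe, Complex.ofReal_one]
  constructor
  · rw [star_smul, smul_mul_smul_comm, h1, one_smul]
    exact (bulkWord N Ω₀ φ x).2.1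
  · rw [star_smul, smul_mul_smul_comm, mul_comm, h1, one_smul]
    exact (bulkWord N Ω₀ φ x).2.2

/-- The unitary scalar multiples of the identity. -/
def unitaryScalars (A : Type*) [CStarAlgebra A] : Subgroup (unitary A) where
  carrier := {v | ∃ c : ℂ, (v : A) = algebraMap ℂ A c}
  one_mem' := ⟨1, by simp⟩
  mul_mem' := by
    rintro v w ⟨c, hc⟩ ⟨e, he⟩
    exact ⟨c * e, by rw [Submonoid.coe_mul, hc, he, map_mul]⟩
  inv_mem' := by
    rintro v ⟨c, hc⟩
    exact ⟨star c, by rw [← Unitary.star_eq_inv, Unitary.coe_star, hc, algebraMap_star_comm]⟩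

instance (A : Type*) [CStarAlgebra A] : (unitaryScalars A).Normal where
  conj_mem := by
    rintro v ⟨c, hc⟩ w
    refine ⟨c, ?_⟩
    rw [Submonoid.coe_mul, Submonoid.coe_mul, hc, ← Algebra.commutes, mul_assoc,
      ← Submonoid.coe_mul, mul_inv_cancel, Submonoid.coe_one, mul_one]

/-- The commutation relations become commutativity modulo scalar unitaries. Rearranging words in
this quotient makes it unnecessary to track the phases. -/
theorem commute_mk_bulkGen (i j : Fin d) :
    Commute (QuotientGroup.mk' (unitaryScalars (Bulk d N Ω₀ φ)) (bulkGen N Ω₀ φ i))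
      (QuotientGroup.mk' (unitaryScalars (Bulk d N Ω₀ φ)) (bulkGen N Ω₀ φ j)) := by
  rw [commute_iff_eq, ← MonoidHom.map_mul, ← MonoidHom.map_mul]
  refine (QuotientGroup.eq (s := unitaryScalars (Bulk d N Ω₀ φ))).2
    ⟨Complex.exp (Complex.I * φ j i), ?_⟩
  have h := bulkGen_comm (N := N) (Ω₀ := Ω₀) (φ := φ) j i
  rw [← Submonoid.coe_mul, ← Submonoid.coe_mul] at h
  rw [Submonoid.coe_mul, h, mul_smul_comm, ← Submonoid.coe_mul, inv_mul_cancel, Submonoid.coe_one,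
    Algebra.algebraMap_eq_smul_one]

/-- The classes of the generators modulo scalars commute, so in the quotient the exponents of two
words add. The values of the scalars play no role later. -/
theorem exists_bulkWord_add (x y : Fin d → ℤ) :
    (∃ c : ℂ, (bulkWord N Ω₀ φ (x + y) : Bulk d N Ω₀ φ)
      = c • ((bulkWord N Ω₀ φ x : Bulk d N Ω₀ φ) * bulkWord N Ω₀ φ y)) ∧
    ∃ c : ℂ, (bulkWord N Ω₀ φ x : Bulk d N Ω₀ φ) * bulkWord N Ω₀ φ y
      = c • (bulkWord N Ω₀ φ (x + y) : Bulk d N Ω₀ φ) := by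
  have hmk : ∀ x, QuotientGroup.mk' (unitaryScalars (Bulk d N Ω₀ φ)) (bulkWord N Ω₀ φ x)
      = (List.ofFn fun j => QuotientGroup.mk' (unitaryScalars (Bulk d N Ω₀ φ))
          (bulkGen N Ω₀ φ j) ^ x j).prod := fun x => by
    rw [bulkWord, MonoidHom.map_list_prod, List.map_ofFn]
    simp only [Function.comp_def, MonoidHom.map_zpow]
  have h := list_ofFn_zpow_add_prod (commute_mk_bulkGen (N := N) (Ω₀ := Ω₀) (φ := φ)) x y
  rw [← hmk x, ← hmk y] at h
  have h2 := hmk (x + y)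
  simp only [Pi.add_apply] at h2
  rw [← h2, ← MonoidHom.map_mul] at h
  obtain ⟨c, hc⟩ := (QuotientGroup.eq (s := unitaryScalars (Bulk d N Ω₀ φ))).1 h.symm
  obtain ⟨e, he⟩ := (QuotientGroup.eq (s := unitaryScalars (Bulk d N Ω₀ φ))).1 h
  have h3 := congrArg Subtype.val
    (mul_inv_cancel_left (bulkWord N Ω₀ φ x * bulkWord N Ω₀ φ y) (bulkWord N Ω₀ φ (x + y)))
  have h4 := congrArg Subtype.val
    (mul_inv_cancel_left (bulkWord N Ω₀ φ (x + y)) (bulkWord N Ω₀ φ x * bulkWord N Ω₀ φ y))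
  rw [Submonoid.coe_mul, hc, Algebra.algebraMap_eq_smul_one, mul_smul_comm, mul_one] at h3
  rw [Submonoid.coe_mul, he, Algebra.algebraMap_eq_smul_one, mul_smul_comm, mul_one] at h4
  exact ⟨⟨c, h3.symm⟩, e, h4.symm⟩

theorem exists_bulkWord_star (x : Fin d → ℤ) :
    ∃ c : ℂ, star (bulkWord N Ω₀ φ x : Bulk d N Ω₀ φ)
      = c • (bulkWord N Ω₀ φ (-x) : Bulk d N Ω₀ φ) := by
  obtain ⟨c, hc⟩ := (exists_bulkWord_add (N := N) (Ω₀ := Ω₀) (φ := φ) x (-x)).1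
  refine ⟨c, ?_⟩
  have h0 : (bulkWord N Ω₀ φ (x + -x) : Bulk d N Ω₀ φ) = 1 := by
    rw [add_neg_cancel, bulkWord]
    simp
  rw [h0, ← mul_smul_comm] at hc
  have := congrArg (star (bulkWord N Ω₀ φ x : Bulk d N Ω₀ φ) * ·) hc
  simp only [mul_one, ← mul_assoc] at this
  rwa [Unitary.coe_star_mul_self, one_mul] at this

theorem bulkFun_bulkWord (f : CN d N Ω₀) (x : Fin d → ℤ) :
    bulkFun φ f * (bulkWord N Ω₀ φ x : Bulk d N Ω₀ φ)
      = bulkWord N Ω₀ φ x * bulkFun φ (f.comp (shift x)) := by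
  -- The pairs (x, v) for which v satisfies the relation with shift x form a subgroup, so it
  -- suffices to check the generators.
  let H : Subgroup (Multiplicative (Fin d → ℤ) × unitary (Bulk d N Ω₀ φ)) :=
    { carrier := {p | ∀ f : CN d N Ω₀, bulkFun φ f * (p.2 : Bulk d N Ω₀ φ)
        = p.2 * bulkFun φ (f.comp (shift p.1.toAdd))}
      one_mem' := fun f => by simp [shift_zero]
      mul_mem' := by
        intro p q hp hq f
        rw [Prod.snd_mul, Submonoid.coe_mul, ← mul_assoc, hp, mul_assoc, hq, ← mul_assoc,
          ContinuousMap.comp_assoc, shift_comp_shift, Prod.fst_mul, toAdd_mul]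
      inv_mem' := by
        intro p hp f
        have h := hp (f.comp (shift (-p.1.toAdd)))
        rw [ContinuousMap.comp_assoc, shift_comp_shift, neg_add_cancel, shift_zero,
          ContinuousMap.comp_id] at h
        have h2 := congrArg (fun z => ((p.2⁻¹ : unitary (Bulk d N Ω₀ φ)) : Bulk d N Ω₀ φ) * z *
          ((p.2⁻¹ : unitary (Bulk d N Ω₀ φ)) : Bulk d N Ω₀ φ)) h
        simp only [mul_assoc] at h2
        rw [← Submonoid.coe_mul, mul_inv_cancel, Submonoid.coe_one, mul_one, ← mul_assoc,
          ← mul_assoc, ← Submonoid.coe_mul, inv_mul_cancel, Submonoid.coe_one, one_mul] at h2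
        exact h2.symm }
  exact list_ofFn_zpow_prod_mem H (fun j f => bulkFun_gen f j) x f

theorem bulkGauge_bulkWord (l : Fin d → Circle) (x : Fin d → ℤ) :
    bulkGauge l (bulkWord N Ω₀ φ x : Bulk d N Ω₀ φ)
      = (((torusChar x l)⁻¹ : Circle) : ℂ) • (bulkWord N Ω₀ φ x : Bulk d N Ω₀ φ) := by
  let H : Subgroup (Multiplicative (Fin d → ℤ) × unitary (Bulk d N Ω₀ φ)) :=
    { carrier := {p | bulkGauge l (p.2 : Bulk d N Ω₀ φ)
        = (((torusChar p.1.toAdd l)⁻¹ : Circle) : ℂ) • (p.2 : Bulk d N Ω₀ φ)}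
      one_mem' := by simp [torusChar_zero]
      mul_mem' := by
        intro p q hp hq
        simp only [mem_ofPred_eq] at hp hq ⊢
        rw [Prod.snd_mul, Submonoid.coe_mul, map_mul, hp, hq, smul_mul_smul_comm, Prod.fst_mul,
          toAdd_mul, torusChar_add, mul_inv, Circle.coe_mul]
      inv_mem' := by
        intro p hp
        simp only [mem_ofPred_eq] at hp ⊢
        rw [Prod.snd_inv, ← Unitary.star_eq_inv, Unitary.coe_star, map_star, hp, star_smul,
          Prod.fst_inv, toAdd_inv, torusChar_neg, Complex.star_def, ← Circle.coe_inv_eq_conj] }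
  refine list_ofFn_zpow_prod_mem H (fun j => ?_) x
  change bulkGauge l (bulkGen N Ω₀ φ j : Bulk d N Ω₀ φ) = _
  rw [bulkGauge_bulkGen, toAdd_ofAdd, torusChar_single]

/-! ### Density of the noncommutative polynomials -/

/-- The linear span of the elements `f u_x`. -/
def bulkPoly (d N : ℕ) (Ω₀ : Type u) [TopologicalSpace Ω₀] [CompactSpace Ω₀]
    (φ : Matrix (Fin d) (Fin d) ℝ) : Submodule ℂ (Bulk d N Ω₀ φ) :=
  Submodule.span ℂ
    (range fun p : CN d N Ω₀ × (Fin d → ℤ) => bulkFun φ p.1 * (bulkWord N Ω₀ φ p.2 : Bulk d N Ω₀ φ))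

theorem bulkFun_mul_bulkWord_mem (f : CN d N Ω₀) (x : Fin d → ℤ) :
    bulkFun φ f * (bulkWord N Ω₀ φ x : Bulk d N Ω₀ φ) ∈ bulkPoly d N Ω₀ φ :=
  Submodule.subset_span ⟨(f, x), rfl⟩

theorem bulkWord_mul_bulkFun_mem (f : CN d N Ω₀) (x : Fin d → ℤ) :
    (bulkWord N Ω₀ φ x : Bulk d N Ω₀ φ) * bulkFun φ f ∈ bulkPoly d N Ω₀ φ := by
  have h := bulkFun_bulkWord (φ := φ) (f.comp (shift (-x))) x
  rw [ContinuousMap.comp_assoc, shift_comp_shift, neg_add_cancel, shift_zero,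
    ContinuousMap.comp_id] at h
  rw [← h]
  exact bulkFun_mul_bulkWord_mem _ _

theorem bulkPoly_mul_mem {a b : Bulk d N Ω₀ φ} (ha : a ∈ bulkPoly d N Ω₀ φ)
    (hb : b ∈ bulkPoly d N Ω₀ φ) : a * b ∈ bulkPoly d N Ω₀ φ := by
  have h := Submodule.mul_mem_mul ha hb
  rw [bulkPoly, Submodule.span_mul_span] at h
  refine Submodule.span_le.2 ?_ h
  rintro _ ⟨_, ⟨⟨f, x⟩, rfl⟩, _, ⟨⟨g, y⟩, rfl⟩, rfl⟩
  have h1 := bulkFun_bulkWord (φ := φ) (g.comp (shift (-x))) x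
  rw [ContinuousMap.comp_assoc, shift_comp_shift, neg_add_cancel, shift_zero,
    ContinuousMap.comp_id] at h1
  obtain ⟨c, hc⟩ := (exists_bulkWord_add (N := N) (Ω₀ := Ω₀) (φ := φ) x y).2
  have h2 : bulkFun φ f * (bulkWord N Ω₀ φ x : Bulk d N Ω₀ φ) *
      (bulkFun φ g * (bulkWord N Ω₀ φ y : Bulk d N Ω₀ φ))
      = c • (bulkFun φ (f * g.comp (shift (-x))) * (bulkWord N Ω₀ φ (x + y) : Bulk d N Ω₀ φ)) := by
    rw [mul_assoc, ← mul_assoc _ (bulkFun φ g), ← h1, mul_assoc (bulkFun φ (g.comp _)), hc,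
      mul_smul_comm, mul_smul_comm, ← mul_assoc, ← map_mul]
  exact (congrArg (· ∈ bulkPoly d N Ω₀ φ) h2).mpr
    ((bulkPoly d N Ω₀ φ).smul_mem c (bulkFun_mul_bulkWord_mem _ _))

theorem bulkPoly_star_mem {a : Bulk d N Ω₀ φ} (ha : a ∈ bulkPoly d N Ω₀ φ) :
    star a ∈ bulkPoly d N Ω₀ φ := by
  induction ha using Submodule.span_induction with
  | mem a h =>
    obtain ⟨⟨f, x⟩, rfl⟩ := h
    obtain ⟨c, hc⟩ := exists_bulkWord_star (N := N) (Ω₀ := Ω₀) (φ := φ) x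
    simp only [star_mul]
    rw [hc, ← map_star, smul_mul_assoc]
    exact (bulkPoly d N Ω₀ φ).smul_mem c (bulkWord_mul_bulkFun_mem _ _)
  | zero => rw [star_zero]; exact Submodule.zero_mem _
  | add a b _ _ ha hb => rw [star_add]; exact Submodule.add_mem _ ha hb
  | smul c a _ ha => rw [star_smul]; exact Submodule.smul_mem _ _ ha

theorem bulkFun_mem_bulkPoly (f : CN d N Ω₀) : bulkFun φ f ∈ bulkPoly d N Ω₀ φ := by
  have h := bulkFun_mul_bulkWord_mem (φ := φ) f 0
  have h0 : bulkWord N Ω₀ φ 0 = 1 := by simp [bulkWord]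
  rwa [h0, Submonoid.coe_one, mul_one] at h

theorem bulkWord_single (j : Fin d) :
    bulkWord N Ω₀ φ (Pi.single j 1) = bulkGen N Ω₀ φ j := by
  have h : ∀ (d : ℕ) (G : Type (u + 1)) [Group G] (g : Fin d → G) (j : Fin d),
      (List.ofFn fun i => g i ^ (Pi.single j 1 : Fin d → ℤ) i).prod = g j := by
    intro d G _ g j
    induction d with
    | zero => exact j.elim0
    | succ d ih =>
      rw [List.ofFn_succ, List.prod_cons]
      refine Fin.cases ?_ (fun i => ?_) j
      · simp [Fin.succ_ne_zero]
      · have := ih (fun k => g k.succ) i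
        simp only [Pi.single_apply, Fin.succ_inj, (Fin.succ_ne_zero _).symm,
          if_false, zpow_zero, one_mul] at this ⊢
        exact this
  exact h d _ _ j

/-- The span is a ⋆-subalgebra, because words can be moved past functions and multiplied up to
scalars. It contains the generators, so its closure is everything. -/
theorem bulkPoly_dense (a : Bulk d N Ω₀ φ) : a ∈ (bulkPoly d N Ω₀ φ).topologicalClosure := by
  let P : StarSubalgebra ℂ (Bulk d N Ω₀ φ) :=
    { carrier := (bulkPoly d N Ω₀ φ : Set (Bulk d N Ω₀ φ))
      mul_mem' := bulkPoly_mul_mem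
      add_mem' := Submodule.add_mem _
      algebraMap_mem' := fun c => by
        rw [← AlgHomClass.commutes (bulkFun φ) c]
        exact bulkFun_mem_bulkPoly _
      star_mem' := bulkPoly_star_mem }
  have h1 : bulkSub d N Ω₀ φ ≤ (P.topologicalClosure.map (bulkSub d N Ω₀ φ).subtype) := by
    refine StarSubalgebra.topologicalClosure_minimal (StarAlgebra.adjoin_le ?_) ?_
    · rintro _ (⟨f, rfl⟩ | ⟨j, rfl⟩)
      · exact ⟨bulkFun φ f, P.le_topologicalClosure (bulkFun_mem_bulkPoly f), rfl⟩
      · refine ⟨bulkGen N Ω₀ φ j, P.le_topologicalClosure ?_, rfl⟩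
        have h := bulkFun_mul_bulkWord_mem (φ := φ) (1 : CN d N Ω₀) (Pi.single j 1)
        rw [map_one, one_mul, bulkWord_single] at h
        exact h
    -- The closure is taken inside the bulk algebra. It stays closed in the ambient product because
    -- the bulk algebra is closed there.
    · have hc : IsClosed (bulkSub d N Ω₀ φ : Set (RepProd d N Ω₀ φ)) := inferInstance
      exact hc.isClosedEmbedding_subtypeVal.isClosedMap (P.topologicalClosure : Set (Bulk d N Ω₀ φ))
        P.isClosed_topologicalClosure
  obtain ⟨b, hb, hab⟩ := h1 a.2
  have : b = a := Subtype.ext hab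
  rw [← this]
  exact hb

/-- Closed linear statements about the bulk algebra can be checked on the elements `f u_x`. -/
theorem bulk_induction {p : Bulk d N Ω₀ φ → Prop} (hp : IsClosed {a | p a})
    (hadd : ∀ a b, p a → p b → p (a + b)) (hsmul : ∀ (c : ℂ) a, p a → p (c • a))
    (h : ∀ f x, p (bulkFun φ f * (bulkWord N Ω₀ φ x : Bulk d N Ω₀ φ))) (a : Bulk d N Ω₀ φ) : p a := by
  have hsub : (bulkPoly d N Ω₀ φ : Set (Bulk d N Ω₀ φ)) ⊆ {a | p a} := by
    intro a ha
    refine Submodule.span_induction ?_ ?_ (fun a b _ _ => hadd a b) (fun c a _ => hsmul c a) ha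
    · rintro _ ⟨⟨f, x⟩, rfl⟩
      exact h f x
    · simpa using hsmul 0 _ (h 0 0)
  exact closure_minimal hsub hp (bulkPoly_dense a)

end BulkFourier
end

noncomputable section

section BulkFourierCoeff

open MeasureTheory

variable {d N : ℕ} {Ω₀ : Type u} [TopologicalSpace Ω₀] {φ : Matrix (Fin d) (Fin d) ℝ}
  [CompactSpace Ω₀]

/-! ### Fourier components -/

/-- The normalized Haar measure of the torus `(ℝ/ℤ)^d`. -/
def torusHaar (d : ℕ) : Measure (UnitAddTorus (Fin d)) :=
  Measure.pi fun _ => (AddCircle.haarAddCircle : Measure UnitAddCircle)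

instance : IsProbabilityMeasure (torusHaar d) := by
  unfold torusHaar; infer_instance

instance : (torusHaar d).IsAddLeftInvariant := by
  unfold torusHaar; infer_instance

/-- The point `(e^{2πi t_j})_j` of the torus. -/
def torusPoint (t : UnitAddTorus (Fin d)) : Fin d → Circle := fun j => AddCircle.toCircle (t j)

theorem torusPoint_add (s t : UnitAddTorus (Fin d)) :
    torusPoint (s + t) = torusPoint s * torusPoint t :=
  funext fun _ => AddCircle.toCircle_add _ _

theorem torusPoint_zero : torusPoint (0 : UnitAddTorus (Fin d)) = 1 :=
  funext fun _ => AddCircle.toCircle_zero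

theorem norm_bulkGauge_le (l : Fin d → Circle) (a : Bulk d N Ω₀ φ) : ‖bulkGauge l a‖ ≤ ‖a‖ :=
  NonUnitalStarAlgHom.norm_apply_le (bulkGauge l) a

theorem bulkGauge_bulkFun_mul_bulkWord (l : Fin d → Circle) (f : CN d N Ω₀) (x : Fin d → ℤ) :
    bulkGauge l (bulkFun φ f * (bulkWord N Ω₀ φ x : Bulk d N Ω₀ φ))
      = (((torusChar x l)⁻¹ : Circle) : ℂ) •
        (bulkFun φ f * (bulkWord N Ω₀ φ x : Bulk d N Ω₀ φ)) := by
  rw [map_mul, bulkGauge_bulkFun, bulkGauge_bulkWord, mul_smul_comm]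

/-- On the elements f u_x the orbit is a character times a constant vector. The gauge maps are
contractions, so continuity survives norm limits, which are uniform along the orbit. -/
theorem continuous_bulkGauge (a : Bulk d N Ω₀ φ) :
    Continuous fun t : UnitAddTorus (Fin d) => bulkGauge (torusPoint t) a := by
  refine bulk_induction (p := fun a => Continuous fun t : UnitAddTorus (Fin d) =>
    bulkGauge (torusPoint t) a) ?_ ?_ ?_ ?_ a
  · refine isClosed_of_closure_subset fun a ha => ?_
    refine continuous_of_uniform_approx_of_continuous fun U hU => ?_
    obtain ⟨ε, hε, hεU⟩ := Metric.mem_uniformity_dist.1 hU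
    obtain ⟨b, hb, hab⟩ := Metric.mem_closure_iff.1 ha ε hε
    refine ⟨_, hb, fun t => hεU ?_⟩
    rw [dist_eq_norm, ← map_sub]
    exact (norm_bulkGauge_le _ _).trans_lt (by rwa [← dist_eq_norm])
  · intro a b ha hb
    simp only [map_add]
    exact ha.add hb
  · intro c a ha
    simp only [map_smul]
    exact ha.const_smul c
  · intro f x
    simp only [bulkGauge_bulkFun_mul_bulkWord]
    suffices h : Continuous fun t : UnitAddTorus (Fin d) =>
        (((torusChar x (torusPoint t))⁻¹ : Circle) : ℂ) from h.smul continuous_const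
    have : (fun t : UnitAddTorus (Fin d) => (((torusChar x (torusPoint t))⁻¹ : Circle) : ℂ))
        = fun t => UnitAddTorus.mFourier (-x) t := by
      ext t
      rw [mFourier_eq_torusChar, torusChar_neg]
      rfl
    rw [this]
    exact (UnitAddTorus.mFourier (-x)).continuous

theorem integrable_mFourier_smul_bulkGauge (x : Fin d → ℤ) (a : Bulk d N Ω₀ φ) :
    Integrable (fun t => UnitAddTorus.mFourier x t • bulkGauge (torusPoint t) a)
      (torusHaar d) := by
  have h : Continuous fun t => UnitAddTorus.mFourier x t • bulkGauge (torusPoint t) a :=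
    (UnitAddTorus.mFourier x).continuous.smul (continuous_bulkGauge a)
  rw [← integrableOn_univ]
  exact h.continuousOn.integrableOn_compact isCompact_univ

theorem norm_mFourier_apply (x : Fin d → ℤ) (t : UnitAddTorus (Fin d)) :
    ‖UnitAddTorus.mFourier x t‖ = 1 := by
  rw [mFourier_eq_torusChar, Circle.norm_coe]

/-- The homogeneous component `∫ λ^x ρ_λ(a) dμ(λ)` of `a`. -/
def bulkComponent (x : Fin d → ℤ) : Bulk d N Ω₀ φ →L[ℂ] Bulk d N Ω₀ φ :=
  LinearMap.mkContinuous
    { toFun := fun a => ∫ t, UnitAddTorus.mFourier x t • bulkGauge (torusPoint t) a ∂(torusHaar d)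
      map_add' := fun a b => by
        rw [← integral_add (integrable_mFourier_smul_bulkGauge x a)
          (integrable_mFourier_smul_bulkGauge x b)]
        simp only [map_add, smul_add]
      map_smul' := fun c a => by
        rw [RingHom.id_apply, ← integral_smul]
        simp only [map_smul, smul_comm c] }
    1 fun a => by
      rw [one_mul]
      refine (norm_integral_le_of_norm_le_const (C := ‖a‖)
        (Filter.Eventually.of_forall fun t => ?_)).trans_eq ?_
      · rw [norm_smul, norm_mFourier_apply, one_mul]
        exact norm_bulkGauge_le _ _
      · simp

theorem bulkComponent_apply (x : Fin d → ℤ) (a : Bulk d N Ω₀ φ) :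
    bulkComponent x a
      = ∫ t, UnitAddTorus.mFourier x t • bulkGauge (torusPoint t) a ∂(torusHaar d) := rfl

theorem norm_bulkComponent_le (x : Fin d → ℤ) :
    ‖(bulkComponent x : Bulk d N Ω₀ φ →L[ℂ] Bulk d N Ω₀ φ)‖ ≤ 1 :=
  LinearMap.mkContinuous_norm_le _ zero_le_one _

theorem mFourierCoeff_bulkGauge (x : Fin d → ℤ) (a : Bulk d N Ω₀ φ) :
    UnitAddTorus.mFourierCoeff (fun t => bulkGauge (torusPoint t) a) x
      = bulkComponent (-x) a := rfl

theorem bulkFourierCoeff_eq (x : Fin d → ℤ) (a : Bulk d N Ω₀ φ) :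
    bulkFourierCoeff x a = bulkComponent x a * star (bulkMonomial N Ω₀ φ x) := by
  rw [bulkFourierCoeff]
  congr 1
  have := mFourierCoeff_bulkGauge (-x) a
  rwa [neg_neg] at this

theorem bulkComponent_eq (x : Fin d → ℤ) (a : Bulk d N Ω₀ φ) :
    bulkComponent x a = bulkFourierCoeff x a * bulkMonomial N Ω₀ φ x := by
  rw [bulkFourierCoeff_eq, mul_assoc, (bulkMonomial_mem_unitary x).1, mul_one]

theorem norm_bulkFourierCoeff (x : Fin d → ℤ) (a : Bulk d N Ω₀ φ) :
    ‖bulkFourierCoeff x a‖ = ‖bulkComponent x a‖ := by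
  rw [bulkFourierCoeff_eq]
  have h := (Unitary.star_mem (bulkMonomial_mem_unitary (N := N) (Ω₀ := Ω₀) (φ := φ) x))
  exact CStarRing.norm_mul_mem_unitary _ h

theorem bulkComponent_bulkGauge (x : Fin d → ℤ) (s : UnitAddTorus (Fin d)) (a : Bulk d N Ω₀ φ) :
    bulkComponent x (bulkGauge (torusPoint s) a)
      = UnitAddTorus.mFourier (-x) s • bulkComponent x a := by
  -- Translation by -s under the Haar integral removes the inner gauge map and leaves the character
  -- of s.
  rw [bulkComponent_apply, bulkComponent_apply, ← integral_smul,
    ← integral_add_left_eq_self _ (-s)]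
  refine integral_congr_ae (Filter.Eventually.of_forall fun t => ?_)
  simp only
  rw [bulkGauge_bulkGauge, ← torusPoint_add, neg_add_cancel_comm, smul_smul, mFourier_eq_torusChar,
    mFourier_eq_torusChar, mFourier_eq_torusChar]
  congr 1
  change ((torusChar x (torusPoint (-s + t)) : Circle) : ℂ)
    = (torusChar (-x) (torusPoint s) : Circle) * (torusChar x (torusPoint t) : Circle)
  have h : torusPoint (-s) * torusPoint s = 1 := by
    rw [← torusPoint_add, neg_add_cancel, torusPoint_zero]
  have h2 : torusChar x (torusPoint (-s)) = torusChar (-x) (torusPoint s) := by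
    rw [torusChar_neg]
    refine eq_inv_of_mul_eq_one_left ?_
    rw [← torusChar_mul, h]
    simp [torusChar]
  rw [torusPoint_add, torusChar_mul, h2, Circle.coe_mul]

theorem circleExp_sum {ι : Type*} (s : Finset ι) (g : ι → ℝ) :
    Circle.exp (∑ i ∈ s, g i) = ∏ i ∈ s, Circle.exp (g i) := by
  classical
  induction s using Finset.induction_on with
  | empty => simp
  | insert i s hi ih => rw [Finset.sum_insert hi, Finset.prod_insert hi, Circle.exp_add, ih]

theorem circleExp_eq_toCircle (θ : ℝ) :
    Circle.exp θ = AddCircle.toCircle ((θ / (2 * Real.pi) : ℝ) : UnitAddCircle) := by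
  rw [AddCircle.toCircle_apply_mk]
  congr 1
  field_simp

theorem bulkComponent_bulkGauge_exp (x : Fin d → ℤ) (θ : Fin d → ℝ) (a : Bulk d N Ω₀ φ) :
    bulkComponent x (bulkGauge (fun j => Circle.exp (θ j)) a)
      = Complex.exp (-(∑ j, x j * θ j : ℝ) * Complex.I) • bulkComponent x a := by
  have h := bulkComponent_bulkGauge x
    (fun j => ((θ j / (2 * Real.pi) : ℝ) : UnitAddCircle)) a
  have h2 : torusPoint (fun j => ((θ j / (2 * Real.pi) : ℝ) : UnitAddCircle))
      = fun j => Circle.exp (θ j) := funext fun j => (circleExp_eq_toCircle _).symm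
  rw [mFourier_eq_torusChar] at h
  change bulkComponent x (bulkGauge (torusPoint _) a) = ((torusChar (-x) (torusPoint _) : Circle) : ℂ)
    • _ at h
  rw [h2] at h
  rw [h]
  congr 1
  have h3 : torusChar (-x) (fun j => Circle.exp (θ j)) = Circle.exp (-(∑ j, x j * θ j)) := by
    rw [torusChar, ← Finset.sum_neg_distrib, circleExp_sum]
    refine Finset.prod_congr rfl fun j _ => ?_
    rw [← Circle.exp_intCast_mul, Pi.neg_apply]
    congr 1
    push_cast
    ring
  rw [h3, Circle.coe_exp]
  push_cast
  rfl

/-! ### Decay and inversion for smooth elements -/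

/-- Along the j-th coordinate circle the x-component oscillates with frequency -x_j, so k
derivatives of the orbit bound |x_j|^k times its norm. The coordinate of largest modulus gives
|x|^k, and 1 + |x| ≤ 2|x| for x ≠ 0. -/
theorem exists_norm_bulkComponent_le {a : Bulk d N Ω₀ φ} (ha : IsSmoothElement a) (k : ℕ) :
    ∃ C : ℝ, 0 ≤ C ∧ ∀ x, (1 + (latticeLen x : ℝ)) ^ k * ‖bulkComponent x a‖ ≤ C := by
  have key : ∀ j : Fin d, ∃ C : ℝ, ∀ x : Fin d → ℤ,
      ((x j).natAbs : ℝ) ^ k * ‖bulkComponent x a‖ ≤ C := by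
    intro j
    set f : ℝ → Bulk d N Ω₀ φ := fun s => bulkGauge (fun i => Circle.exp ((Pi.single j s : Fin d → ℝ) i)) a
    have hf : ContDiff ℝ k f :=
      (ha k).comp (ContinuousLinearMap.single ℝ (fun _ : Fin d => ℝ) j).contDiff
    refine ⟨‖iteratedFDeriv ℝ k f 0‖, fun x => ?_⟩
    have h := abs_pow_mul_norm_le_of_oscillation
      ((bulkComponent x : Bulk d N Ω₀ φ →L[ℂ] Bulk d N Ω₀ φ).restrictScalars ℝ)
      (by rw [ContinuousLinearMap.norm_restrictScalars]; exact norm_bulkComponent_le x) hf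
      (κ := -(x j : ℝ)) (y := bulkComponent x a) fun s => by
        change bulkComponent x (f s) = _
        rw [bulkComponent_bulkGauge_exp]
        congr 2
        rw [Finset.sum_eq_single j]
        · rw [Pi.single_eq_same]; push_cast; ring
        · intro i _ hi; rw [Pi.single_eq_of_ne hi, mul_zero]
        · simp
    rwa [abs_neg, ← Int.cast_abs, Int.abs_eq_natAbs, Int.cast_natCast] at h
  choose C hC using key
  refine ⟨2 ^ k * (‖a‖ + ∑ j, |C j|), by positivity, fun x => ?_⟩
  have h0 : ‖bulkComponent x a‖ ≤ ‖a‖ := by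
    simpa using (bulkComponent x).le_of_opNorm_le (norm_bulkComponent_le x) a
  have h1 : (latticeLen x : ℝ) ^ k * ‖bulkComponent x a‖ ≤ ‖a‖ + ∑ j, |C j| := by
    have hs : 0 ≤ ∑ j, |C j| := Finset.sum_nonneg fun j _ => abs_nonneg _
    rcases isEmpty_or_nonempty (Fin d) with hd | hd
    · have : latticeLen x = 0 := by simp [latticeLen]
      rw [this, Nat.cast_zero]
      have h2 : (0 : ℝ) ^ k ≤ 1 := pow_le_one₀ le_rfl zero_le_one
      nlinarith [norm_nonneg (bulkComponent x a)]
    · obtain ⟨j, -, hj⟩ := Finset.exists_mem_eq_sup Finset.univ Finset.univ_nonempty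
        fun j => (x j).natAbs
      rw [show latticeLen x = (x j).natAbs from hj]
      refine (hC j x).trans ((le_abs_self _).trans ?_)
      have := Finset.single_le_sum (f := fun j => |C j|) (fun i _ => abs_nonneg _)
        (Finset.mem_univ j)
      linarith [norm_nonneg a]
  by_cases hx : latticeLen x = 0
  · rw [hx, Nat.cast_zero, add_zero, one_pow, one_mul]
    refine h0.trans ?_
    have hs : 0 ≤ ∑ j, |C j| := Finset.sum_nonneg fun j _ => abs_nonneg _
    have h2 : (1 : ℝ) ≤ 2 ^ k := one_le_pow₀ one_le_two
    nlinarith [norm_nonneg a]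
  · have h3 : (1 : ℝ) ≤ latticeLen x := by exact_mod_cast Nat.one_le_iff_ne_zero.2 hx
    calc _ ≤ (2 * (latticeLen x : ℝ)) ^ k * ‖bulkComponent x a‖ := by gcongr; linarith
      _ = 2 ^ k * ((latticeLen x : ℝ) ^ k * ‖bulkComponent x a‖) := by rw [mul_pow]; ring
      _ ≤ _ := by gcongr

theorem summable_norm_bulkComponent {a : Bulk d N Ω₀ φ} (ha : IsSmoothElement a) :
    Summable fun x => ‖bulkComponent x a‖ := by
  obtain ⟨C, hC0, hC⟩ := exists_norm_bulkComponent_le ha (2 * d)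
  refine Summable.of_nonneg_of_le (fun x => norm_nonneg _) (fun x => ?_)
    ((summable_one_add_latticeLen_inv_pow d).mul_left C)
  rw [← div_eq_mul_inv, le_div_iff₀ (by positivity), mul_comm]
  exact hC x

/-- Fourier inversion for smooth elements. -/
theorem hasSum_bulkComponent {a : Bulk d N Ω₀ φ} (ha : IsSmoothElement a) :
    HasSum (fun x => bulkComponent x a) a := by
  have hs : Summable fun x => bulkComponent x a := (summable_norm_bulkComponent ha).of_norm
  -- A bounded functional reduces inversion to a scalar continuous function on the torus with
  -- summable Fourier coefficients, evaluated at the neutral element.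
  have key : ∀ T : StrongDual ℂ (Bulk d N Ω₀ φ), HasSum (fun x => T (bulkComponent x a)) (T a) := by
    intro T
    let f : C(UnitAddTorus (Fin d), ℂ) := ⟨fun t => T (bulkGauge (torusPoint t) a),
      T.continuous.comp (continuous_bulkGauge a)⟩
    have hf : ∀ x, UnitAddTorus.mFourierCoeff f x = T (bulkComponent (-x) a) := by
      intro x
      rw [bulkComponent_apply, ← T.integral_comp_comm (integrable_mFourier_smul_bulkGauge _ a)]
      simp only [map_smul]
      rfl
    have hsum : Summable (UnitAddTorus.mFourierCoeff f) := by
      refine Summable.congr (T.summable (f := fun x => bulkComponent (-x) a)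
        ((Equiv.neg (Fin d → ℤ)).summable_iff.2 hs)) fun x => (hf x).symm
    have h := UnitAddTorus.hasSum_mFourier_series_apply_of_summable hsum 0
    have h0 : ∀ x : Fin d → ℤ, UnitAddTorus.mFourier x 0 = 1 := fun x => by
      simp [UnitAddTorus.mFourier]
    simp only [hf, h0, smul_eq_mul, mul_one] at h
    change HasSum _ (T (bulkGauge (torusPoint 0) a)) at h
    rw [torusPoint_zero, bulkGauge_one] at h
    exact (Equiv.neg (Fin d → ℤ)).hasSum_iff.1 h
  have h : ∑' x, bulkComponent x a = a := by
    refine (SeparatingDual.eq_iff_forall_dual_eq (R := ℂ)).2 fun T => ?_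
    rw [T.map_tsum hs]
    exact (key T).tsum_eq
  have h2 := hs.hasSum
  rwa [h] at h2

/-! ### Fourier coefficients are functions -/

theorem exists_mFourier_ne {x y : Fin d → ℤ} (h : x ≠ y) :
    ∃ t : UnitAddTorus (Fin d), UnitAddTorus.mFourier x t ≠ UnitAddTorus.mFourier y t := by
  by_contra! hc
  have h1 : UnitAddTorus.mFourier x = UnitAddTorus.mFourier y := ContinuousMap.ext hc
  refine h (UnitAddTorus.orthonormal_mFourier.linearIndependent.injective ?_)
  rw [UnitAddTorus.mFourierLp, h1]

theorem bulkComponent_bulkFun_mul_bulkWord (f : CN d N Ω₀) (x y : Fin d → ℤ) :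
    bulkComponent x (bulkFun φ f * (bulkWord N Ω₀ φ y : Bulk d N Ω₀ φ))
      = if x = y then bulkFun φ f * (bulkWord N Ω₀ φ y : Bulk d N Ω₀ φ) else 0 := by
  have hg : ∀ t : UnitAddTorus (Fin d), bulkGauge (torusPoint t)
      (bulkFun φ f * (bulkWord N Ω₀ φ y : Bulk d N Ω₀ φ))
      = UnitAddTorus.mFourier (-y) t • (bulkFun φ f * (bulkWord N Ω₀ φ y : Bulk d N Ω₀ φ)) := by
    intro t
    rw [bulkGauge_bulkFun_mul_bulkWord, mFourier_eq_torusChar, torusChar_neg]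
    rfl
  split_ifs with hxy
  · subst hxy
    rw [bulkComponent_apply]
    have h : ∀ t : UnitAddTorus (Fin d), UnitAddTorus.mFourier x t • bulkGauge (torusPoint t)
        (bulkFun φ f * (bulkWord N Ω₀ φ x : Bulk d N Ω₀ φ))
        = bulkFun φ f * (bulkWord N Ω₀ φ x : Bulk d N Ω₀ φ) := by
      intro t
      rw [hg, smul_smul, ← UnitAddTorus.mFourier_add, add_neg_cancel, UnitAddTorus.mFourier_zero,
        ContinuousMap.one_apply, one_smul]
    simp only [h, integral_const, probReal_univ, one_smul]
  -- The component is multiplied by two characters that differ at `t`, so it vanishes.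
  · obtain ⟨t, ht⟩ := exists_mFourier_ne (fun h => hxy (neg_injective h) : -x ≠ -y)
    have h := bulkComponent_bulkGauge x t (bulkFun φ f * (bulkWord N Ω₀ φ y : Bulk d N Ω₀ φ))
    rw [hg, map_smul, ← sub_eq_zero, ← sub_smul] at h
    exact (smul_eq_zero.1 h).resolve_left (sub_ne_zero.2 ht.symm)

/-- An injective ⋆-homomorphism is isometric, so its range is closed and the claim need only be
checked on the elements f u_y. There the coefficient is zero or a phase times f. -/
theorem bulkFourierCoeff_mem_range (hinj : Function.Injective (bulkFun (N := N) (Ω₀ := Ω₀) φ))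
    (x : Fin d → ℤ) (a : Bulk d N Ω₀ φ) :
    bulkFourierCoeff x a ∈ range (bulkFun (N := N) (Ω₀ := Ω₀) φ) := by
  have hclosed : IsClosed (range (bulkFun (N := N) (Ω₀ := Ω₀) φ)) :=
    (NonUnitalStarAlgHom.isometry (bulkFun (N := N) (Ω₀ := Ω₀) φ)
      hinj).isClosedEmbedding.isClosed_range
  refine bulk_induction (p := fun a => bulkFourierCoeff x a ∈ range (bulkFun φ)) ?_ ?_ ?_ ?_ a
  · simp only [bulkFourierCoeff_eq]
    exact hclosed.preimage ((bulkComponent x).continuous.mul continuous_const)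
  · rintro a b ⟨f, hf⟩ ⟨g, hg⟩
    refine ⟨f + g, ?_⟩
    rw [bulkFourierCoeff_eq] at *
    rw [map_add, hf, hg, map_add, add_mul]
  · rintro c a ⟨f, hf⟩
    refine ⟨c • f, ?_⟩
    rw [bulkFourierCoeff_eq] at *
    rw [map_smul, hf, map_smul, smul_mul_assoc]
  · intro f y
    rw [bulkFourierCoeff_eq, bulkComponent_bulkFun_mul_bulkWord]
    split_ifs with hxy
    · subst hxy
      obtain ⟨c, hc⟩ := exists_bulkMonomial_eq (N := N) (Ω₀ := Ω₀) (φ := φ) x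
      refine ⟨star (c : ℂ) • f, ?_⟩
      rw [hc, star_smul, mul_smul_comm, mul_assoc, (bulkWord N Ω₀ φ x).2.2, mul_one, map_smul]
    · exact ⟨0, by rw [zero_mul, map_zero]⟩

end BulkFourierCoeff
end

noncomputable section

/-! ## Comparison of two matrices by an off-diagonal corner -/

section Doubling

variable {N : ℕ}

/-- Two copies of `ℂ^N`. -/
abbrev DoubleSpace (N : ℕ) : Type := EuclideanSpace ℂ (Fin N ⊕ Fin N)

/-- The block diagonal operator `A ⊕ A'`. -/
def blockDiagHom (N : ℕ) : Matrix (Fin N) (Fin N) ℂ × Matrix (Fin N) (Fin N) ℂ →⋆ₐ[ℂ]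
    (DoubleSpace N →L[ℂ] DoubleSpace N) where
  toFun p := Matrix.toEuclideanCLM (𝕜 := ℂ) (Matrix.fromBlocks p.1 0 0 p.2)
  map_one' := by rw [Prod.fst_one, Prod.snd_one, Matrix.fromBlocks_one, map_one]
  map_mul' p q := by
    rw [← map_mul, Matrix.fromBlocks_multiply]
    simp
  map_zero' := by rw [Prod.fst_zero, Prod.snd_zero, Matrix.fromBlocks_zero, map_zero]
  map_add' p q := by
    rw [← map_add, Matrix.fromBlocks_add]
    simp
  commutes' c := by
    rw [← AlgHomClass.commutes (Matrix.toEuclideanCLM (𝕜 := ℂ) (n := Fin N ⊕ Fin N)) c]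
    congr 1
    rw [Prod.algebraMap_apply, Algebra.algebraMap_eq_smul_one, Algebra.algebraMap_eq_smul_one,
      ← Matrix.fromBlocks_one, Matrix.fromBlocks_smul]
    simp
  map_star' p := by
    rw [← map_star, Matrix.star_eq_conjTranspose, Matrix.fromBlocks_conjTranspose]
    simp [Matrix.star_eq_conjTranspose]

theorem blockDiagHom_apply (p : Matrix (Fin N) (Fin N) ℂ × Matrix (Fin N) (Fin N) ℂ) :
    blockDiagHom N p = Matrix.toEuclideanCLM (𝕜 := ℂ) (Matrix.fromBlocks p.1 0 0 p.2) := rfl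

theorem norm_blockDiagHom_le (A B : Matrix (Fin N) (Fin N) ℂ) :
    ‖blockDiagHom N (A, B)‖ ≤ max ‖A‖ ‖B‖ :=
  NonUnitalStarAlgHom.norm_apply_le (blockDiagHom N) (A, B)

theorem blockDiagHom_injective : Function.Injective (blockDiagHom N) := by
  intro p q h
  have h1 := (Matrix.toEuclideanCLM (𝕜 := ℂ) (n := Fin N ⊕ Fin N)).injective h
  obtain ⟨h2, -, -, h3⟩ := Matrix.fromBlocks_inj.1 h1
  exact Prod.ext h2 h3

theorem norm_blockDiagHom (A B : Matrix (Fin N) (Fin N) ℂ) :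
    ‖blockDiagHom N (A, B)‖ = max ‖A‖ ‖B‖ :=
  NonUnitalStarAlgHom.norm_map (blockDiagHom N) blockDiagHom_injective (A, B)

/-- The projection onto the diagonal of `ℂ^N ⊕ ℂ^N`. -/
def diagProj (N : ℕ) : DoubleSpace N →L[ℂ] DoubleSpace N :=
  Matrix.toEuclideanCLM (𝕜 := ℂ) ((2⁻¹ : ℂ) • Matrix.fromBlocks 1 1 1 1)

theorem star_diagProj : star (diagProj N) = diagProj N := by
  rw [diagProj, ← map_star, star_smul, Matrix.star_eq_conjTranspose,
    Matrix.fromBlocks_conjTranspose]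
  simp

theorem diagProj_mul_self : diagProj N * diagProj N = diagProj N := by
  rw [diagProj, ← map_mul, smul_mul_smul_comm, Matrix.fromBlocks_multiply]
  congr 1
  simp only [mul_one, ← two_smul ℂ (1 : Matrix (Fin N) (Fin N) ℂ)]
  rw [← Matrix.fromBlocks_smul, smul_smul]
  norm_num

theorem diagProj_mul_compl : diagProj N * (1 - diagProj N) = 0 := by
  rw [mul_sub, mul_one, diagProj_mul_self, sub_self]

theorem compl_mul_diagProj : (1 - diagProj N) * diagProj N = 0 := by
  rw [sub_mul, one_mul, diagProj_mul_self, sub_self]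

theorem compl_mul_compl : (1 - diagProj N) * (1 - diagProj N) = 1 - diagProj N := by
  rw [sub_mul, one_mul, diagProj_mul_compl, sub_zero]

theorem diagProj_mul_blockDiagHom (A : Matrix (Fin N) (Fin N) ℂ) :
    diagProj N * blockDiagHom N (A, A) = blockDiagHom N (A, A) * diagProj N := by
  rw [blockDiagHom_apply, diagProj, ← map_mul, ← map_mul, smul_mul_assoc, mul_smul_comm,
    Matrix.fromBlocks_multiply, Matrix.fromBlocks_multiply]
  simp

theorem norm_le_one_of_projection {A : Type*} [CStarAlgebra A] {p : A} (h1 : star p = p)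
    (h2 : p * p = p) : ‖p‖ ≤ 1 := by
  have h := CStarRing.norm_star_mul_self (x := p)
  rw [h1, h2] at h
  by_contra! hc
  nlinarith

theorem norm_diagProj_le : ‖diagProj N‖ ≤ 1 :=
  norm_le_one_of_projection star_diagProj diagProj_mul_self

theorem norm_compl_diagProj_le : ‖1 - diagProj N‖ ≤ 1 :=
  norm_le_one_of_projection (by rw [star_sub, star_one, star_diagProj]) compl_mul_compl

theorem blockDiagHom_sub_blockDiagHom (A B : Matrix (Fin N) (Fin N) ℂ) :
    blockDiagHom N (A, B) = blockDiagHom N (A - B, 0) + blockDiagHom N (B, B) := by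
  rw [← map_add]
  simp

/-- Write A ⊕ B = (A - B) ⊕ 0 + B ⊕ B. The second summand commutes with the projection and has no
off-diagonal corner. -/
theorem corner_blockDiagHom (A B : Matrix (Fin N) (Fin N) ℂ) :
    diagProj N * blockDiagHom N (A, B) * (1 - diagProj N)
      = diagProj N * blockDiagHom N (A - B, 0) * (1 - diagProj N) := by
  rw [blockDiagHom_sub_blockDiagHom A B, mul_add, add_mul, diagProj_mul_blockDiagHom, mul_assoc _ _ (1 - diagProj N),
    mul_assoc (blockDiagHom N (B, B)), diagProj_mul_compl, mul_zero, add_zero]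

theorem corner_blockDiagHom' (A B : Matrix (Fin N) (Fin N) ℂ) :
    (1 - diagProj N) * blockDiagHom N (A, B) * diagProj N
      = (1 - diagProj N) * blockDiagHom N (A - B, 0) * diagProj N := by
  rw [blockDiagHom_sub_blockDiagHom A B, mul_add, add_mul, mul_assoc _ (blockDiagHom N (B, B)),
    ← diagProj_mul_blockDiagHom, ← mul_assoc (1 - diagProj N) (diagProj N), compl_mul_diagProj,
    zero_mul, add_zero]

theorem norm_mul_mul_le_of_norm_le_one {A : Type*} [NormedRing A] {p q x : A} (hp : ‖p‖ ≤ 1)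
    (hq : ‖q‖ ≤ 1) : ‖p * x * q‖ ≤ ‖x‖ :=
  calc _ ≤ ‖p * x‖ * ‖q‖ := norm_mul_le _ _
    _ ≤ ‖p * x‖ := mul_le_of_le_one_right (norm_nonneg _) hq
    _ ≤ ‖p‖ * ‖x‖ := norm_mul_le _ _
    _ ≤ ‖x‖ := mul_le_of_le_one_left (norm_nonneg _) hp

theorem norm_corner_le (A B : Matrix (Fin N) (Fin N) ℂ) :
    ‖diagProj N * blockDiagHom N (A, B) * (1 - diagProj N)‖ ≤ ‖A - B‖ := by
  rw [corner_blockDiagHom]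
  refine (norm_mul_mul_le_of_norm_le_one norm_diagProj_le norm_compl_diagProj_le).trans ?_
  exact (norm_blockDiagHom_le _ _).trans (by simp)

theorem norm_corner_le' (A B : Matrix (Fin N) (Fin N) ℂ) :
    ‖(1 - diagProj N) * blockDiagHom N (A, B) * diagProj N‖ ≤ ‖A - B‖ := by
  rw [corner_blockDiagHom']
  refine (norm_mul_mul_le_of_norm_le_one norm_compl_diagProj_le norm_diagProj_le).trans ?_
  exact (norm_blockDiagHom_le _ _).trans (by simp)

/-- The upper left blocks of the projection and of its complement are both 1/2. Compression of the
corner to the first copy of ℂ^N therefore gives (A - B)/4. -/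
theorem norm_sub_le_norm_corner (A B : Matrix (Fin N) (Fin N) ℂ) :
    ‖A - B‖ ≤ 4 * ‖diagProj N * blockDiagHom N (A, B) * (1 - diagProj N)‖ := by
  have h1 : ‖blockDiagHom N (1, 0)‖ ≤ 1 :=
    (norm_blockDiagHom_le _ _).trans (by
      rw [norm_zero, max_eq_left (norm_nonneg _)]
      exact CStarAlgebra.norm_one_le _)
  have h2 : blockDiagHom N (1, 0) * (diagProj N * blockDiagHom N (A, B) * (1 - diagProj N))
      * blockDiagHom N (1, 0) = (4⁻¹ : ℂ) • blockDiagHom N (A - B, 0) := by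
    rw [corner_blockDiagHom, blockDiagHom_apply, blockDiagHom_apply, diagProj, ← map_smul,
      ← map_one (Matrix.toEuclideanCLM (𝕜 := ℂ) (n := Fin N ⊕ Fin N)), ← map_sub, ← map_mul,
      ← map_mul, ← map_mul, ← map_mul, ← Matrix.fromBlocks_one,
      sub_eq_add_neg (Matrix.fromBlocks _ _ _ _) _, ← neg_smul, Matrix.fromBlocks_smul, Matrix.fromBlocks_smul, Matrix.fromBlocks_smul,
      Matrix.fromBlocks_add]
    simp only [Matrix.fromBlocks_multiply]
    congr 2 <;> simp
    rw [mul_add, mul_one, mul_neg, mul_smul_comm, mul_one, smul_add, smul_neg, smul_smul,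
      ← sub_eq_add_neg, ← sub_smul]
    norm_num
  have h3 := norm_mul_mul_le_of_norm_le_one (x := diagProj N * blockDiagHom N (A, B) * (1 - diagProj N)) h1 h1
  rw [h2, norm_smul, norm_blockDiagHom, norm_zero, max_eq_left (norm_nonneg _)] at h3
  norm_num at h3
  linarith

end Doubling

/-! ## Summable series of oscillating operators -/

section PhaseSeries

variable {d : ℕ} {ι F : Type*} [NormedAddCommGroup F] [InnerProductSpace ℂ F] [CompleteSpace F]

theorem norm_monomialCLM_apply_le (τ : Equiv.Perm ι) (m : BddFam ι (F →L[ℂ] F)) :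
    ‖monomialCLM τ m‖ ≤ ‖m‖ :=
  (ContinuousLinearMap.le_opNorm (monomialCLM (F := F) τ) m).trans
    (mul_le_of_le_one_left (norm_nonneg m) (norm_monomialCLM_le τ))

/-- Interpolation between two families of moment bounds. -/
theorem exists_mixed_moment_le {X : Type*} {a b c : X → ℝ} 
    (hc : ∀ x, 0 ≤ c x) (h1 : ∀ k : ℕ, ∃ C : ℝ, ∀ x, a x ^ k * c x ≤ C)
    (h2 : ∀ k : ℕ, ∃ C : ℝ, ∀ x, b x ^ k * c x ≤ C) (j k : ℕ) :
    ∃ C : ℝ, 0 ≤ C ∧ ∀ x, a x ^ j * (b x ^ k * c x) ≤ C := by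
  obtain ⟨C1, hC1⟩ := h1 (2 * j)
  obtain ⟨C2, hC2⟩ := h2 (2 * k)
  refine ⟨|C1| + |C2|, by positivity, fun x => ?_⟩
  have e1 := (hC1 x).trans (le_abs_self _)
  have e2 := (hC2 x).trans (le_abs_self _)
  -- The arithmetic-geometric mean inequality for a^j and b^k; it explains the doubled exponents
  -- above.
  have h3 : a x ^ j * b x ^ k ≤ a x ^ (2 * j) + b x ^ (2 * k) := by
    rw [mul_comm 2 j, mul_comm 2 k, pow_mul, pow_mul]
    nlinarith [sq_nonneg (a x ^ j - b x ^ k), sq_nonneg (a x ^ j), sq_nonneg (b x ^ k)]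
  calc a x ^ j * (b x ^ k * c x) = (a x ^ j * b x ^ k) * c x := by ring
    _ ≤ (a x ^ (2 * j) + b x ^ (2 * k)) * c x := mul_le_mul_of_nonneg_right h3 (hc x)
    _ ≤ |C1| + |C2| := by rw [add_mul]; exact add_le_add e1 e2

variable {σ : (Fin d → ℤ) → Equiv.Perm ι} {κ : (Fin d → ℤ) → ι → ℝ}
  {f : (Fin d → ℤ) → ι → F →L[ℂ] F}

theorem summable_monomialCLM
    (h1 : ∀ k : ℕ, ∃ C : ℝ, ∀ x i, (1 + (latticeLen x : ℝ)) ^ k * ‖f x i‖ ≤ C) (s : ℝ) :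
    Summable fun x => monomialCLM (σ x) (phaseFamily (κ x) (f x) s) := by
  obtain ⟨C, hC⟩ := h1 (2 * d)
  have hb : ∀ x, ‖monomialCLM (σ x) (phaseFamily (κ x) (f x) s)‖
      ≤ |C| * ((1 + (latticeLen x : ℝ)) ^ (2 * d))⁻¹ := by
    intro x
    have h2 : ‖phaseFamily (κ x) (f x) s‖ ≤ |C| * ((1 + (latticeLen x : ℝ)) ^ (2 * d))⁻¹ := by
      refine norm_bddFamily_le (by positivity) fun i => ?_
      rw [norm_phase_smul, ← div_eq_mul_inv, le_div_iff₀ (by positivity), mul_comm]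
      exact (hC x i).trans (le_abs_self C)
    exact (norm_monomialCLM_apply_le _ _).trans h2
  exact Summable.of_norm_bounded ((summable_one_add_latticeLen_inv_pow d).mul_left |C|) hb

/-- The k-th derivative of a summand is bounded by a k-th frequency moment. Interpolation with the
decay in x makes that moment O((1 + |x|)^{-2d}), which is summable. -/
theorem contDiff_tsum_monomialCLM
    (h1 : ∀ k : ℕ, ∃ C : ℝ, ∀ x i, (1 + (latticeLen x : ℝ)) ^ k * ‖f x i‖ ≤ C)
    (h2 : ∀ k : ℕ, ∃ C : ℝ, ∀ x i, |κ x i| ^ k * ‖f x i‖ ≤ C) (n : ℕ) :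
    ContDiff ℝ n fun s => ∑' x, monomialCLM (σ x) (phaseFamily (κ x) (f x) s) := by
  have hmix := exists_mixed_moment_le (X := (Fin d → ℤ) × ι)
    (a := fun p => 1 + (latticeLen p.1 : ℝ)) (b := fun p => |κ p.1 p.2|) (c := fun p => ‖f p.1 p.2‖)
    (fun p => norm_nonneg _)
    (fun k => (h1 k).imp fun C hC p => hC p.1 p.2) (fun k => (h2 k).imp fun C hC p => hC p.1 p.2)
    (2 * d)
  choose C hC0 hC using hmix
  have hf : ∀ x, ∀ k : ℕ, ∃ C : ℝ, ∀ i, |κ x i| ^ k * ‖f x i‖ ≤ C := fun x k =>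
    (h2 k).imp fun C hC i => hC x i
  refine contDiff_tsum (N := (n : ℕ∞)) (v := fun k x => C k * ((1 + (latticeLen x : ℝ)) ^ (2 * d))⁻¹) ?_ ?_ ?_
  · intro x
    exact ((monomialCLM (σ x)).restrictScalars ℝ).contDiff.comp (contDiff_phaseFamily (hf x) n)
  · intro k _
    exact (summable_one_add_latticeLen_inv_pow d).mul_left _
  · intro k x s _
    refine (ContinuousLinearMap.norm_iteratedFDeriv_comp_left (N := (k : WithTop ℕ∞))
      ((monomialCLM (σ x)).restrictScalars ℝ)
      (contDiff_phaseFamily (hf x) k).contDiffAt le_rfl).trans ?_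
    rw [ContinuousLinearMap.norm_restrictScalars]
    refine (mul_le_of_le_one_left (norm_nonneg _) (norm_monomialCLM_le _)).trans ?_
    refine norm_iteratedFDeriv_phaseFamily_le (hf x) (mul_nonneg (hC0 k) (by positivity))
      (fun i => ?_) s
    rw [← div_eq_mul_inv, le_div_iff₀ (by positivity), mul_comm]
    exact hC k (x, i)

end PhaseSeries
end

noncomputable section

/-! ## Conjugation by weighted phases -/

section WeightedPhase

variable {d N : ℕ} {ι : Type*}

theorem BddFam.ext {ι X : Type*} [NormedAddCommGroup X] {f g : BddFam ι X} (h : ∀ i, f i = g i) :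
    f = g := Subtype.ext (funext h)

theorem BddFam.add_apply {ι X : Type*} [NormedAddCommGroup X] (f g : BddFam ι X) (i : ι) :
    (f + g) i = f i + g i := rfl

section PhaseUnit

variable {A : Type*} [CStarAlgebra A] {p : A}

/-- The unitary `e^{it} p + e^{-it} (1 - p)` of a projection `p`. -/
def phaseUnit (p : A) (t : ℝ) : A :=
  Complex.exp (t * Complex.I) • p + Complex.exp ((-t : ℝ) * Complex.I) • (1 - p)

/-- The diagonal corners acquire the difference of the two phases, the off-diagonal corners their
sum. This contrast is what lets conjugation detect off-diagonal corners. -/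
theorem phaseUnit_mul_mul (p m : A) {a b c e : ℝ} (hc : c = a - b) (he : e = a + b) :
    phaseUnit p a * m * phaseUnit p (-b)
      = Complex.exp (c * Complex.I) • (p * m * p)
        + Complex.exp (e * Complex.I) • (p * m * (1 - p))
        + Complex.exp ((-e : ℝ) * Complex.I) • ((1 - p) * m * p)
        + Complex.exp ((-c : ℝ) * Complex.I) • ((1 - p) * m * (1 - p)) := by
  have ex : ∀ a b c : ℝ, a = b + c →
      Complex.exp (a * Complex.I) = Complex.exp (b * Complex.I) * Complex.exp (c * Complex.I) := by
    rintro a b c rfl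
    rw [← Complex.exp_add]
    push_cast
    rw [add_mul]
  rw [ex c (-b) a (by rw [hc]; ring), ex e (- -b) a (by rw [he]; ring),
    ex (-e) (-b) (-a) (by rw [he]; ring), ex (-c) (- -b) (-a) (by rw [hc]; ring), phaseUnit,
    phaseUnit]
  generalize 1 - p = q
  simp only [add_mul, mul_add, smul_mul_assoc, mul_smul_comm, smul_smul, smul_add]
  abel

theorem mul_one_sub_of_mul_self (h : p * p = p) : p * (1 - p) = 0 := by
  rw [mul_sub, mul_one, h, sub_self]

theorem one_sub_mul_of_mul_self (h : p * p = p) : (1 - p) * p = 0 := by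
  rw [sub_mul, one_mul, h, sub_self]

theorem one_sub_mul_one_sub_of_mul_self (h : p * p = p) : (1 - p) * (1 - p) = 1 - p := by
  rw [mul_sub, mul_one, one_sub_mul_of_mul_self h, sub_zero]

theorem phaseUnit_mul (h : p * p = p) (s t : ℝ) :
    phaseUnit p s * phaseUnit p t = phaseUnit p (s + t) := by
  have e := phaseUnit_mul_mul p 1 (a := s) (b := -t) rfl rfl
  rw [neg_neg, mul_one, mul_one, mul_one, mul_one_sub_of_mul_self h, one_sub_mul_of_mul_self h,
    one_sub_mul_one_sub_of_mul_self h, h, smul_zero, smul_zero, add_zero, add_zero,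
    sub_neg_eq_add] at e
  exact e

theorem phaseUnit_zero : phaseUnit p 0 = 1 := by
  simp [phaseUnit]

theorem star_phaseUnit (h : star p = p) (t : ℝ) : star (phaseUnit p t) = phaseUnit p (-t) := by
  have e : ∀ t : ℝ, star (Complex.exp (t * Complex.I)) = Complex.exp ((-t : ℝ) * Complex.I) := by
    intro t
    rw [Complex.star_def, ← Complex.exp_conj, map_mul, Complex.conj_I, Complex.conj_ofReal]
    push_cast
    ring_nf
  rw [phaseUnit, star_add, star_smul, star_smul, star_sub, star_one, h, e, e, phaseUnit]

theorem norm_phaseUnit_le (h1 : ‖p‖ ≤ 1) (h2 : ‖1 - p‖ ≤ 1) (t : ℝ) : ‖phaseUnit p t‖ ≤ 2 := by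
  refine (norm_add_le _ _).trans ?_
  rw [norm_smul, norm_smul, Complex.norm_exp_ofReal_mul_I, Complex.norm_exp_ofReal_mul_I, one_mul,
    one_mul]
  linarith

theorem corner_phaseUnit (h : p * p = p) (m : A) (s t : ℝ) :
    p * (phaseUnit p s * m * phaseUnit p (-t)) * (1 - p)
      = Complex.exp ((s + t : ℝ) * Complex.I) • (p * m * (1 - p)) := by
  rw [phaseUnit_mul_mul p m rfl rfl]
  have h1 := mul_one_sub_of_mul_self h
  have h2 := one_sub_mul_one_sub_of_mul_self h
  simp only [mul_add, add_mul, mul_smul_comm, smul_mul_assoc]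
  simp only [← mul_assoc, h, h1, zero_mul, smul_zero, add_zero]
  simp only [mul_assoc, h1, h2, mul_zero, smul_zero, zero_add]

/-- Conjugation by a unitary. -/
def conjUnitary (v : unitary A) : A →⋆ₐ[ℂ] A := (Unitary.conjStarAlgAut ℂ A v : A ≃⋆ₐ[ℂ] A)

theorem conjUnitary_apply (v : unitary A) (x : A) : conjUnitary v x = v * x * star (v : A) := rfl

end PhaseUnit

/-! ### Weight unitaries on ℓ² and their conjugation orbits. -/

theorem norm_phaseUnit_diagProj_le (t : ℝ) : ‖phaseUnit (diagProj N) t‖ ≤ 2 :=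
  norm_phaseUnit_le norm_diagProj_le norm_compl_diagProj_le t

/-- The diagonal unitary with entries `phaseUnit (s w_i)`. -/
def weightOp (N : ℕ) (w : ι → ℝ) (s : ℝ) :
    SqSum ι (DoubleSpace N) →L[ℂ] SqSum ι (DoubleSpace N) :=
  monomialOp (Equiv.refl ι) (bddFamily fun i => phaseUnit (diagProj N) (s * w i))

theorem weightOp_mul (w : ι → ℝ) (s t : ℝ) :
    weightOp N w s * weightOp N w t = weightOp N w (s + t) := by
  refine monomialOp_mul fun i => ?_
  rw [bddFamily_apply (fun i => norm_phaseUnit_diagProj_le _), bddFamily_apply (fun i => norm_phaseUnit_diagProj_le _),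
    bddFamily_apply (fun i => norm_phaseUnit_diagProj_le _), phaseUnit_mul diagProj_mul_self, add_mul]
  rfl

theorem weightOp_zero (w : ι → ℝ) : weightOp N w 0 = 1 := by
  refine monomialOp_one fun i => ?_
  rw [bddFamily_apply (fun i => norm_phaseUnit_diagProj_le _), zero_mul, phaseUnit_zero]

theorem star_weightOp (w : ι → ℝ) (s : ℝ) : star (weightOp N w s) = weightOp N w (-s) := by
  refine star_monomialOp fun i => ?_
  rw [bddFamily_apply (fun i => norm_phaseUnit_diagProj_le _), bddFamily_apply (fun i => norm_phaseUnit_diagProj_le _),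
    star_phaseUnit star_diagProj, neg_mul]
  rfl

/-- `weightOp` as a unitary. -/
def weightUnitary (N : ℕ) (w : ι → ℝ) (s : ℝ) :
    unitary (SqSum ι (DoubleSpace N) →L[ℂ] SqSum ι (DoubleSpace N)) :=
  ⟨weightOp N w s, by
    constructor
    · rw [star_weightOp, weightOp_mul, neg_add_cancel, weightOp_zero]
    · rw [star_weightOp, weightOp_mul, add_neg_cancel, weightOp_zero]⟩

/-- Conjugation by `weightOp`. -/
def weightConj (N : ℕ) (w : ι → ℝ) (s : ℝ) :
    (SqSum ι (DoubleSpace N) →L[ℂ] SqSum ι (DoubleSpace N)) →⋆ₐ[ℂ]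
      (SqSum ι (DoubleSpace N) →L[ℂ] SqSum ι (DoubleSpace N)) :=
  conjUnitary (weightUnitary N w s)

theorem weightConj_apply (w : ι → ℝ) (s : ℝ)
    (T : SqSum ι (DoubleSpace N) →L[ℂ] SqSum ι (DoubleSpace N)) :
    weightConj N w s T = weightOp N w s * T * weightOp N w (-s) := by
  rw [← star_weightOp, weightConj, conjUnitary_apply]; rfl

theorem weightConj_weightConj (w : ι → ℝ) (s t : ℝ)
    (T : SqSum ι (DoubleSpace N) →L[ℂ] SqSum ι (DoubleSpace N)) :
    weightConj N w s (weightConj N w t T) = weightConj N w (s + t) T := by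
  rw [weightConj_apply, weightConj_apply, weightConj_apply, ← weightOp_mul, neg_add_rev,
    ← weightOp_mul]
  simp only [mul_assoc]

/-- In every entry each of the four corners moves by a pure phase. The frequencies ±(w_i - w_{σi})
will be bounded by the displacement, while ±(w_i + w_{σi}) are at least w_i in modulus for
nonnegative weights. -/
theorem weightConj_monomialOp (w : ι → ℝ) (σ : Equiv.Perm ι) {m : ι → DoubleSpace N →L[ℂ] DoubleSpace N}
    {C : ℝ} (hm : ∀ i, ‖m i‖ ≤ C) (s : ℝ) :
    weightConj N w s (monomialOp σ (bddFamily m))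
      = monomialCLM σ (phaseFamily (fun i => w i - w (σ i))
            (fun i => diagProj N * m i * diagProj N) s)
        + monomialCLM σ (phaseFamily (fun i => w i + w (σ i))
            (fun i => diagProj N * m i * (1 - diagProj N)) s)
        + monomialCLM σ (phaseFamily (fun i => -(w i + w (σ i)))
            (fun i => (1 - diagProj N) * m i * diagProj N) s)
        + monomialCLM σ (phaseFamily (fun i => -(w i - w (σ i)))
            (fun i => (1 - diagProj N) * m i * (1 - diagProj N)) s) := by
  have hP := norm_diagProj_le (N := N)
  have hQ := norm_compl_diagProj_le (N := N)
  set P := diagProj N with hPdef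
  set g := phaseFamily (fun i => w i - w (σ i)) (fun i => P * m i * P) s
    + phaseFamily (fun i => w i + w (σ i)) (fun i => P * m i * (1 - P)) s
    + phaseFamily (fun i => -(w i + w (σ i))) (fun i => (1 - P) * m i * P) s
    + phaseFamily (fun i => -(w i - w (σ i))) (fun i => (1 - P) * m i * (1 - P)) s with hg
  have hgi : ∀ i, g i = phaseUnit (diagProj N) (s * w i) * m i * phaseUnit (diagProj N) (-s * w (σ i)) := by
    intro i
    have e : ∀ (κ : ι → ℝ) {p q : DoubleSpace N →L[ℂ] DoubleSpace N}, ‖p‖ ≤ 1 → ‖q‖ ≤ 1 →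
        phaseFamily κ (fun i => p * m i * q) s i
          = Complex.exp ((s * κ i : ℝ) * Complex.I) • (p * m i * q) := by
      intro κ p q hp hq
      exact bddFamily_apply (C := C)
        (fun i => by rw [norm_phase_smul]; exact (norm_mul_mul_le_of_norm_le_one hp hq).trans (hm i)) i
    rw [hg, BddFam.add_apply, BddFam.add_apply, BddFam.add_apply, e _ hP hP, e _ hP hQ, e _ hQ hP,
      e _ hQ hQ, neg_mul, hPdef, mul_neg, mul_neg]
    exact (phaseUnit_mul_mul _ _ (mul_sub _ _ _) (mul_add _ _ _)).symm
  have hk : ∀ i, ‖phaseUnit (diagProj N) (s * w i) * m i‖ ≤ 2 * C := fun i =>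
    (norm_mul_le _ _).trans (mul_le_mul (norm_phaseUnit_diagProj_le _) (hm i) (norm_nonneg _) zero_le_two)
  rw [weightConj_apply, ← map_add, ← map_add, ← map_add, ← hg, monomialCLM_apply, weightOp, weightOp,
    monomialOp_mul (k := bddFamily fun i => phaseUnit (diagProj N) (s * w i) * m i), monomialOp_mul (k := g)]
  · rfl
  · intro i
    rw [hgi, bddFamily_apply hk, bddFamily_apply (fun i => norm_phaseUnit_diagProj_le _)]
    rfl
  · intro i
    rw [bddFamily_apply hk, bddFamily_apply (fun i => norm_phaseUnit_diagProj_le _), bddFamily_apply hm]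
    rfl

/-- The conjugation orbit of a series of monomial operators is smooth when the coefficients and
their weighted corners decay. -/
theorem contDiff_weightConj {w : ι → ℝ} (hw : ∀ i, 0 ≤ w i) {σ : (Fin d → ℤ) → Equiv.Perm ι}
    {m : (Fin d → ℤ) → ι → DoubleSpace N →L[ℂ] DoubleSpace N}
    (hσ : ∀ x i, |w i - w (σ x i)| ≤ latticeLen x)
    (hm : ∀ k : ℕ, ∃ C : ℝ, ∀ x i, (1 + (latticeLen x : ℝ)) ^ k * ‖m x i‖ ≤ C)
    (hc : ∀ k : ℕ, ∃ C : ℝ, ∀ x i, w i ^ k * ‖diagProj N * m x i * (1 - diagProj N)‖ ≤ C)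
    (hc' : ∀ k : ℕ, ∃ C : ℝ, ∀ x i, w i ^ k * ‖(1 - diagProj N) * m x i * diagProj N‖ ≤ C)
    {T : SqSum ι (DoubleSpace N) →L[ℂ] SqSum ι (DoubleSpace N)}
    (hT : HasSum (fun x => monomialOp (σ x) (bddFamily (m x))) T) (n : ℕ) :
    ContDiff ℝ n fun s => weightConj N w s T := by
  have hP := norm_diagProj_le (N := N)
  have hQ := norm_compl_diagProj_le (N := N)
  have hpq : ∀ {p q : DoubleSpace N →L[ℂ] DoubleSpace N}, ‖p‖ ≤ 1 → ‖q‖ ≤ 1 →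
      ∀ k : ℕ, ∃ C : ℝ, ∀ x i, (1 + (latticeLen x : ℝ)) ^ k * ‖p * m x i * q‖ ≤ C := by
    intro p q hp hq k
    obtain ⟨C, hC⟩ := hm k
    refine ⟨C, fun x i => le_trans ?_ (hC x i)⟩
    gcongr
    exact norm_mul_mul_le_of_norm_le_one hp hq
  have hdiag : ∀ {p q : DoubleSpace N →L[ℂ] DoubleSpace N}, ‖p‖ ≤ 1 → ‖q‖ ≤ 1 →
      ∀ k : ℕ, ∃ C : ℝ, ∀ x i, |w i - w (σ x i)| ^ k * ‖p * m x i * q‖ ≤ C := by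
    intro p q hp hq k
    obtain ⟨C, hC⟩ := hpq hp hq k
    refine ⟨C, fun x i => le_trans ?_ (hC x i)⟩
    gcongr
    linarith [hσ x i]
  have hoff : ∀ {p q : DoubleSpace N →L[ℂ] DoubleSpace N}, ‖p‖ ≤ 1 → ‖q‖ ≤ 1 →
      (∀ k : ℕ, ∃ C : ℝ, ∀ x i, w i ^ k * ‖p * m x i * q‖ ≤ C) →
      ∀ k : ℕ, ∃ C : ℝ, ∀ x i, |w i + w (σ x i)| ^ k * ‖p * m x i * q‖ ≤ C := by
    intro p q hp hq h k
    obtain ⟨C1, hC1⟩ := hpq hp hq k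
    obtain ⟨C2, hC2⟩ := h k
    refine ⟨4 ^ k * (C2 + C1), fun x i => ?_⟩
    -- The weights differ by at most |x|, so the sum is at most 2 w_i + |x|. Its moments thus reduce
    -- to those of w_i and of 1 + |x|.
    have h0 : |w i + w (σ x i)| ≤ 4 * max (w i) (1 + latticeLen x) := by
      rw [abs_of_nonneg (add_nonneg (hw _) (hw _))]
      have h1 := (abs_le.1 (hσ x i)).1
      have h2 := le_max_left (w i) (1 + (latticeLen x : ℝ))
      have h3 := le_max_right (w i) (1 + (latticeLen x : ℝ))
      linarith
    have h1 : (max (w i) (1 + (latticeLen x : ℝ))) ^ k ≤ w i ^ k + (1 + (latticeLen x : ℝ)) ^ k := by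
      have := pow_nonneg (hw i) k
      have : (0 : ℝ) ≤ (1 + (latticeLen x : ℝ)) ^ k := by positivity
      rcases max_choice (w i) (1 + (latticeLen x : ℝ)) with h | h <;> rw [h] <;> linarith
    calc _ ≤ (4 * max (w i) (1 + latticeLen x)) ^ k * ‖p * m x i * q‖ := by gcongr
      _ = 4 ^ k * ((max (w i) (1 + latticeLen x)) ^ k * ‖p * m x i * q‖) := by ring
      _ ≤ 4 ^ k * ((w i ^ k + (1 + latticeLen x) ^ k) * ‖p * m x i * q‖) := by gcongr
      _ ≤ _ := by
        rw [add_mul]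
        gcongr
        exacts [hC2 x i, hC1 x i]
  have hneg : ∀ {κ g : (Fin d → ℤ) → ι → ℝ},
      (∀ k : ℕ, ∃ C : ℝ, ∀ x i, |κ x i| ^ k * g x i ≤ C) →
      ∀ k : ℕ, ∃ C : ℝ, ∀ x i, |-κ x i| ^ k * g x i ≤ C := by
    intro κ g h k
    simpa only [abs_neg] using h k
  have key : (fun s => weightConj N w s T) = fun s =>
      ((∑' x, monomialCLM (σ x) (phaseFamily (fun i => w i - w (σ x i))
            (fun i => diagProj N * m x i * diagProj N) s)
        + ∑' x, monomialCLM (σ x) (phaseFamily (fun i => w i + w (σ x i))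
            (fun i => diagProj N * m x i * (1 - diagProj N)) s))
        + ∑' x, monomialCLM (σ x) (phaseFamily (fun i => -(w i + w (σ x i)))
            (fun i => (1 - diagProj N) * m x i * diagProj N) s))
        + ∑' x, monomialCLM (σ x) (phaseFamily (fun i => -(w i - w (σ x i)))
            (fun i => (1 - diagProj N) * m x i * (1 - diagProj N)) s) := by
    funext s
    obtain ⟨C, hC⟩ := hm 0
    have h1 := hT.map (weightConj N w s) (weightConj N w s).continuous_of_cstar
    have h2 : (weightConj N w s ∘ fun x => monomialOp (σ x) (bddFamily (m x))) = _ :=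
      funext fun x => weightConj_monomialOp w (σ x) (fun i => by simpa using hC x i) s
    rw [h2] at h1
    exact h1.unique ((((summable_monomialCLM (hpq hP hP) s).hasSum.add
      (summable_monomialCLM (hpq hP hQ) s).hasSum).add
      (summable_monomialCLM (hpq hQ hP) s).hasSum).add
      (summable_monomialCLM (hpq hQ hQ) s).hasSum)
  rw [key]
  exact (((contDiff_tsum_monomialCLM (hpq hP hP) (hdiag hP hP) n).add
    (contDiff_tsum_monomialCLM (hpq hP hQ) (hoff hP hQ hc) n)).add
    (contDiff_tsum_monomialCLM (hpq hQ hP) (hneg (hoff hQ hP hc')) n)).add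
    (contDiff_tsum_monomialCLM (hpq hQ hQ) (hneg (hdiag hQ hQ)) n)

/-- The off-diagonal corners of the matrix entries oscillate under conjugation. -/
theorem corner_entryCLM_weightConj (w : ι → ℝ) (s : ℝ) (i j : ι)
    (T : SqSum ι (DoubleSpace N) →L[ℂ] SqSum ι (DoubleSpace N)) :
    diagProj N * entryCLM i j (weightConj N w s T) * (1 - diagProj N)
      = Complex.exp ((w i + w j : ℝ) * Complex.I * s) •
        (diagProj N * entryCLM i j T * (1 - diagProj N)) := by
  rw [weightConj_apply, weightOp, weightOp, entryCLM_mul_diag, entryCLM_diag_mul,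
    bddFamily_apply (fun i => norm_phaseUnit_diagProj_le _), bddFamily_apply (fun i => norm_phaseUnit_diagProj_le _)]
  rw [neg_mul, corner_phaseUnit diagProj_mul_self]
  congr 2
  push_cast
  ring

end WeightedPhase
end

noncomputable section

/-! ## The representation on pairs of configurations -/

section PairRepresentation

variable {d N : ℕ} {Ω₀ : Type u}

/-- Pairs of configurations that agree on the cube `V_M`. -/
def AgreeingPair (d : ℕ) (Ω₀ : Type u) : Type u :=
  {p : ℕ × Config d Ω₀ × Config d Ω₀ // ∀ y ∈ cube d p.1, p.2.1 y = p.2.2 y}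

/-- Agreeing pairs with a marked lattice point. -/
abbrev PairSite (d : ℕ) (Ω₀ : Type u) : Type u := AgreeingPair d Ω₀ × (Fin d → ℤ)

/-- The operators of the pair representation. -/
abbrev PairOp (d N : ℕ) (Ω₀ : Type u) : Type u :=
  SqSum (PairSite d Ω₀) (DoubleSpace N) →L[ℂ] SqSum (PairSite d Ω₀) (DoubleSpace N)

/-- Translation of the marked point. -/
def siteShift (Ω₀ : Type u) (x : Fin d → ℤ) : Equiv.Perm (PairSite d Ω₀) :=
  (Equiv.refl _).prodCongr (Equiv.subRight x)

theorem siteShift_apply (x : Fin d → ℤ) (i : PairSite d Ω₀) :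
    siteShift Ω₀ x i = (i.1, i.2 - x) := rfl

theorem siteShift_trans (x y : Fin d → ℤ) :
    (siteShift Ω₀ x).trans (siteShift Ω₀ y) = siteShift Ω₀ (x + y) := by
  ext i : 1
  rw [Equiv.trans_apply, siteShift_apply, siteShift_apply, siteShift_apply, sub_sub]

theorem siteShift_zero : siteShift Ω₀ (0 : Fin d → ℤ) = Equiv.refl _ := by
  ext i : 1
  rw [siteShift_apply, sub_zero]; rfl

theorem siteShift_symm (x : Fin d → ℤ) : (siteShift Ω₀ x).symm = siteShift Ω₀ (-x) := by
  ext i : 1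
  rw [Equiv.symm_apply_eq, siteShift_apply, siteShift_apply, sub_neg_eq_add, add_sub_cancel_right]

theorem latticeLen_neg (x : Fin d → ℤ) : latticeLen (-x) = latticeLen x := by
  simp [latticeLen]

/-- The distance from the marked point to the complement of the cube of agreement. -/
def pairWeight (i : PairSite d Ω₀) : ℝ := (i.1.1.1 - latticeLen i.2 : ℕ)

theorem pairWeight_nonneg (i : PairSite d Ω₀) : 0 ≤ pairWeight i := Nat.cast_nonneg _

/-- The truncated distance max(M - |y|, 0) is 1-Lipschitz in y. -/
theorem abs_pairWeight_sub_le (x : Fin d → ℤ) (i : PairSite d Ω₀) :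
    |pairWeight i - pairWeight (siteShift Ω₀ x i)| ≤ latticeLen x := by
  have h1 := latticeLen_sub_le i.2 x
  have h2 := latticeLen_sub_le (i.2 - x) (-x)
  rw [sub_neg_eq_add, sub_add_cancel, latticeLen_neg] at h2
  have h3 : i.1.1.1 - latticeLen i.2 ≤ i.1.1.1 - latticeLen (i.2 - x) + latticeLen x := by omega
  have h4 : i.1.1.1 - latticeLen (i.2 - x) ≤ i.1.1.1 - latticeLen i.2 + latticeLen x := by omega
  rw [pairWeight, pairWeight, siteShift_apply, abs_le]
  constructor
  · have : ((i.1.1.1 - latticeLen (i.2 - x) : ℕ) : ℝ)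
      ≤ ((i.1.1.1 - latticeLen i.2 : ℕ) : ℝ) + latticeLen x := by exact_mod_cast h4
    linarith
  · have : ((i.1.1.1 - latticeLen i.2 : ℕ) : ℝ)
      ≤ ((i.1.1.1 - latticeLen (i.2 - x) : ℕ) : ℝ) + latticeLen x := by exact_mod_cast h3
    linarith

/-! ### Shift operators -/

theorem norm_circle_smul {E : Type*} [NormedAddCommGroup E] [NormedSpace ℂ E] (c : Circle) (v : E) :
    ‖(c : ℂ) • v‖ = ‖v‖ := by
  rw [norm_smul, Circle.norm_coe, one_mul]

/-- Translation by `x`, twisted by the phases `c`. -/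
def shiftOp (N : ℕ) (x : Fin d → ℤ) (c : PairSite d Ω₀ → Circle) : PairOp d N Ω₀ :=
  monomialOp (siteShift Ω₀ x) (bddFamily fun i => (c i : ℂ) • 1)

theorem shift_coeff_le (c : PairSite d Ω₀ → Circle) (i : PairSite d Ω₀) :
    ‖(c i : ℂ) • (1 : DoubleSpace N →L[ℂ] DoubleSpace N)‖ ≤ 1 :=
  (norm_circle_smul (c i) (1 : DoubleSpace N →L[ℂ] DoubleSpace N)).trans_le (CStarAlgebra.norm_one_le _)

theorem shiftOp_mul (x y : Fin d → ℤ) (c e : PairSite d Ω₀ → Circle) :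
    shiftOp N x c * shiftOp N y e = shiftOp N (x + y) fun i => c i * e (siteShift Ω₀ x i) := by
  rw [shiftOp, shiftOp, shiftOp, ← siteShift_trans]
  refine monomialOp_mul fun i => ?_
  rw [bddFamily_apply (shift_coeff_le c), bddFamily_apply (shift_coeff_le e),
    bddFamily_apply (shift_coeff_le fun i => c i * e (siteShift Ω₀ x i)), Circle.coe_mul,
    smul_mul_smul_comm, one_mul]

theorem shiftOp_zero : shiftOp N 0 (fun _ : PairSite d Ω₀ => 1) = 1 := by
  rw [shiftOp, siteShift_zero]
  refine monomialOp_one fun i => ?_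
  rw [bddFamily_apply (shift_coeff_le fun _ => 1), Circle.coe_one, one_smul]

theorem star_shiftOp (x : Fin d → ℤ) (c : PairSite d Ω₀ → Circle) :
    star (shiftOp N x c) = shiftOp N (-x) fun i => (c (siteShift Ω₀ (-x) i))⁻¹ := by
  rw [shiftOp, shiftOp, ← siteShift_symm]
  refine star_monomialOp fun i => ?_
  rw [bddFamily_apply (shift_coeff_le c),
    bddFamily_apply (shift_coeff_le fun i => (c ((siteShift Ω₀ x).symm i))⁻¹),
    Equiv.symm_apply_apply, star_smul, star_one, Circle.coe_inv_eq_conj]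
  rfl

/-- The magnetic phase of the translation by `e_j`. -/
def magneticPhase (φ : Matrix (Fin d) (Fin d) ℝ) (j : Fin d) (i : PairSite d Ω₀) : Circle :=
  Circle.exp (∑ k, φ j k / 2 * i.2 k)

/-- Each order of two translations contributes half of the commutation phase. Antisymmetry of φ
makes the two halves add up in `pairRep`. -/
theorem magneticPhase_siteShift (φ : Matrix (Fin d) (Fin d) ℝ) (j l : Fin d) (i : PairSite d Ω₀) :
    magneticPhase φ j (siteShift Ω₀ (Pi.single l 1) i)
      = magneticPhase φ j i * Circle.exp (-(φ j l / 2)) := by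
  rw [magneticPhase, magneticPhase, ← Circle.exp_add, siteShift_apply]
  congr 1
  have h : ∑ k, φ j k / 2 * (((Pi.single l 1 : Fin d → ℤ) k : ℤ) : ℝ) = φ j l / 2 := by
    simp [Pi.single_apply]
  rw [← sub_eq_add_neg, ← h, ← Finset.sum_sub_distrib]
  refine Finset.sum_congr rfl fun k _ => ?_
  change _ * (((i.2 k - (Pi.single l 1 : Fin d → ℤ) k : ℤ)) : ℝ) = _
  rw [Int.cast_sub, mul_sub]

/-! ### Multiplication operators -/

variable [TopologicalSpace Ω₀]

/-- The two values of `f` at a marked pair. -/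
def siteHom (N : ℕ) (i : PairSite d Ω₀) :
    CN d N Ω₀ →⋆ₐ[ℂ] (DoubleSpace N →L[ℂ] DoubleSpace N) where
  toFun f := blockDiagHom N (f (shift i.2 i.1.1.2.1), f (shift i.2 i.1.1.2.2))
  map_one' := map_one (blockDiagHom N)
  map_mul' _ _ := map_mul (blockDiagHom N) (_, _) (_, _)
  map_zero' := map_zero (blockDiagHom N)
  map_add' _ _ := map_add (blockDiagHom N) (_, _) (_, _)
  commutes' c := AlgHomClass.commutes (blockDiagHom N) c
  map_star' _ := map_star (blockDiagHom N) (_, _)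

theorem siteHom_apply (i : PairSite d Ω₀) (f : CN d N Ω₀) :
    siteHom N i f = blockDiagHom N (f (shift i.2 i.1.1.2.1), f (shift i.2 i.1.1.2.2)) := rfl

/-- The covariance relation at a single site: τ_x τ_{y-x} = τ_y. -/
theorem siteHom_comp_shift (x : Fin d → ℤ) (i : PairSite d Ω₀) (f : CN d N Ω₀) :
    siteHom N (siteShift Ω₀ x i) (f.comp (shift x)) = siteHom N i f := by
  have h : ∀ ω : Config d Ω₀, shift x (shift (i.2 - x) ω) = shift i.2 ω := by
    intro ω
    have := DFunLike.congr_fun (shift_comp_shift (Ω₀ := Ω₀) x (i.2 - x)) ω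
    rwa [add_sub_cancel] at this
  rw [siteHom_apply, siteHom_apply, siteShift_apply, ContinuousMap.comp_apply,
    ContinuousMap.comp_apply, h, h]

variable [CompactSpace Ω₀]

theorem norm_siteHom_le (f : CN d N Ω₀) (i : PairSite d Ω₀) : ‖siteHom N i f‖ ≤ ‖f‖ :=
  (norm_blockDiagHom_le _ _).trans (max_le (f.norm_coe_le_norm _) (f.norm_coe_le_norm _))

/-- Functions as multiplication operators. -/
def pairFun (d N : ℕ) (Ω₀ : Type u) [TopologicalSpace Ω₀] [CompactSpace Ω₀] :
    CN d N Ω₀ →⋆ₐ[ℂ] PairOp d N Ω₀ where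
  toFun f := monomialCLM (Equiv.refl _) (bddFamily fun i => siteHom N i f)
  map_one' := monomialOp_one fun i => by
    rw [bddFamily_apply (norm_siteHom_le 1), map_one]
  map_mul' f g := (monomialOp_mul (σ := Equiv.refl _) (τ := Equiv.refl _) fun i => by
    rw [bddFamily_apply (norm_siteHom_le (f * g)), bddFamily_apply (norm_siteHom_le f),
      bddFamily_apply (norm_siteHom_le g), map_mul]; rfl).symm
  map_zero' := by
    rw [show bddFamily (fun i => siteHom N i (0 : CN d N Ω₀)) = 0 from
      BddFam.ext fun i => by rw [bddFamily_apply (norm_siteHom_le 0), map_zero]; rfl, map_zero]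
  map_add' f g := by
    rw [← map_add]
    congr 1
    refine BddFam.ext fun i => ?_
    rw [BddFam.add_apply, bddFamily_apply (norm_siteHom_le (f + g)),
      bddFamily_apply (norm_siteHom_le f), bddFamily_apply (norm_siteHom_le g), map_add]
  commutes' c := by
    rw [Algebra.algebraMap_eq_smul_one, Algebra.algebraMap_eq_smul_one,
      ← monomialOp_one (m := bddFamily fun i => siteHom N i (1 : CN d N Ω₀)) fun i => by
        rw [bddFamily_apply (norm_siteHom_le 1), map_one], ← monomialCLM_apply, ← map_smul]
    congr 1
    refine BddFam.ext fun i => ?_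
    rw [bddFamily_apply (norm_siteHom_le (c • 1)), map_smul]
    change _ = c • bddFamily (fun i => siteHom N i (1 : CN d N Ω₀)) i
    rw [bddFamily_apply (norm_siteHom_le 1)]
  map_star' f := (star_monomialOp (σ := Equiv.refl _) fun i => by
    rw [bddFamily_apply (norm_siteHom_le f), bddFamily_apply (norm_siteHom_le (star f)),
      map_star]; rfl).symm

theorem pairFun_apply (f : CN d N Ω₀) :
    pairFun d N Ω₀ f = monomialOp (Equiv.refl _) (bddFamily fun i => siteHom N i f) := rfl

theorem norm_smul_siteHom_le (f : CN d N Ω₀) (c : PairSite d Ω₀ → Circle) (i : PairSite d Ω₀) :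
    ‖(c i : ℂ) • siteHom N i f‖ ≤ ‖f‖ :=
  (norm_circle_smul (c i) _).trans_le (norm_siteHom_le f i)

theorem pairFun_mul_shiftOp (f : CN d N Ω₀) (x : Fin d → ℤ) (c : PairSite d Ω₀ → Circle) :
    pairFun d N Ω₀ f * shiftOp N x c
      = monomialOp (siteShift Ω₀ x) (bddFamily fun i => (c i : ℂ) • siteHom N i f) := by
  rw [pairFun_apply, shiftOp]
  refine monomialOp_mul (σ := Equiv.refl _) fun i => ?_
  rw [bddFamily_apply (norm_smul_siteHom_le f c), bddFamily_apply (norm_siteHom_le f),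
    bddFamily_apply (shift_coeff_le c), mul_smul_comm, mul_one]
  rfl

theorem shiftOp_mul_pairFun (f : CN d N Ω₀) (x : Fin d → ℤ) (c : PairSite d Ω₀ → Circle) :
    shiftOp N x c * pairFun d N Ω₀ (f.comp (shift x))
      = monomialOp (siteShift Ω₀ x) (bddFamily fun i => (c i : ℂ) • siteHom N i f) := by
  rw [pairFun_apply, shiftOp]
  refine monomialOp_mul (τ := Equiv.refl _) fun i => ?_
  rw [bddFamily_apply (norm_smul_siteHom_le f c), bddFamily_apply (norm_siteHom_le (f.comp (shift x))),
    bddFamily_apply (shift_coeff_le c), siteHom_comp_shift, smul_mul_assoc, one_mul]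

/-- The site `((0, ω, ω), 0)`. -/
def diagSite (ω : Config d Ω₀) : PairSite d Ω₀ := (⟨(0, ω, ω), fun _ _ => rfl⟩, 0)

/-- Every configuration, paired with itself and marked at the origin, is a site, so all values of a
function appear as entries. -/
theorem pairFun_injective : Function.Injective (pairFun d N Ω₀) := by
  intro f g h
  ext1 ω
  have h1 : siteHom N (diagSite ω) f = siteHom N (diagSite ω) g := by
    rw [← bddFamily_apply (norm_siteHom_le f), ← bddFamily_apply (norm_siteHom_le g),
      ← entryCLM_monomialOp (Equiv.refl _), ← entryCLM_monomialOp (Equiv.refl _), ← pairFun_apply,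
      ← pairFun_apply, h]
  have h2 := congrArg Prod.fst (blockDiagHom_injective h1)
  change f (shift 0 ω) = g (shift 0 ω) at h2
  rwa [shift_zero] at h2

/-! ### The covariant representation -/

/-- The representation of the bulk algebra on pairs of configurations. -/
def pairRep (φ : Matrix (Fin d) (Fin d) ℝ) (hφ : φ.transpose = -φ) [Nontrivial (CN d N Ω₀)] :
    CovRep d N Ω₀ φ where
  carrier := PairOp d N Ω₀
  nontriv := (pairFun_injective (d := d) (N := N) (Ω₀ := Ω₀)).nontrivial
  ofFun := pairFun d N Ω₀
  gen j := shiftOp N (Pi.single j 1) (magneticPhase φ j)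
  gen_star_mul j := by
    rw [star_shiftOp, shiftOp_mul, neg_add_cancel, ← shiftOp_zero]
    congr 1
    funext i
    rw [inv_mul_cancel]
  gen_mul_star j := by
    rw [star_shiftOp, shiftOp_mul, add_neg_cancel, ← shiftOp_zero]
    congr 1
    funext i
    rw [← siteShift_symm, Equiv.symm_apply_apply, mul_inv_cancel]
  gen_comm j l := by
    have h1 : φ l j = -φ j l := congrFun (congrFun hφ j) l
    have h2 : Complex.exp (Complex.I * φ j l) = (Circle.exp (φ j l) : ℂ) := by
      rw [Circle.coe_exp, mul_comm]
    rw [shiftOp_mul, shiftOp_mul, h2, add_comm (Pi.single l 1), shiftOp, shiftOp,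
      ← monomialCLM_apply, ← monomialCLM_apply, ← map_smul]
    congr 1
    refine BddFam.ext fun i => ?_
    change _ = (Circle.exp (φ j l) : ℂ) • bddFamily (fun i =>
      ((magneticPhase φ l i * magneticPhase φ j (siteShift Ω₀ (Pi.single l 1) i) : Circle) : ℂ) •
        (1 : DoubleSpace N →L[ℂ] DoubleSpace N)) i
    rw [bddFamily_apply (shift_coeff_le fun i =>
        magneticPhase φ j i * magneticPhase φ l (siteShift Ω₀ (Pi.single j 1) i)),
      bddFamily_apply (shift_coeff_le fun i =>
        magneticPhase φ l i * magneticPhase φ j (siteShift Ω₀ (Pi.single l 1) i)),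
      smul_smul, ← Circle.coe_mul, magneticPhase_siteShift, magneticPhase_siteShift, h1]
    congr 2
    rw [mul_left_comm (Circle.exp (φ j l)), mul_left_comm (Circle.exp (φ j l)), ← Circle.exp_add,
      mul_left_comm (magneticPhase φ j i)]
    congr 4
    ring
  ofFun_gen f j := by
    rw [pairFun_mul_shiftOp, shiftOp_mul_pairFun]

variable [Nontrivial (CN d N Ω₀)] {φ : Matrix (Fin d) (Fin d) ℝ}

/-- The pair representation as a homomorphism. -/
def pairHom (N : ℕ) (Ω₀ : Type u) [TopologicalSpace Ω₀] [CompactSpace Ω₀] [Nontrivial (CN d N Ω₀)]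
    (hφ : φ.transpose = -φ) : Bulk d N Ω₀ φ →⋆ₐ[ℂ] PairOp d N Ω₀ :=
  (evalRep (pairRep φ hφ)).comp (bulkSub d N Ω₀ φ).subtype

theorem pairHom_bulkFun (hφ : φ.transpose = -φ) (f : CN d N Ω₀) :
    pairHom N Ω₀ hφ (bulkFun φ f) = pairFun d N Ω₀ f := rfl

theorem pairHom_bulkGen (hφ : φ.transpose = -φ) (j : Fin d) :
    pairHom N Ω₀ hφ (bulkGen N Ω₀ φ j : Bulk d N Ω₀ φ)
      = shiftOp N (Pi.single j 1) (magneticPhase φ j) := rfl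

/-- The pair representation is a covariant representation that is already faithful on functions. -/
theorem bulkFun_injective (hφ : φ.transpose = -φ) :
    Function.Injective (bulkFun (N := N) (Ω₀ := Ω₀) φ) := by
  intro f g h
  have h1 := congrArg (pairHom N Ω₀ hφ) h
  exact pairFun_injective h1

/-- The phases are left unspecified because all later estimates concern norms of individual entries
and corners, which do not see them. -/
theorem exists_pairHom_bulkWord (hφ : φ.transpose = -φ) (x : Fin d → ℤ) :
    ∃ c : PairSite d Ω₀ → Circle,
      pairHom N Ω₀ hφ (bulkWord N Ω₀ φ x : Bulk d N Ω₀ φ) = shiftOp N x c := by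
  let H : Subgroup (Multiplicative (Fin d → ℤ) × unitary (Bulk d N Ω₀ φ)) :=
    { carrier := {p | ∃ c : PairSite d Ω₀ → Circle,
        pairHom N Ω₀ hφ (p.2 : Bulk d N Ω₀ φ) = shiftOp N p.1.toAdd c}
      one_mem' := ⟨fun _ => 1, by
        rw [Prod.fst_one, Prod.snd_one, toAdd_one, shiftOp_zero, Submonoid.coe_one, map_one]⟩
      mul_mem' := by
        rintro p q ⟨c, hc⟩ ⟨e, he⟩
        exact ⟨_, by
          rw [Prod.fst_mul, Prod.snd_mul, toAdd_mul, Submonoid.coe_mul, map_mul, hc, he,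
            shiftOp_mul]⟩
      inv_mem' := by
        rintro p ⟨c, hc⟩
        exact ⟨_, by
          rw [Prod.fst_inv, Prod.snd_inv, toAdd_inv, ← Unitary.star_eq_inv, Unitary.coe_star,
            map_star, hc, star_shiftOp]⟩ }
  exact list_ofFn_zpow_prod_mem H (fun j => ⟨_, pairHom_bulkGen hφ j⟩) x

theorem exists_pairHom_bulkMonomial (hφ : φ.transpose = -φ) (x : Fin d → ℤ) :
    ∃ c : PairSite d Ω₀ → Circle, pairHom N Ω₀ hφ (bulkMonomial N Ω₀ φ x) = shiftOp N x c := by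
  obtain ⟨c, hc⟩ := exists_bulkMonomial_eq (N := N) (Ω₀ := Ω₀) (φ := φ) x
  obtain ⟨e, he⟩ := exists_pairHom_bulkWord (N := N) (Ω₀ := Ω₀) hφ x
  refine ⟨fun i => c * e i, ?_⟩
  rw [hc, map_smul, he, shiftOp, shiftOp, ← monomialCLM_apply, ← monomialCLM_apply, ← map_smul]
  congr 1
  refine BddFam.ext fun i => ?_
  change (c : ℂ) • bddFamily (fun i => (e i : ℂ) • (1 : DoubleSpace N →L[ℂ] DoubleSpace N)) i = _
  rw [bddFamily_apply (shift_coeff_le e), bddFamily_apply (shift_coeff_le fun i => c * e i),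
    smul_smul, Circle.coe_mul]

/-- The image of a homogeneous component of `a`. -/
theorem exists_pairHom_bulkComponent (hφ : φ.transpose = -φ) {a : Bulk d N Ω₀ φ} {x : Fin d → ℤ}
    {h : CN d N Ω₀} (hh : bulkFun φ h = bulkFourierCoeff x a) :
    ∃ c : PairSite d Ω₀ → Circle, pairHom N Ω₀ hφ (bulkComponent x a)
      = monomialOp (siteShift Ω₀ x) (bddFamily fun i => (c i : ℂ) • siteHom N i h) := by
  obtain ⟨c, hc⟩ := exists_pairHom_bulkMonomial (N := N) (Ω₀ := Ω₀) hφ x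
  refine ⟨c, ?_⟩
  rw [bulkComponent_eq, ← hh, map_mul, hc, pairHom_bulkFun, pairFun_mul_shiftOp]

end PairRepresentation
end

noncomputable section

theorem HasSmoothOrbit.cfc_of_contDiffOn {A B E : Type*} [CStarAlgebra A] [CStarAlgebra B]
    [NormedAddCommGroup E] [NormedSpace ℝ E] {Θ : E → A →⋆ₐ[ℂ] B} {β : E → B →⋆ₐ[ℂ] B} {h : A}
    (hβ : ∀ e e' a, Θ (e + e') a = β e (Θ e' a)) (hh : HasSmoothOrbit Θ h) (sa : IsSelfAdjoint h)
    {U : Set ℝ} {G : ℝ → ℂ} (hU : IsOpen U) (hKU : spectrum ℝ h ⊆ U)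
    (hG : ∀ n : ℕ, ContDiffOn ℝ n G U) : HasSmoothOrbit Θ (cfc (fun z : ℂ => G z.re) h) := by
  obtain ⟨r, c, hc, hs⟩ := exists_fourier_expansion (spectrum.isCompact (𝕜 := ℝ) h) hU hKU hG
  exact hh.smoothCalculus hβ sa hc
    (hasSum_smul_exp_cfc sa ((hG 0).continuousOn.mono hKU) (by simpa using hc 0) hs)

/-! ## Smooth localized elements are the elements with two smooth orbits -/

section SmoothLocalized

variable {d N : ℕ} {Ω₀ : Type u} [TopologicalSpace Ω₀]

/-- Localized families are polynomially small in the weight of the marked pairs. -/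
theorem exists_pairWeight_pow_mul_le {h : (Fin d → ℤ) → CN d N Ω₀} {B : ℝ}
    (hB : ∀ x ω, ‖h x ω‖ ≤ B)
    (hA : ∀ K : ℕ, ∃ A : ℝ, 0 < A ∧ ∀ (M : ℕ) (ω ω' : Config d Ω₀),
      (∀ y ∈ cube d M, ω y = ω' y) →
        ∀ x, ‖h x ω - h x ω'‖ ≤ A / (1 + ((cube d M).card : ℝ)) ^ K) (k : ℕ) :
    ∃ C : ℝ, ∀ (x : Fin d → ℤ) (i : PairSite d Ω₀), pairWeight i ^ k *
      ‖h x (shift i.2 i.1.1.2.1) - h x (shift i.2 i.1.1.2.2)‖ ≤ C := by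
  obtain ⟨A, hA0, hA⟩ := hA k
  refine ⟨A + 2 * |B|, fun x i => ?_⟩
  obtain ⟨⟨⟨M, ω, ω'⟩, hω⟩, y⟩ := i
  change ((M - latticeLen y : ℕ) : ℝ) ^ k * ‖h x (shift y ω) - h x (shift y ω')‖ ≤ _
  set w := M - latticeLen y with hw
  -- At weight zero the agreement gives no information. The factor `0 ^ k` is still 1 for k = 0, so
  -- the uniform bound `B` is needed.
  by_cases hw0 : w = 0
  · rw [hw0, Nat.cast_zero]
    have h1 : ‖h x (shift y ω) - h x (shift y ω')‖ ≤ 2 * |B| :=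
      (norm_sub_le _ _).trans (by linarith [hB x (shift y ω), hB x (shift y ω'), le_abs_self B])
    calc (0 : ℝ) ^ k * ‖h x (shift y ω) - h x (shift y ω')‖
        ≤ 1 * ‖h x (shift y ω) - h x (shift y ω')‖ := by
          gcongr
          exact pow_le_one₀ le_rfl zero_le_one
      _ ≤ A + 2 * |B| := by linarith
  -- If |z| ≤ M - |y| then |z - y| ≤ M. Agreement on V_M thus survives the shift by y on the smaller
  -- cube V_w.
  · have hag : ∀ z ∈ cube d w, shift y ω z = shift y ω' z := by
      intro z hz
      refine hω (z - y) (mem_cube_iff.2 ((latticeLen_sub_le z y).trans ?_))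
      have := mem_cube_iff.1 hz
      change latticeLen z + latticeLen y ≤ M
      omega
    -- For d = 0 the volume of the cube is 1 and does not dominate w, but then the cube is the whole
    -- lattice and the two configurations coincide.
    rcases Nat.eq_zero_or_pos d with rfl | hd
    · have h1 : shift y ω = shift y ω' := funext fun z => hag z (mem_cube_iff.2 (by simp [latticeLen]))
      rw [h1, sub_self, norm_zero, mul_zero]
      positivity
    · have h1 : (w : ℝ) ≤ 1 + ((cube d w).card : ℝ) := by
        rw [card_cube]
        have h2 := Nat.le_self_pow hd.ne' (2 * w + 1)
        have h3 : w ≤ 1 + (2 * w + 1) ^ d := by omega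
        exact_mod_cast h3
      have h2 := hA w _ _ hag x
      rw [le_div_iff₀ (by positivity)] at h2
      calc _ ≤ (1 + ((cube d w).card : ℝ)) ^ k * ‖h x (shift y ω) - h x (shift y ω')‖ := by gcongr
        _ ≤ A := by rw [mul_comm]; exact h2
        _ ≤ _ := by linarith [abs_nonneg B]

/-- Polynomial decay in `M` gives polynomial decay in the volume of the cubes. -/
theorem exists_le_div_card_pow {X : ℕ → Type*} {r : ∀ M, X M → ℝ} (hr : ∀ M x, 0 ≤ r M x)
    (h : ∀ k : ℕ, ∃ C : ℝ, ∀ (M : ℕ) (x : X M), (M : ℝ) ^ k * r M x ≤ C) (d K : ℕ) :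
    ∃ A : ℝ, 0 < A ∧ ∀ M (x : X M), r M x ≤ A / (1 + ((cube d M).card : ℝ)) ^ K := by
  obtain ⟨C1, hC1⟩ := h (d * K)
  obtain ⟨C0, hC0⟩ := h 0
  -- The factors come from 1 + (2M+1)^d ≤ 2 (2M+1)^d and from 2M + 1 ≤ 3M for M ≥ 1; `C0` accounts
  -- for M = 0. The final 1 makes the constant positive.
  refine ⟨2 ^ K * 3 ^ (d * K) * (|C0| + |C1|) + 1, by positivity, fun M x => ?_⟩
  rw [le_div_iff₀ (by positivity), card_cube, mul_comm]
  have e0 : r M x ≤ |C0| := by simpa using (hC0 M x).trans (le_abs_self _)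
  have e1 := (hC1 M x).trans (le_abs_self _)
  have h1 : (1 + ((2 * M + 1 : ℕ) ^ d : ℕ) : ℝ) ≤ 2 * (2 * M + 1) ^ d := by
    push_cast
    have : (1 : ℝ) ≤ (2 * M + 1) ^ d := one_le_pow₀ (by linarith [Nat.cast_nonneg (α := ℝ) M])
    linarith
  have h2 : (2 * M + 1 : ℝ) ^ (d * K) ≤ 3 ^ (d * K) * (1 + M ^ (d * K)) := by
    rcases Nat.eq_zero_or_pos M with rfl | hM
    · have h3 : (1 : ℝ) ≤ 3 ^ (d * K) := one_le_pow₀ (by norm_num)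
      have h4 : (0 : ℝ) ≤ ((0 : ℕ) : ℝ) ^ (d * K) := by positivity
      have h5 : (2 * ((0 : ℕ) : ℝ) + 1) ^ (d * K) = 1 := by simp
      rw [h5]
      nlinarith
    · have h3 : (1 : ℝ) ≤ M := by exact_mod_cast hM
      calc (2 * M + 1 : ℝ) ^ (d * K) ≤ (3 * M) ^ (d * K) := by gcongr; linarith
        _ = 3 ^ (d * K) * M ^ (d * K) := mul_pow _ _ _
        _ ≤ _ := by gcongr; linarith
  have hr0 := hr M x
  calc (1 + ((2 * M + 1 : ℕ) ^ d : ℕ) : ℝ) ^ K * r M x ≤ (2 * (2 * M + 1) ^ d) ^ K * r M x := by gcongr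
    _ = 2 ^ K * ((2 * M + 1) ^ (d * K) * r M x) := by rw [mul_pow, ← pow_mul]; ring
    _ ≤ 2 ^ K * ((3 ^ (d * K) * (1 + M ^ (d * K))) * r M x) := by gcongr
    _ = 2 ^ K * 3 ^ (d * K) * (r M x + M ^ (d * K) * r M x) := by ring
    _ ≤ 2 ^ K * 3 ^ (d * K) * (|C0| + |C1|) := by gcongr
    _ ≤ _ := by linarith

theorem norm_corner_circle_smul {A : Type*} [CStarAlgebra A] (p q x : A) (c : Circle) :
    ‖p * ((c : ℂ) • x) * q‖ = ‖p * x * q‖ := by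
  rw [mul_smul_comm, smul_mul_assoc, norm_circle_smul]

/-- The off-diagonal corner of a matrix entry. -/
def cornerEntry {ι : Type*} (i j : ι) :
    (SqSum ι (DoubleSpace N) →L[ℂ] SqSum ι (DoubleSpace N)) →L[ℂ]
      (DoubleSpace N →L[ℂ] DoubleSpace N) :=
  LinearMap.mkContinuous
    { toFun := fun T => diagProj N * entryCLM i j T * (1 - diagProj N)
      map_add' := fun S T => by rw [map_add, mul_add, add_mul]
      map_smul' := fun c T => by
        rw [map_smul, mul_smul_comm, smul_mul_assoc, RingHom.id_apply] }
    1 fun T => by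
      rw [one_mul]
      refine (norm_mul_mul_le_of_norm_le_one norm_diagProj_le norm_compl_diagProj_le).trans ?_
      exact (ContinuousLinearMap.le_opNorm (entryCLM (F := DoubleSpace N) i j) T).trans
        (mul_le_of_le_one_left (norm_nonneg T) (norm_entryCLM_le i j))

theorem norm_cornerEntry_le {ι : Type*} (i j : ι) : ‖cornerEntry (N := N) i j‖ ≤ 1 :=
  LinearMap.mkContinuous_norm_le _ zero_le_one _

variable [CompactSpace Ω₀] {φ : Matrix (Fin d) (Fin d) ℝ}

/-- The `⋆`-homomorphisms of two `C⋆`-algebras. -/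
abbrev CStarHom (A B : Type*) [CStarAlgebra A] [CStarAlgebra B] := A →⋆ₐ[ℂ] B

/-- The torus action in angular coordinates. -/
def gaugeOrbit (θ : Fin d → ℝ) : CStarHom (Bulk d N Ω₀ φ) (Bulk d N Ω₀ φ) :=
  bulkGauge fun j => Circle.exp (θ j)

theorem gaugeOrbit_add (θ θ' : Fin d → ℝ) (a : Bulk d N Ω₀ φ) :
    gaugeOrbit (θ + θ') a = gaugeOrbit θ (gaugeOrbit θ' a) := by
  rw [gaugeOrbit, gaugeOrbit, gaugeOrbit, bulkGauge_bulkGauge]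
  congr 2
  funext j
  exact Circle.exp_add _ _

/-- The degenerate case, such as N = 0 or empty Ω₀: 1 = 0 holds in the bulk algebra, and the pair
representation with its nonzero target is not at hand. -/
theorem isSmoothLocalized_of_subsingleton [Subsingleton (CN d N Ω₀)] (a : Bulk d N Ω₀ φ) :
    IsSmoothLocalized a := by
  have hs : Subsingleton (Bulk d N Ω₀ φ) := by
    refine subsingleton_of_zero_eq_one ?_
    rw [← map_zero (bulkFun φ), ← map_one (bulkFun φ), Subsingleton.elim (0 : CN d N Ω₀) 1]
  refine ⟨fun n => contDiff_of_subsingleton, fun _ => 0, fun x => Subsingleton.elim _ _,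
    fun K => ⟨1, one_pos, fun M ω ω' _ x => ?_⟩⟩
  rw [ContinuousMap.zero_apply, ContinuousMap.zero_apply, sub_zero, norm_zero]
  positivity

variable [Nontrivial (CN d N Ω₀)]

/-- The weighted conjugation orbit in the pair representation. -/
def pairOrbit (N : ℕ) (Ω₀ : Type u) [TopologicalSpace Ω₀] [CompactSpace Ω₀]
    [Nontrivial (CN d N Ω₀)] (hφ : φ.transpose = -φ) (s : ℝ) :
    CStarHom (Bulk d N Ω₀ φ) (PairOp d N Ω₀) :=
  (weightConj N pairWeight s).comp (pairHom N Ω₀ hφ)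

/-- No action on the bulk algebra itself is required. Covariance through conjugations of the target
is enough for uniform bounds on the derivatives of the orbit. -/
theorem pairOrbit_add (hφ : φ.transpose = -φ) (s t : ℝ) (a : Bulk d N Ω₀ φ) :
    pairOrbit N Ω₀ hφ (s + t) a = weightConj N pairWeight s (pairOrbit N Ω₀ hφ t a) :=
  (weightConj_weightConj _ s t _).symm

theorem norm_eq_norm_bulkComponent (hφ : φ.transpose = -φ) {a : Bulk d N Ω₀ φ} {x : Fin d → ℤ}
    {h : CN d N Ω₀} (hh : bulkFun φ h = bulkFourierCoeff x a) : ‖h‖ = ‖bulkComponent x a‖ := by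
  rw [← norm_bulkFourierCoeff, ← hh]
  exact (NonUnitalStarAlgHom.norm_map (bulkFun φ) (bulkFun_injective hφ) h).symm

/-- Fourier inversion presents the image of `a` as a series of monomial operators. Condition (a1)
gives decay of the coefficients in x, and (a2) gives decay of their off-diagonal corners in the
weight. -/
theorem HasSmoothOrbit.of_isSmoothLocalized (hφ : φ.transpose = -φ) {a : Bulk d N Ω₀ φ}
    (ha : IsSmoothLocalized a) : HasSmoothOrbit (pairOrbit N Ω₀ hφ) a := by
  obtain ⟨ha, h, hh, hA⟩ := ha
  have hnorm : ∀ x, ‖h x‖ = ‖bulkComponent x a‖ := fun x => norm_eq_norm_bulkComponent hφ (hh x)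
  choose c hc using fun x => exists_pairHom_bulkComponent (N := N) (Ω₀ := Ω₀) hφ (hh x)
  have hB : ∃ B : ℝ, ∀ x ω, ‖h x ω‖ ≤ B := by
    obtain ⟨C, -, hC⟩ := exists_norm_bulkComponent_le ha 0
    refine ⟨C, fun x ω => ((h x).norm_coe_le_norm ω).trans ?_⟩
    rw [hnorm]
    simpa using hC x
  obtain ⟨B, hB⟩ := hB
  have hsum : HasSum (fun x => monomialOp (siteShift Ω₀ x)
      (bddFamily fun i => (c x i : ℂ) • siteHom N i (h x))) (pairHom N Ω₀ hφ a) := by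
    have := (hasSum_bulkComponent ha).map (pairHom N Ω₀ hφ) (pairHom N Ω₀ hφ).continuous_of_cstar
    rwa [show (pairHom N Ω₀ hφ ∘ fun x => bulkComponent x a) = _ from funext hc] at this
  refine fun n => contDiff_weightConj pairWeight_nonneg abs_pairWeight_sub_le ?_ ?_ ?_ hsum n
  · intro k
    obtain ⟨C, -, hC⟩ := exists_norm_bulkComponent_le ha k
    refine ⟨C, fun x i => le_trans ?_ (hC x)⟩
    rw [← hnorm]
    exact mul_le_mul_of_nonneg_left (norm_smul_siteHom_le (h x) (c x) i) (by positivity)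
  · intro k
    obtain ⟨C, hC⟩ := exists_pairWeight_pow_mul_le hB hA k
    refine ⟨C, fun x i => le_trans ?_ (hC x i)⟩
    refine mul_le_mul_of_nonneg_left ?_ (pow_nonneg (pairWeight_nonneg i) k)
    exact (norm_corner_circle_smul _ _ _ (c x i)).trans_le (norm_corner_le _ _)
  · intro k
    obtain ⟨C, hC⟩ := exists_pairWeight_pow_mul_le hB hA k
    refine ⟨C, fun x i => le_trans ?_ (hC x i)⟩
    refine mul_le_mul_of_nonneg_left ?_ (pow_nonneg (pairWeight_nonneg i) k)
    exact (norm_corner_circle_smul _ _ _ (c x i)).trans_le (norm_corner_le' _ _)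

/-- Distinct lattice vectors displace a site differently, so exactly one Fourier component
contributes to a given entry. The entries thus recover the Fourier coefficients up to a phase. -/
theorem entryCLM_pairHom (hφ : φ.transpose = -φ) {a : Bulk d N Ω₀ φ} (ha : IsSmoothElement a)
    {h : (Fin d → ℤ) → CN d N Ω₀} (hh : ∀ x, bulkFun φ (h x) = bulkFourierCoeff x a)
    (x : Fin d → ℤ) (i : PairSite d Ω₀) :
    ∃ c : Circle, entryCLM i (siteShift Ω₀ x i) (pairHom N Ω₀ hφ a)
      = (c : ℂ) • siteHom N i (h x) := by
  choose c hc using fun x => exists_pairHom_bulkComponent (N := N) (Ω₀ := Ω₀) hφ (hh x)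
  refine ⟨c x i, ?_⟩
  have h1 := ((hasSum_bulkComponent ha).map (pairHom N Ω₀ hφ)
    (pairHom N Ω₀ hφ).continuous_of_cstar).mapL (entryCLM i (siteShift Ω₀ x i))
  refine h1.unique ?_
  have h2 : (c x i : ℂ) • siteHom N i (h x) = entryCLM i (siteShift Ω₀ x i)
      ((pairHom N Ω₀ hφ ∘ fun x => bulkComponent x a) x) := by
    rw [Function.comp_apply, hc, entryCLM_monomialOp,
      bddFamily_apply (norm_smul_siteHom_le (h x) (c x))]
  rw [h2]
  refine hasSum_single x fun y hy => ?_
  rw [Function.comp_apply, hc]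
  refine entryCLM_monomialOp_of_ne _ fun he => hy ?_
  have h3 : i.2 - y = i.2 - x := congrArg Prod.snd he
  exact sub_right_injective h3

/-- The derivatives of the orbit at the origin control the variation of the Fourier coefficients. -/
theorem pow_mul_norm_sub_le (hφ : φ.transpose = -φ) {a : Bulk d N Ω₀ φ} (ha : IsSmoothElement a)
    (hp : HasSmoothOrbit (pairOrbit N Ω₀ hφ) a)
    {h : (Fin d → ℤ) → CN d N Ω₀} (hh : ∀ x, bulkFun φ (h x) = bulkFourierCoeff x a)
    (k M : ℕ) {ω ω' : Config d Ω₀} (hω : ∀ y ∈ cube d M, ω y = ω' y) (x : Fin d → ℤ) :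
    (M : ℝ) ^ k * ‖h x ω - h x ω'‖
      ≤ 4 * ‖iteratedFDeriv ℝ k (fun s => pairOrbit N Ω₀ hφ s a) 0‖ := by
  -- With the marked point at the origin the weight is exactly M, and the site sees the unshifted
  -- configurations.
  set i : PairSite d Ω₀ := (⟨(M, ω, ω'), hω⟩, 0) with hi
  obtain ⟨c, hc⟩ := entryCLM_pairHom hφ ha hh x i
  have hosc := abs_pow_mul_norm_le_of_oscillation
    ((cornerEntry (N := N) i (siteShift Ω₀ x i)).restrictScalars ℝ)
    ((ContinuousLinearMap.norm_restrictScalars _).trans_le (norm_cornerEntry_le _ _)) (hp k)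
    (fun s => corner_entryCLM_weightConj pairWeight s i (siteShift Ω₀ x i) (pairHom N Ω₀ hφ a))
  have hs : ∀ ω : Config d Ω₀, shift (0 : Fin d → ℤ) ω = ω := fun ω => by rw [shift_zero]; rfl
  have hsite : siteHom N i (h x) = blockDiagHom N (h x ω, h x ω') := by
    have h1 := siteHom_apply i (h x)
    change _ = blockDiagHom N (h x (shift 0 ω), h x (shift 0 ω')) at h1
    rwa [hs, hs] at h1
  have hw : (M : ℝ) ≤ |pairWeight i + pairWeight (siteShift Ω₀ x i)| := by
    have h1 : pairWeight i = M := by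
      change ((M - latticeLen (0 : Fin d → ℤ) : ℕ) : ℝ) = _
      rw [latticeLen_zero, Nat.sub_zero]
    rw [h1]
    exact (le_add_of_nonneg_right (pairWeight_nonneg _)).trans (le_abs_self _)
  rw [hc, hsite, norm_corner_circle_smul] at hosc
  calc (M : ℝ) ^ k * ‖h x ω - h x ω'‖
      ≤ (M : ℝ) ^ k * (4 * ‖diagProj N * blockDiagHom N (h x ω, h x ω') * (1 - diagProj N)‖) :=
        mul_le_mul_of_nonneg_left (norm_sub_le_norm_corner _ _) (by positivity)
    _ = 4 * ((M : ℝ) ^ k * ‖diagProj N * blockDiagHom N (h x ω, h x ω') * (1 - diagProj N)‖) :=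
        mul_left_comm _ _ _
    _ ≤ _ := by
      refine mul_le_mul_of_nonneg_left (le_trans ?_ hosc) zero_le_four
      exact mul_le_mul_of_nonneg_right (pow_le_pow_left₀ (Nat.cast_nonneg _) hw k) (norm_nonneg _)

theorem isLocalizedElement_of_hasSmoothOrbit (hφ : φ.transpose = -φ) {a : Bulk d N Ω₀ φ}
    (ha : IsSmoothElement a) (hp : HasSmoothOrbit (pairOrbit N Ω₀ hφ) a) :
    IsLocalizedElement a := by
  choose h hh using fun x =>
    bulkFourierCoeff_mem_range (bulkFun_injective (N := N) (Ω₀ := Ω₀) hφ) x a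
  refine ⟨h, hh, fun K => ?_⟩
  -- The pair of configurations and the lattice vector are bundled into one index, so that the
  -- constant is uniform in all of them.
  obtain ⟨A, hA0, hA⟩ := exists_le_div_card_pow
    (X := fun M => {p : Config d Ω₀ × Config d Ω₀ // ∀ y ∈ cube d M, p.1 y = p.2 y} × (Fin d → ℤ))
    (r := fun M p => ‖h p.2 p.1.1.1 - h p.2 p.1.1.2‖) (fun M p => norm_nonneg _)
    (fun k => ⟨_, fun M p => pow_mul_norm_sub_le hφ ha hp hh k M p.1.2 p.2⟩) d K
  exact ⟨A, hA0, fun M ω ω' hω x => hA M (⟨(ω, ω'), hω⟩, x)⟩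

/-- This turns the decay conditions into regularity of orbits, for which stability under the
algebraic operations and functional calculi is known. -/
theorem isSmoothLocalized_iff (hφ : φ.transpose = -φ) {a : Bulk d N Ω₀ φ} :
    IsSmoothLocalized a ↔
      HasSmoothOrbit gaugeOrbit a ∧ HasSmoothOrbit (pairOrbit N Ω₀ hφ) a :=
  ⟨fun h => ⟨h.1, HasSmoothOrbit.of_isSmoothLocalized hφ h⟩,
    fun h => ⟨h.1, isLocalizedElement_of_hasSmoothOrbit hφ h.1 h.2⟩⟩

end SmoothLocalized
end

/-- The elements of the algebra of bulk observables that are smooth and whose Fourier coefficients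
are localized with respect to the disorder configuration form a subalgebra, stable under products,
inverses, holomorphic calculus, and smooth calculus on self-adjoint elements. -/
theorem mainTheorem8 {d N : ℕ} {Ω₀ : Type u} [TopologicalSpace Ω₀] [CompactSpace Ω₀]
    [TopologicalSpace.MetrizableSpace Ω₀] (φ : Matrix (Fin d) (Fin d) ℝ)
    (hφ : φ.transpose = -φ) :
    (∀ a b : Bulk d N Ω₀ φ, IsSmoothLocalized a → IsSmoothLocalized b →
      IsSmoothLocalized (a * b)) ∧
    (∀ a : (Bulk d N Ω₀ φ)ˣ, IsSmoothLocalized (a : Bulk d N Ω₀ φ) →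
      IsSmoothLocalized ((a⁻¹ : (Bulk d N Ω₀ φ)ˣ) : Bulk d N Ω₀ φ)) ∧
    (∃ S : Subalgebra ℂ (Bulk d N Ω₀ φ), ∀ a, a ∈ S ↔ IsSmoothLocalized a) ∧
    (∀ (a b : Bulk d N Ω₀ φ) (U : Set ℂ) (f : ℂ → ℂ), IsSmoothLocalized a → IsOpen U →
      spectrum ℂ a ⊆ U → DifferentiableOn ℂ f U → IsHolomorphicCalculus U f a b →
      IsSmoothLocalized b) ∧
    (∀ (h : Bulk d N Ω₀ φ) (U : Set ℝ) (G : ℝ → ℂ), IsSmoothLocalized h → IsSelfAdjoint h →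
      IsOpen U → spectrum ℝ h ⊆ U → (∀ n : ℕ, ContDiffOn ℝ n G U) →
      IsSmoothLocalized (cfc (fun z : ℂ => G z.re) h)) := by
  -- The pair representation is available only when C_N(Ω) is nonzero.
  rcases subsingleton_or_nontrivial (CN d N Ω₀) with hs | hs
  · have h := isSmoothLocalized_of_subsingleton (d := d) (N := N) (Ω₀ := Ω₀) (φ := φ)
    exact ⟨fun _ _ _ _ => h _, fun _ _ => h _, ⟨⊤, fun a => iff_of_true trivial (h a)⟩,
      fun _ _ _ _ _ _ _ _ _ => h _, fun _ _ _ _ _ _ _ _ => h _⟩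
  have key := fun a : Bulk d N Ω₀ φ => isSmoothLocalized_iff (a := a) hφ
  refine ⟨fun a b ha hb => ?_, fun a ha => ?_, ?_, fun a b U f ha _ _ hf hb => ?_,
    fun h U G hh sa hU hKU hG => ?_⟩
  · rw [key] at *
    exact ⟨ha.1.mul hb.1, ha.2.mul hb.2⟩
  · rw [key] at *
    exact ⟨ha.1.unit_inv, ha.2.unit_inv⟩
  · refine ⟨{
      carrier := {a | IsSmoothLocalized a}
      mul_mem' := ?_
      add_mem' := ?_
      algebraMap_mem' := fun c =>
        (key _).2 ⟨HasSmoothOrbit.of_algebraMap c, HasSmoothOrbit.of_algebraMap c⟩ },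
      fun a => Iff.rfl⟩
    · intro a b ha hb
      exact (key _).2 ⟨((key _).1 ha).1.mul ((key _).1 hb).1, ((key _).1 ha).2.mul ((key _).1 hb).2⟩
    · intro a b ha hb
      exact (key _).2 ⟨((key _).1 ha).1.add ((key _).1 hb).1, ((key _).1 ha).2.add ((key _).1 hb).2⟩
  · rw [key] at *
    exact ⟨ha.1.holomorphicCalculus hf.continuousOn hb, ha.2.holomorphicCalculus hf.continuousOn hb⟩
  · rw [key] at *
    -- The torus orbit is covariant under the torus action itself, the pair orbit under conjugation
    -- by the weight unitaries.
    exact ⟨hh.1.cfc_of_contDiffOn (β := gaugeOrbit) gaugeOrbit_add sa hU hKU hG,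
      hh.2.cfc_of_contDiffOn (β := weightConj N pairWeight) (pairOrbit_add hφ) sa hU hKU hG⟩
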